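/- Let $k$ be a field, let $n \ge 3$ be odd and let $q \in k$ be a primitive $n$-th root of unity. Let $u_q(\mathfrak{sl}_2)$ be the $k$-algebra generated by $E, F, K$ with relations $K^n = 1$, $E^n = F^n = 0$, $KE = q^2 EK$, $KF = q^{-2} FK$, $EF - FE = \frac{K - K^{-1}}{q - q^{-1}}$ (where $K^{-1} = K^{n-1}$), made into a Hopf algebra by $\Delta(K) = K \otimes K$, $\Delta(E) = 1 \otimes E + E \otimes K$, $\Delta(F) = K^{-1} \otimes F + F \otimes 1$, $\epsilon(K) = 1$, $\epsilon(E) = \epsilon(F) = 0$, $S(K) = K^{-1}$, $S(E) = -EK^{-1}$, $S(F) = -KF$. For a finite-dimensional Hopf algebra $H$, the Drinfel'd double $D(H)$ is the coalgebra $H^{*\mathrm{cop}} \otimes H$ (write $p \bowtie x$ for $p \otimes x$) with product $(p \bowtie x)(p' \bowtie y) = p\,(x_1 \succ p' \prec S^{-1}(x_3)) \bowtie x_2 y$, where $H^*$ has the convolution product, $\langle x \succ p, y\rangle = \langle p, yx \rangle$ and $\langle p \prec x, y \rangle = \langle p, xy \rangle$; its unit is $\epsilon \bowtie 1$ and its antipode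 is $S(p \bowtie x) = (\epsilon \bowtie S(x))(p \circ S^{-1} \bowtie 1)$. Let $\rho : u_q(\mathfrak{sl}_2) \to M_2(k)$ be the representation with $\rho(E) = \begin{pmatrix} 0&1\\0&0\end{pmatrix}$, $\rho(F) = \begin{pmatrix} 0&0\\1&0\end{pmatrix}$, $\rho(K) = \begin{pmatrix} q&0\\0&q^{-1}\end{pmatrix}$, and write $\rho(x) = \begin{pmatrix} A(x) & B(x) \\ C(x) & D(x) \end{pmatrix}$ with $A, B, C, D \in u_q(\mathfrak{sl}_2)^*$ (these are the images of the generators $a,b,c,d$ of $\overline{\mathcal O_q(SL_2)}$ under the usual isomorphism $\overline{\mathcal O_q(SL_2)} \cong u_q(\mathfrak{sl}_2)^*$). In $D(u_q(\mathfrak{sl}_2))$ put $a = A \bowtie 1$, $b = B \bowtie 1$, $c = C \bowtie 1$, $d = D \bowtie 1$, and write $E, F, K$ for $\epsilon \bowtie E$, $\epsilon \bowtie F$, $\epsilon \bowtie K$. Then the algebra $D(u_q(\mathfrak{sl}_2))$ is generated by $a, b, c, d, E, F, K$ subject to exactly the following (defining) relations: $$a^n = d^n = K^n = 1, \quad b^n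 = c^n = E^n = F^n = 0,$$ $$ba = qab, \quad db = qbd, \quad ca = qac, \quad dc = qcd, \quad bc = cb, \quad ad = q^{-1}bc + 1,$$ $$KE = q^2 EK, \quad KF = q^{-2}FK, \quad EF - FE = \frac{K - K^{-1}}{q - q^{-1}},$$ $$Ka = aK, \quad Kb = q^{-2}bK, \quad Kc = q^2 cK, \quad Kd = dK,$$ $$Ea = q^{-1}aE - q^{-1}c, \quad Eb = q^{-1}bE + q^{-1}aK - q^{-1}d, \quad Ec = qcE, \quad Ed = qdE + qcK,$$ $$Fa = q^{-1}aF + b, \quad Fb = qbF, \quad Fc = q^{-1}cF - aK^{-1} + d, \quad Fd = qdF - q^2 bK^{-1},$$ where $K^{-1} = K^{n-1}$. The comultiplication and counit are given by $$\Delta(a) = a \otimes a + c \otimes b, \quad \Delta(b) = b \otimes a + d \otimes b, \quad \Delta(c) = a \otimes c + c \otimes d, \quad \Delta(d) = b \otimes c + d \otimes d,$$ $$\Delta(K) = K \otimes K, \quad \Delta(E) = 1 \otimes E + E \otimes K, \quad \Delta(F) = K^{-1} \otimes F + F \otimes 1,$$ $$\epsilon(a) = \epsilon(d) = \epsilon(K)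 = 1, \quad \epsilon(b) = \epsilon(c) = \epsilon(E) = \epsilon(F) = 0,$$ and the antipode by $$S(a) = d, \quad S(b) = -q^{-1}b, \quad S(c) = -qc, \quad S(d) = a, \quad S(K) = K^{-1}, \quad S(E) = -EK^{-1}, \quad S(F) = -KF.$$ -/

import Mathlib

open scoped TensorProduct
open Coalgebra HopfAlgebra WithConv

set_option linter.unusedSectionVars false

noncomputable section

namespace QDouble

section Antipode

variable (k : Type*) [Field k] (H : Type*) [Ring H] [HopfAlgebra k H]

/-- The antipode is bijective (always the case for a finite-dimensional Hopf algebra). -/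
class BijectiveAntipode : Prop where
  bijective : Function.Bijective (antipode k (A := H))

variable [BijectiveAntipode k H]

/-- The inverse `S⁻¹` of the antipode. -/
def antipodeInv : H →ₗ[k] H :=
  (LinearEquiv.ofBijective (antipode k (A := H)) BijectiveAntipode.bijective).symm.toLinearMap

variable {H}

@[simp] theorem antipodeInv_antipode (a : H) : antipodeInv k H (antipode k a) = a :=
  (LinearEquiv.ofBijective (antipode k (A := H)) BijectiveAntipode.bijective).symm_apply_apply a

@[simp] theorem antipode_antipodeInv (a : H) : antipode k (antipodeInv k H a) = a :=
  (LinearEquiv.ofBijective (antipode k (A := H)) BijectiveAntipode.bijective).apply_symm_apply a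

theorem antipode_inj {a b : H} (h : antipode k a = antipode k b) : a = b :=
  (BijectiveAntipode.bijective (k := k) (H := H)).1 h

@[simp] theorem antipodeInv_one : antipodeInv k H 1 = 1 := antipode_inj k (by simp)

theorem antipodeInv_mul (a b : H) :
    antipodeInv k H (a * b) = antipodeInv k H b * antipodeInv k H a :=
  antipode_inj k (by simp [antipode_mul_antidistrib])

theorem sum_mul_antipodeInv {ι : Type*} {a : H} (r : Repr k a ι) :
    ∑ i ∈ r.index, r.right i * antipodeInv k H (r.left i) = counit (R := k) a • 1 := by
  apply antipode_inj k
  simp only [map_sum, antipode_mul_antidistrib, antipode_antipodeInv, map_smul, antipode_one]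
  exact sum_mul_antipode_eq_smul r

theorem sum_antipodeInv_mul {ι : Type*} {a : H} (r : Repr k a ι) :
    ∑ i ∈ r.index, antipodeInv k H (r.right i) * r.left i = counit (R := k) a • 1 := by
  apply antipode_inj k
  simp only [map_sum, antipode_mul_antidistrib, antipode_antipodeInv, map_smul, antipode_one]
  exact sum_antipode_mul_eq_smul r

end Antipode

section DualCop

variable (k : Type*) [Field k] (H : Type*) [Ring H] [HopfAlgebra k H]

/-- The Hopf algebra `H^{* cop}`: the dual `H^*` with the convolution product
`⟨p q, x⟩ = ⟨p, x₁⟩ ⟨q, x₂⟩` and the opposite of the comultiplication dual to the product. -/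
def DualCop : Type _ := WithConv (H →ₗ[k] k)

namespace DualCop

instance : Ring (DualCop k H) := inferInstanceAs (Ring (WithConv (H →ₗ[k] k)))
instance : Algebra k (DualCop k H) := inferInstanceAs (Algebra k (WithConv (H →ₗ[k] k)))

variable {k H}

/-- A linear functional as an element of the dual. -/
def of (f : H →ₗ[k] k) : DualCop k H := toConv f

/-- An element of the dual as a linear functional. -/
def toLin : DualCop k H ≃ₗ[k] (H →ₗ[k] k) := WithConv.linearEquiv k (H →ₗ[k] k)

instance : CoeFun (DualCop k H) (fun _ => H → k) := ⟨fun p => toLin p⟩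

@[simp] theorem of_apply (f : H →ₗ[k] k) (x : H) : of f x = f x := rfl

@[ext] theorem ext {p q : DualCop k H} (h : ∀ x, p x = q x) : p = q :=
  toLin.injective (LinearMap.ext h)

@[simp] theorem one_apply (x : H) : (1 : DualCop k H) x = counit (R := k) x := rfl

theorem mul_apply {ι : Type*} {x : H} (r : Repr k x ι) (p q : DualCop k H) :
    (p * q) x = ∑ i ∈ r.index, p (r.left i) * q (r.right i) :=
  r.convMul_apply (p : WithConv (H →ₗ[k] k)) q

variable (k H)

/-- `lact a p = a ≻ p`, with `⟨a ≻ p, x⟩ = ⟨p, x a⟩`. -/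
def lact : H →ₐ[k] Module.End k (DualCop k H) :=
  AlgHom.ofLinearMap
    (LinearMap.mk₂ k (fun a p => of (toLin p ∘ₗ LinearMap.mulRight k a))
      (fun a b p => by ext; simp [mul_add]) (fun c a p => by ext; simp)
      (fun a p q => by ext; simp) (fun c a p => by ext; simp))
    (by ext; simp) (fun a b => by ext; simp [mul_assoc])

/-- `ract c p = p ≺ S⁻¹(c)`, with `⟨p ≺ b, x⟩ = ⟨p, b x⟩`. -/
def ract [BijectiveAntipode k H] : H →ₐ[k] Module.End k (DualCop k H) :=
  AlgHom.ofLinearMap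
    (LinearMap.mk₂ k (fun c p => of (toLin p ∘ₗ LinearMap.mulLeft k (antipodeInv k H c)))
      (fun a b p => by ext; simp [add_mul]) (fun c a p => by ext; simp)
      (fun a p q => by ext; simp) (fun c a p => by ext; simp))
    (by ext; simp) (fun a b => by ext; simp [antipodeInv_mul])

variable {k H}

@[simp] theorem lact_apply (a x : H) (p : DualCop k H) : lact k H a p x = p (x * a) := rfl

@[simp] theorem ract_apply [BijectiveAntipode k H] (c x : H) (p : DualCop k H) :
    ract k H c p x = p (antipodeInv k H c * x) := rfl

variable [FiniteDimensional k H]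

/-- For finite-dimensional `H`, the isomorphism `p ⊗ v ↦ (x ↦ ⟨p, x⟩ v)`. -/
def tensorEquiv (V : Type*) [AddCommGroup V] [Module k V] : DualCop k H ⊗[k] V ≃ₗ[k] (H →ₗ[k] V) :=
  (TensorProduct.congr toLin (LinearEquiv.refl k V)).trans (dualTensorHomEquiv k H V)

@[simp] theorem tensorEquiv_tmul {V : Type*} [AddCommGroup V] [Module k V] (p : DualCop k H)
    (v : V) (x : H) : tensorEquiv V (p ⊗ₜ[k] v) x = p x • v := by
  simp [tensorEquiv]

theorem tensor_ext {V : Type*} [AddCommGroup V] [Module k V] {s t : DualCop k H ⊗[k] V}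
    (h : ∀ x, tensorEquiv V s x = tensorEquiv V t x) : s = t :=
  (tensorEquiv V).injective (LinearMap.ext h)

variable (k H) in
/-- The comultiplication of `H^{* cop}`: `Δ(p) = ∑ p' ⊗ p''` with `∑ ⟨p', x⟩ ⟨p'', y⟩ = ⟨p, y x⟩`. -/
def comulCop : DualCop k H →ₗ[k] DualCop k H ⊗[k] DualCop k H :=
  (tensorEquiv (DualCop k H)).symm.toLinearMap ∘ₗ (lact k H).toLinearMap.flip

@[simp] theorem tensorEquiv_comulCop (p : DualCop k H) (x : H) :
    tensorEquiv (DualCop k H) (comulCop k H p) x = lact k H x p := by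
  simp [comulCop]

theorem tensorEquiv_map {V W : Type*} [AddCommGroup V] [Module k V] [AddCommGroup W] [Module k W]
    (f : V →ₗ[k] W) (t : DualCop k H ⊗[k] V) (x : H) :
    tensorEquiv W (f.lTensor _ t) x = f (tensorEquiv V t x) := by
  induction t with
  | zero => simp
  | tmul p v => simp
  | add s t hs ht => simp [hs, ht]

theorem tensorEquiv_assoc (t : DualCop k H ⊗[k] DualCop k H) (x y : H) :
    tensorEquiv _ (tensorEquiv _ (TensorProduct.assoc k _ _ _ ((comulCop k H).rTensor _ t)) x) y =
      tensorEquiv _ t (y * x) := by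
  induction t with
  | zero => simp
  | add s t hs ht => simp [hs, ht]
  | tmul p v =>
    have key : ∀ s : DualCop k H ⊗[k] DualCop k H,
        tensorEquiv _ (tensorEquiv _ (TensorProduct.assoc k _ _ _ (s ⊗ₜ[k] v)) x) y
          = (tensorEquiv _ s x) y • v := by
      intro s
      induction s with
      | zero => simp
      | add s t hs ht => simp [TensorProduct.add_tmul, hs, ht, add_smul]
      | tmul p q => simp [mul_smul]
    simp [key]

instance : Coalgebra k (DualCop k H) where
  comul := comulCop k H
  counit := (LinearMap.applyₗ (1 : H)) ∘ₗ toLin.toLinearMap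
  coassoc := by
    ext p : 1
    refine tensor_ext fun x => tensor_ext fun y => ?_
    simp only [LinearMap.comp_apply, LinearEquiv.coe_coe, tensorEquiv_assoc, tensorEquiv_map,
      tensorEquiv_comulCop]
    simp
  rTensor_counit_comp_comul := by
    ext p : 1
    have key : ∀ s : DualCop k H ⊗[k] DualCop k H,
        LinearMap.rTensor _ ((LinearMap.applyₗ (1 : H)) ∘ₗ toLin.toLinearMap) s
          = (1 : k) ⊗ₜ[k] (tensorEquiv _ s 1) := by
      intro s
      induction s with
      | zero => simp
      | add s t hs ht => simp [hs, ht, TensorProduct.tmul_add]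
      | tmul p q => simp [TensorProduct.smul_tmul']
    simp [key]
  lTensor_counit_comp_comul := by
    ext p : 1
    refine tensor_ext fun x => ?_
    simp [tensorEquiv_map]

@[simp] theorem tensorEquiv_comul (p : DualCop k H) (x : H) :
    tensorEquiv (DualCop k H) (comul (R := k) p) x = lact k H x p :=
  tensorEquiv_comulCop p x

@[simp] theorem counit_apply (p : DualCop k H) : counit (R := k) p = p 1 := rfl

theorem pair_comul (p : DualCop k H) {ι : Type*} (r : Repr k p ι) (x y : H) :
    ∑ i ∈ r.index, r.left i x * r.right i y = p (y * x) := by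
  have h := tensorEquiv_comul p x
  rw [← r.eq] at h
  have := congrArg (fun q : DualCop k H => q y) h
  simpa using this

theorem tensorEquiv_mul (s t : DualCop k H ⊗[k] DualCop k H) {ι κ : Type*} {x y : H}
    (r : Repr k x ι) (r' : Repr k y κ) :
    tensorEquiv _ (s * t) x y = ∑ i ∈ r.index, ∑ j ∈ r'.index,
      tensorEquiv _ s (r.left i) (r'.left j) * tensorEquiv _ t (r.right i) (r'.right j) := by
  induction s with
  | zero => simp
  | add s s' hs hs' => simp [add_mul, hs, hs', Finset.sum_add_distrib]
  | tmul p p' =>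
    induction t with
    | zero => simp
    | add s s' hs hs' => simp [mul_add, hs, hs', Finset.sum_add_distrib]
    | tmul q q' =>
      simp only [Algebra.TensorProduct.tmul_mul_tmul, tensorEquiv_tmul, map_smul,
        LinearMap.smul_apply, smul_eq_mul, mul_apply r, mul_apply r', Finset.sum_mul_sum]
      exact Finset.sum_congr rfl fun i _ => Finset.sum_congr rfl fun j _ => by ring

instance : Bialgebra k (DualCop k H) :=
  Bialgebra.mk' k (DualCop k H) (by simp)
    (by
      intro p q
      have : comul (R := k) (1 : H) = 1 ⊗ₜ 1 := by simp [Algebra.TensorProduct.one_def]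
      let r : Repr k (1 : H) Unit := ⟨{()}, fun _ => 1, fun _ => 1, by simp [this]⟩
      simp [mul_apply r, r])
    (by
      refine tensor_ext fun x => ?_
      ext y
      simp [Algebra.TensorProduct.one_def, mul_comm])
    (by
      intro p q
      refine tensor_ext fun x => ?_
      ext y
      rw [tensorEquiv_mul _ _ (ℛ k x) (ℛ k y)]
      simp only [tensorEquiv_comul, lact_apply]
      rw [mul_apply ((ℛ k y).mul (ℛ k x))]
      simp only [Repr.mul_index, Repr.mul_left, Repr.mul_right, Finset.sum_product]
      exact Finset.sum_comm)

variable [BijectiveAntipode k H]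

variable (k H) in
/-- The antipode `p ↦ p ∘ S⁻¹` of `H^{* cop}`. -/
def antipodeCop : DualCop k H →ₗ[k] DualCop k H where
  toFun p := of (toLin p ∘ₗ antipodeInv k H)
  map_add' p q := by ext; simp
  map_smul' c p := by ext; simp

instance : HopfAlgebra k (DualCop k H) where
  antipode := antipodeCop k H
  mul_antipode_rTensor_comul := by
    ext p x
    simp only [LinearMap.comp_apply]
    rw [← (ℛ k p).eq]
    have h : ∀ i, ∀ r : Repr k x (H × H), ((antipodeCop k H ((ℛ k p).left i)) * (ℛ k p).right i) x =
      ∑ j ∈ r.index, (ℛ k p).left i (antipodeInv k H (r.left j)) * (ℛ k p).right i (r.right j) := by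
      intro i r
      rw [mul_apply r]; rfl
    simp only [map_sum, LinearMap.rTensor_tmul, LinearMap.mul'_apply, LinearMap.sum_apply]
    simp only [h _ (ℛ k x)]
    rw [Finset.sum_comm]
    simp only [pair_comul]
    rw [← map_sum, sum_mul_antipodeInv]
    simp [Algebra.algebraMap_eq_smul_one, mul_comm]
  mul_antipode_lTensor_comul := by
    ext p x
    simp only [LinearMap.comp_apply]
    rw [← (ℛ k p).eq]
    have h : ∀ i, ∀ r : Repr k x (H × H), ((ℛ k p).left i * antipodeCop k H ((ℛ k p).right i)) x =
      ∑ j ∈ r.index, (ℛ k p).left i (r.left j) * (ℛ k p).right i (antipodeInv k H (r.right j)) := by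
      intro i r
      rw [mul_apply r]; rfl
    simp only [map_sum, LinearMap.lTensor_tmul, LinearMap.mul'_apply, LinearMap.sum_apply]
    simp only [h _ (ℛ k x)]
    rw [Finset.sum_comm]
    simp only [pair_comul]
    rw [← map_sum, sum_antipodeInv_mul]
    simp [Algebra.algebraMap_eq_smul_one, mul_comm]

theorem antipode_apply (p : DualCop k H) (x : H) :
    antipode k p x = p (antipodeInv k H x) := rfl

end DualCop
end DualCop
section Conv

variable {k : Type*} [Field k] {H : Type*} [Ring H] [HopfAlgebra k H]
  {V W : Type*} [AddCommGroup V] [Module k V] [AddCommGroup W] [Module k W]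

/-- If `f, g` are algebra maps with commuting images, so is `a ↦ f(a₁) g(a₂)`. -/
def convHom {B : Type*} [Semiring B] [Algebra k B] (f g : H →ₐ[k] B)
    (h : ∀ x y, Commute (f x) (g y)) : H →ₐ[k] B :=
  (Algebra.TensorProduct.lift f g h).comp (Bialgebra.comulAlgHom k H)

/-- The convolution product of linear maps into an algebra. -/
def cv {B : Type*} [Semiring B] [Algebra k B] (f g : H →ₗ[k] B) : H →ₗ[k] B :=
  (toConv f * toConv g).ofConv

theorem cv_apply {B : Type*} [Semiring B] [Algebra k B] (f g : H →ₗ[k] B) {ι : Type*} {a : H}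
    (r : Repr k a ι) : cv f g a = ∑ i ∈ r.index, f (r.left i) * g (r.right i) :=
  r.convMul_apply (toConv f) (toConv g)

theorem cv_assoc {B : Type*} [Semiring B] [Algebra k B] (f g h : H →ₗ[k] B) :
    cv (cv f g) h = cv f (cv g h) :=
  congrArg WithConv.ofConv (mul_assoc (toConv f) (toConv g) (toConv h))

theorem convHom_toLinearMap {B : Type*} [Semiring B] [Algebra k B] (f g : H →ₐ[k] B)
    (h : ∀ x y, Commute (f x) (g y)) :
    (convHom f g h).toLinearMap = cv f.toLinearMap g.toLinearMap := by
  ext a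
  rw [cv_apply _ _ (ℛ k a)]
  simp only [convHom, AlgHom.toLinearMap_apply, AlgHom.comp_apply, Bialgebra.comulAlgHom_apply]
  conv_lhs => rw [← (ℛ k a).eq]
  simp

theorem convHom_apply {B : Type*} [Semiring B] [Algebra k B] (f g : H →ₐ[k] B)
    (h : ∀ x y, Commute (f x) (g y)) (a : H) :
    convHom f g h a = cv f.toLinearMap g.toLinearMap a :=
  LinearMap.congr_fun (convHom_toLinearMap f g h) a

/-- Intertwiners are compatible with convolution. -/
theorem cv_intertwine (m : V →ₗ[k] W) {X Y : H →ₗ[k] Module.End k W} {X' Y' : H →ₗ[k] Module.End k V}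
    (hX : ∀ a, X a ∘ₗ m = m ∘ₗ X' a) (hY : ∀ a, Y a ∘ₗ m = m ∘ₗ Y' a) (a : H) :
    cv X Y a ∘ₗ m = m ∘ₗ cv X' Y' a := by
  rw [cv_apply _ _ (ℛ k a), cv_apply _ _ (ℛ k a)]
  ext v
  simp only [LinearMap.comp_apply, LinearMap.sum_apply, map_sum, Module.End.mul_apply]
  refine Finset.sum_congr rfl fun i _ => ?_
  have h1 := LinearMap.congr_fun (hY ((ℛ k a).right i)) v
  have h2 := LinearMap.congr_fun (hX ((ℛ k a).left i)) (Y' ((ℛ k a).right i) v)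
  simp only [LinearMap.comp_apply] at h1 h2
  rw [h1, h2]

theorem cv_congr_comp (m : V →ₗ[k] W) {X Y Y' : H →ₗ[k] Module.End k W}
    (hY : ∀ a, Y a ∘ₗ m = Y' a ∘ₗ m) (a : H) : cv X Y a ∘ₗ m = cv X Y' a ∘ₗ m := by
  rw [cv_apply _ _ (ℛ k a), cv_apply _ _ (ℛ k a)]
  ext v
  simp only [LinearMap.comp_apply, LinearMap.sum_apply, Module.End.mul_apply]
  refine Finset.sum_congr rfl fun i _ => ?_
  have h1 := LinearMap.congr_fun (hY ((ℛ k a).right i)) v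
  simp only [LinearMap.comp_apply] at h1
  rw [h1]

theorem cv_cancel (m : V →ₗ[k] W) {Z X : H →ₗ[k] Module.End k W}
    (hZ : ∀ a, Z a ∘ₗ m = counit (R := k) a • m) (hZX : ∀ a b, Commute (Z a) (X b)) (a : H) :
    cv Z X a ∘ₗ m = X a ∘ₗ m := by
  rw [cv_apply _ _ (ℛ k a)]
  ext v
  simp only [LinearMap.comp_apply, LinearMap.sum_apply, (hZX _ _).eq, Module.End.mul_apply]
  have h : ∀ b, Z b (m v) = counit (R := k) b • m v := fun b => LinearMap.congr_fun (hZ b) v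
  simp only [h]
  conv_rhs => rw [← sum_counit_smul (ℛ k a)]
  simp

theorem cv_commute {B : Type*} [Semiring B] [Algebra k B] {f g : H →ₗ[k] B} {b : B}
    (hf : ∀ x, Commute (f x) b) (hg : ∀ x, Commute (g x) b) (a : H) : Commute (cv f g a) b := by
  rw [cv_apply _ _ (ℛ k a)]
  exact Finset.sum_induction _ (fun x => Commute x b) (fun _ _ => Commute.add_left)
    (Commute.zero_left _) fun i _ => (hf _).mul_left (hg _)

theorem comul_antipode (a : H) : comul (R := k) (antipode k a) =
    TensorProduct.map (antipode k) (antipode k) (TensorProduct.comm k H H (comul a)) := by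
  let iL : H →ₐ[k] H ⊗[k] H := Algebra.TensorProduct.includeLeft
  let iR : H →ₐ[k] H ⊗[k] H := Algebra.TensorProduct.includeRight
  have hδ : toConv (comul (R := k) (A := H)) = toConv iL.toLinearMap * toConv iR.toLinearMap := by
    ext x
    rw [(ℛ k x).convMul_apply]
    conv_lhs => rw [ofConv_toConv, ← (ℛ k x).eq]
    simp [iL, iR]
  have hG : toConv (TensorProduct.map (antipode k) (antipode k) ∘ₗ
      (TensorProduct.comm k H H).toLinearMap ∘ₗ comul (R := k) (A := H)) =
      toConv (iR.toLinearMap ∘ₗ antipode k) * toConv (iL.toLinearMap ∘ₗ antipode k) := by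
    ext x
    rw [(ℛ k x).convMul_apply]
    rw [ofConv_toConv, LinearMap.comp_apply, LinearMap.comp_apply]
    conv_lhs => rw [← (ℛ k x).eq]
    simp [iL, iR]
  have hinv : ∀ i : H →ₐ[k] H ⊗[k] H,
      toConv (i.toLinearMap ∘ₗ antipode k) * toConv i.toLinearMap = 1 := by
    intro i
    ext x
    rw [(ℛ k x).convMul_apply]
    have := congrArg i (sum_antipode_mul_eq_smul (ℛ k x))
    simp only [map_sum, map_mul] at this
    simpa [Algebra.algebraMap_eq_smul_one] using this
  have hleft : toConv (TensorProduct.map (antipode k) (antipode k) ∘ₗ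
      (TensorProduct.comm k H H).toLinearMap ∘ₗ comul (R := k) (A := H)) * toConv comul = 1 := by
    rw [hG, hδ, mul_assoc, ← mul_assoc (toConv (iL.toLinearMap ∘ₗ antipode k)), hinv, one_mul, hinv]
  have := left_inv_eq_right_inv hleft LinearMap.comul_right_inv
  exact (LinearMap.congr_fun (congrArg WithConv.ofConv this) a).symm

/-- If `Δ(c) = ∑ cᵢ ⊗ dᵢ` then `Δ(S⁻¹(c)) = ∑ S⁻¹(dᵢ) ⊗ S⁻¹(cᵢ)`. -/
def reprAntipodeInv [BijectiveAntipode k H] {ι : Type*} {c : H} (r : Repr k c ι) :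
    Repr k (antipodeInv k H c) ι where
  index := r.index
  left i := antipodeInv k H (r.right i)
  right i := antipodeInv k H (r.left i)
  eq := by
    have h := comul_antipode (k := k) (antipodeInv k H c)
    rw [antipode_antipodeInv, ← r.eq] at h
    have h2 := congrArg (fun t => TensorProduct.comm k H H
      (TensorProduct.map (antipodeInv k H) (antipodeInv k H) t)) h
    have h3 : ∀ t : H ⊗[k] H, TensorProduct.comm k H H
      (TensorProduct.map (antipodeInv k H) (antipodeInv k H)
        (TensorProduct.map (antipode k) (antipode k) (TensorProduct.comm k H H t))) = t := by
      intro t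
      induction t with
      | zero => simp
      | add s t hs ht => simp only [map_add, hs, ht]
      | tmul x y => simp
    simp only [h3] at h2
    rw [← h2]
    simp

end Conv

section Double

variable {k : Type*} [Field k] {H : Type*} [Ring H] [HopfAlgebra k H]

namespace DualCop

theorem lact_mul {ι : Type*} {a : H} (r : Repr k a ι) (p q : DualCop k H) :
    lact k H a (p * q) = ∑ i ∈ r.index, lact k H (r.left i) p * lact k H (r.right i) q := by
  ext x
  rw [lact_apply, mul_apply ((ℛ k x).mul r)]
  simp only [Repr.mul_index, Repr.mul_left, Repr.mul_right, Finset.sum_product, map_sum,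
    LinearMap.sum_apply, mul_apply (ℛ k x), lact_apply]
  exact Finset.sum_comm

theorem ract_mul [BijectiveAntipode k H] {ι : Type*} {c : H} (r : Repr k c ι)
    (p q : DualCop k H) :
    ract k H c (p * q) = ∑ i ∈ r.index, ract k H (r.right i) p * ract k H (r.left i) q := by
  ext x
  rw [ract_apply, mul_apply ((reprAntipodeInv r).mul (ℛ k x))]
  simp only [Repr.mul_index, Repr.mul_left, Repr.mul_right, Finset.sum_product, map_sum,
    LinearMap.sum_apply, mul_apply (ℛ k x), ract_apply]
  rfl

theorem lact_ract_commute [BijectiveAntipode k H] (a c : H) :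
    Commute (lact k H a) (ract k H c) := by
  ext p x
  simp [mul_assoc]

end DualCop

variable (k H)

/-- The Drinfel'd double `D(H)`: as a coalgebra it is `H^{* cop} ⊗ H`, with the product
`(p ⋈ a)(q ⋈ b) = p (a₁ ≻ q ≺ S⁻¹(a₃)) ⋈ a₂ b`. -/
def DrinfeldDouble : Type _ := DualCop k H ⊗[k] H

namespace DrinfeldDouble

open DualCop

instance : AddCommGroup (DrinfeldDouble k H) := inferInstanceAs (AddCommGroup (DualCop k H ⊗[k] H))
instance : Module k (DrinfeldDouble k H) := inferInstanceAs (Module k (DualCop k H ⊗[k] H))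

variable {k H}

/-- The simple tensor `p ⋈ a`. -/
def mk : DualCop k H →ₗ[k] H →ₗ[k] DrinfeldDouble k H := TensorProduct.mk k (DualCop k H) H

variable (k H)

/-- `actDual p (q ⋈ b) = p q ⋈ b`. -/
def actDual : DualCop k H →ₐ[k] Module.End k (DualCop k H ⊗[k] H) :=
  (Module.End.rTensorAlgHom k (DualCop k H) H).comp (Algebra.lmul k (DualCop k H))

/-- `opL a (q ⋈ b) = (a ≻ q) ⋈ b`. -/
def opL : H →ₐ[k] Module.End k (DualCop k H ⊗[k] H) :=
  (Module.End.rTensorAlgHom k (DualCop k H) H).comp (lact k H)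

/-- `opN a (q ⋈ b) = q ⋈ a b`. -/
def opN : H →ₐ[k] Module.End k (DualCop k H ⊗[k] H) :=
  (Module.End.lTensorAlgHom k H (DualCop k H)).comp (Algebra.lmul k H)

variable [BijectiveAntipode k H]

/-- `opR a (q ⋈ b) = (q ≺ S⁻¹(a)) ⋈ b`. -/
def opR : H →ₐ[k] Module.End k (DualCop k H ⊗[k] H) :=
  (Module.End.rTensorAlgHom k (DualCop k H) H).comp (ract k H)

variable {k H}

@[simp] theorem actDual_tmul (p q : DualCop k H) (b : H) :
    actDual k H p (q ⊗ₜ b) = (p * q) ⊗ₜ b := rfl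
@[simp] theorem opL_tmul (a : H) (q : DualCop k H) (b : H) :
    opL k H a (q ⊗ₜ b) = (lact k H a q) ⊗ₜ b := rfl
@[simp] theorem opN_tmul (a : H) (q : DualCop k H) (b : H) :
    opN k H a (q ⊗ₜ b) = q ⊗ₜ (a * b) := rfl
@[simp] theorem opR_tmul (a : H) (q : DualCop k H) (b : H) :
    opR k H a (q ⊗ₜ b) = (ract k H a q) ⊗ₜ b := rfl

theorem commute_LN (a b : H) : Commute (opL k H a) (opN k H b) :=
  TensorProduct.ext' fun _ _ => rfl
theorem commute_NR (a b : H) : Commute (opN k H a) (opR k H b) :=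
  TensorProduct.ext' fun _ _ => rfl
theorem commute_LR (a b : H) : Commute (opL k H a) (opR k H b) :=
  (lact_ract_commute a b).map (Module.End.rTensorAlgHom k (DualCop k H) H)

variable (k H)

/-- `actNR a (q ⋈ b) = (q ≺ S⁻¹(a₂)) ⋈ a₁ b`. -/
def actNR : H →ₐ[k] Module.End k (DualCop k H ⊗[k] H) := convHom (opN k H) (opR k H) commute_NR

variable {k H}

theorem commute_L_NR (a b : H) : Commute (opL k H a) (actNR k H b) := by
  rw [actNR, convHom_apply]
  exact (cv_commute (fun x => (commute_LN a x).symm) (fun x => (commute_LR a x).symm) b).symm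

variable (k H)

/-- `actH a (q ⋈ b) = (a₁ ≻ q ≺ S⁻¹(a₃)) ⋈ a₂ b`. -/
def actH : H →ₐ[k] Module.End k (DualCop k H ⊗[k] H) := convHom (opL k H) (actNR k H) commute_L_NR

/-- The product `(p ⋈ a)(q ⋈ b) = p (a₁ ≻ q ≺ S⁻¹(a₃)) ⋈ a₂ b`. -/
def mulMap : DualCop k H ⊗[k] H →ₗ[k] Module.End k (DualCop k H ⊗[k] H) :=
  TensorProduct.lift ((LinearMap.mul k _).compl₁₂ (actDual k H).toLinearMap (actH k H).toLinearMap)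

variable {k H}

@[simp] theorem mulMap_tmul (p : DualCop k H) (a : H) :
    mulMap k H (p ⊗ₜ a) = actDual k H p * actH k H a := rfl

theorem actH_eq (a : H) : actH k H a =
    cv (opL k H).toLinearMap (cv (opN k H).toLinearMap (opR k H).toLinearMap) a := by
  rw [actH, convHom_apply, actNR, convHom_toLinearMap]

/-- The action of `H`, through a given expression of the iterated comultiplication. -/
theorem actH_tmul {a : H} {ι : Type*} {κ : ι → Type*} (r : Repr k a ι)
    (r' : ∀ i, Repr k (r.right i) (κ i)) (q : DualCop k H) (b : H) :
    actH k H a (q ⊗ₜ b) = ∑ i ∈ r.index, ∑ j ∈ (r' i).index,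
      (lact k H (r.left i) (ract k H ((r' i).right j) q)) ⊗ₜ ((r' i).left j * b) := by
  rw [actH_eq, cv_apply _ _ r]
  simp only [cv_apply _ _ (r' _), LinearMap.sum_apply, Module.End.mul_apply, map_sum]
  rfl

theorem cv_algHom {B C : Type*} [Semiring B] [Algebra k B] [Semiring C] [Algebra k C] (i : B →ₐ[k] C)
    (f g : H →ₗ[k] B) : cv (i.toLinearMap ∘ₗ f) (i.toLinearMap ∘ₗ g) = i.toLinearMap ∘ₗ cv f g :=
  (LinearMap.algHom_comp_convMul_distrib i (toConv f) (toConv g)).symm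

@[simp] theorem lact_one (a : H) : lact k H a 1 = counit (R := k) a • 1 := by
  ext x; simp [mul_comm]

@[simp] theorem counit_antipodeInv (a : H) :
    counit (R := k) (antipodeInv k H a) = counit (R := k) a := by
  conv_rhs => rw [← antipode_antipodeInv k a]
  rw [counit_antipode]

@[simp] theorem ract_one (a : H) : ract k H a 1 = counit (R := k) a • 1 := by
  ext x; simp

theorem actH_one_tmul (a b : H) : actH k H a (1 ⊗ₜ b) = 1 ⊗ₜ (a * b) := by
  rw [actH_tmul (ℛ k a) (fun i => ℛ k _)]
  have h : ∀ c : H, ∑ j ∈ (ℛ k c).index, counit (R := k) ((ℛ k c).right j) • (ℛ k c).left j = c :=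
    fun c => by
      have := congrArg (TensorProduct.rid k H) (sum_tmul_counit_eq (ℛ k c))
      simpa only [map_sum, TensorProduct.rid_tmul, one_smul] using this
  simp only [ract_one, map_smul, lact_one, ← TensorProduct.smul_tmul', ← TensorProduct.tmul_smul,
    ← smul_mul_assoc, ← TensorProduct.tmul_sum, ← Finset.sum_mul]
  congr 2
  conv_rhs => rw [← sum_counit_smul (ℛ k a)]
  refine Finset.sum_congr rfl fun i _ => ?_
  conv_rhs => rw [← h ((ℛ k a).right i)]
  rw [Finset.smul_sum]
  exact Finset.sum_congr rfl fun j _ => smul_comm _ _ _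

theorem actH_comp_actDual (a : H) (q : DualCop k H) (b : H) :
    mulMap k H (actH k H a (q ⊗ₜ b)) = actH k H a * actDual k H q * actH k H b := by
  let m : DualCop k H ⊗[k] (DualCop k H ⊗[k] H) →ₗ[k] DualCop k H ⊗[k] H :=
    TensorProduct.lift (actDual k H).toLinearMap
  let iT := Module.End.lTensorAlgHom k (DualCop k H ⊗[k] H) (DualCop k H)
  let rT := Module.End.rTensorAlgHom k (DualCop k H) (DualCop k H ⊗[k] H)
  let L0 := rT.toLinearMap ∘ₗ (lact k H).toLinearMap
  let R0 := rT.toLinearMap ∘ₗ (ract k H).toLinearMap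
  let L1 := iT.toLinearMap ∘ₗ (opL k H).toLinearMap
  let N1 := iT.toLinearMap ∘ₗ (opN k H).toLinearMap
  let R1 := iT.toLinearMap ∘ₗ (opR k H).toLinearMap
  have hi : ∀ f q t, iT f (q ⊗ₜ t) = q ⊗ₜ f t := fun _ _ _ => rfl
  have hr : ∀ f q t, rT f (q ⊗ₜ t) = f q ⊗ₜ t := fun _ _ _ => rfl
  have hL : ∀ a, (opL k H).toLinearMap a ∘ₗ m = m ∘ₗ cv L0 L1 a := by
    intro a
    rw [cv_apply _ _ (ℛ k a)]
    ext q p b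
    simp [m, L0, L1, hi, hr, lact_mul (ℛ k a), TensorProduct.sum_tmul]
  have hN : ∀ a, (opN k H).toLinearMap a ∘ₗ m = m ∘ₗ N1 a := by
    intro a
    ext q p b
    simp [m, N1, hi]
  have hR : ∀ a, (opR k H).toLinearMap a ∘ₗ m = m ∘ₗ cv R1 R0 a := by
    intro a
    rw [cv_apply _ _ (ℛ k a)]
    ext q p b
    simp [m, R0, R1, hi, hr, ract_mul (ℛ k a), TensorProduct.sum_tmul]
  have hH : ∀ a, actH k H a ∘ₗ m = m ∘ₗ cv L0 (cv (iT.toLinearMap ∘ₗ (actH k H).toLinearMap) R0) a := by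
    intro a
    have e : (actH k H).toLinearMap = cv (opL k H).toLinearMap
        (cv (opN k H).toLinearMap (opR k H).toLinearMap) := by
      ext1 x; exact actH_eq x
    have e2 : cv L1 (cv N1 R1) = iT.toLinearMap ∘ₗ (actH k H).toLinearMap := by
      have h1 := cv_algHom iT (opN k H).toLinearMap (opR k H).toLinearMap
      have h2 := cv_algHom iT (opL k H).toLinearMap
        (cv (opN k H).toLinearMap (opR k H).toLinearMap)
      rw [e]
      exact Eq.trans (by rw [← h1]) h2
    rw [actH_eq, cv_intertwine m hL (cv_intertwine m hN hR), ← e2]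
    simp only [cv_assoc]
  refine LinearMap.ext fun t => ?_
  have h := LinearMap.congr_fun (hH a) (q ⊗ₜ actH k H b t)
  rw [cv_apply _ _ (ℛ k a)] at h
  simp only [cv_apply _ _ (ℛ k _)] at h
  rw [actH_tmul (ℛ k a) (fun i => ℛ k _)]
  simp only [map_sum, mulMap_tmul, LinearMap.sum_apply, Module.End.mul_apply, map_mul]
  simp only [LinearMap.comp_apply, LinearMap.sum_apply, map_sum, Module.End.mul_apply] at h
  exact h.symm

theorem mulMap_actDual (p : DualCop k H) (t : DualCop k H ⊗[k] H) :
    mulMap k H (actDual k H p t) = actDual k H p * mulMap k H t := by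
  induction t with
  | zero => simp
  | add s t hs ht => simp only [map_add, hs, ht, mul_add]
  | tmul q b => simp [mul_assoc]

theorem mulMap_mulMap (x y : DualCop k H ⊗[k] H) :
    mulMap k H (mulMap k H x y) = mulMap k H x * mulMap k H y := by
  induction x with
  | zero => simp
  | add s t hs ht => simp only [map_add, LinearMap.add_apply, hs, ht, add_mul]
  | tmul p a =>
    induction y with
    | zero => simp
    | add s t hs ht => simp only [map_add, hs, ht, mul_add]
    | tmul q b =>
      rw [mulMap_tmul, mulMap_tmul, Module.End.mul_apply, mulMap_actDual, actH_comp_actDual]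
      simp only [mul_assoc]

theorem mulMap_one (x : DualCop k H ⊗[k] H) : mulMap k H x (1 ⊗ₜ 1) = x := by
  induction x with
  | zero => simp
  | add s t hs ht => simp only [map_add, LinearMap.add_apply, hs, ht]
  | tmul p a => simp [actH_one_tmul]

instance : Mul (DrinfeldDouble k H) := ⟨fun x y => mulMap k H x y⟩
instance : One (DrinfeldDouble k H) := ⟨mk 1 1⟩

theorem one_mulMap (x : DualCop k H ⊗[k] H) : mulMap k H (1 ⊗ₜ 1) x = x := by
  simp

instance : Ring (DrinfeldDouble k H) where
  __ := (inferInstance : AddCommGroup (DrinfeldDouble k H))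
  mul_assoc x y z := LinearMap.congr_fun (mulMap_mulMap x y) z
  one_mul x := one_mulMap x
  mul_one x := mulMap_one x
  left_distrib x y z := map_add (mulMap k H x) y z
  right_distrib x y z := LinearMap.congr_fun (map_add (mulMap k H) x y) z
  zero_mul x := LinearMap.congr_fun (map_zero (mulMap k H)) x
  mul_zero x := map_zero (mulMap k H x)

instance : Algebra k (DrinfeldDouble k H) :=
  Algebra.ofModule
    (fun c x y => LinearMap.congr_fun (map_smul (mulMap k H) c x) y)
    (fun c x y => map_smul (mulMap k H x) c y)

/-- The product formula, through any expression of the iterated comultiplication of `a`. -/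
theorem mk_mul_mk (p q : DualCop k H) (a b : H) {ι : Type*} {κ : ι → Type*} (r : Repr k a ι)
    (r' : ∀ i, Repr k (r.right i) (κ i)) :
    mk p a * mk q b = ∑ i ∈ r.index, ∑ j ∈ (r' i).index,
      mk (p * lact k H (r.left i) (ract k H ((r' i).right j) q)) ((r' i).left j * b) := by
  change mulMap k H (p ⊗ₜ a) (q ⊗ₜ b) = _
  rw [mulMap_tmul, Module.End.mul_apply, actH_tmul r r']
  simp only [map_sum, actDual_tmul]
  rfl

section Hopf

variable [FiniteDimensional k H]

theorem _root_.QDouble.DualCop.tensorEquiv_rTensor {V : Type*} [AddCommGroup V] [Module k V]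
    (f : DualCop k H →ₗ[k] DualCop k H) (x y : H) (h : ∀ p, f p x = p y) (t : DualCop k H ⊗[k] V) :
    tensorEquiv V (f.rTensor V t) x = tensorEquiv V t y := by
  induction t with
  | zero => simp
  | add s t hs ht => simp [hs, ht]
  | tmul p v => simp [h]

theorem _root_.QDouble.DualCop.comul_lact (a : H) (q : DualCop k H) :
    (lact k H a).rTensor _ (comul (R := k) q) = comul (R := k) (lact k H a q) := by
  refine tensor_ext fun x => ?_
  rw [tensorEquiv_rTensor _ x (x * a) (fun p => rfl)]
  ext y
  simp [mul_assoc]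

theorem _root_.QDouble.DualCop.comul_ract (c : H) (q : DualCop k H) :
    (ract k H c).lTensor _ (comul (R := k) q) = comul (R := k) (ract k H c q) := by
  refine tensor_ext fun x => ?_
  rw [tensorEquiv_map]
  ext y
  simp [mul_assoc]

theorem _root_.QDouble.DualCop.ract_lact_comul {ι : Type*} {a : H} (r : Repr k a ι)
    (q : DualCop k H) :
    ∑ i ∈ r.index, (ract k H (r.left i)).rTensor _ ((lact k H (r.right i)).lTensor _
      (comul (R := k) q)) = counit (R := k) a • comul (R := k) q := by
  refine tensor_ext fun x => ?_
  simp only [map_sum, LinearMap.sum_apply, map_smul, LinearMap.smul_apply]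
  have h : ∀ i t, tensorEquiv (DualCop k H) ((ract k H (r.left i)).rTensor _ t) x =
      tensorEquiv _ t (antipodeInv k H (r.left i) * x) := fun i t =>
    tensorEquiv_rTensor _ x _ (fun p => rfl) t
  simp only [h, tensorEquiv_map, tensorEquiv_comul]
  ext y
  have h2 := congrArg (fun z => q (y * (z * x))) (sum_mul_antipodeInv k r)
  simp only [Finset.sum_mul, Finset.mul_sum, map_sum] at h2
  simpa [mul_assoc] using h2

local notation "δ" => comul (R := k) (A := DualCop k H ⊗[k] H)

variable (k H) in
/-- Operators on the left factor of a tensor square. -/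
def onL : Module.End k (DualCop k H ⊗[k] H) →ₐ[k]
    Module.End k ((DualCop k H ⊗[k] H) ⊗[k] (DualCop k H ⊗[k] H)) :=
  Module.End.rTensorAlgHom k _ _

variable (k H) in
/-- Operators on the right factor of a tensor square. -/
def onR : Module.End k (DualCop k H ⊗[k] H) →ₐ[k]
    Module.End k ((DualCop k H ⊗[k] H) ⊗[k] (DualCop k H ⊗[k] H)) :=
  Module.End.lTensorAlgHom k _ _

theorem onL_tmul (f : Module.End k (DualCop k H ⊗[k] H)) (s t) :
    onL k H f (s ⊗ₜ t) = f s ⊗ₜ t := rfl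
theorem onR_tmul (f : Module.End k (DualCop k H ⊗[k] H)) (s t) :
    onR k H f (s ⊗ₜ t) = s ⊗ₜ f t := rfl

theorem commute_onL_onR (f g : Module.End k (DualCop k H ⊗[k] H)) :
    Commute (onL k H f) (onR k H g) :=
  TensorProduct.ext' fun _ _ => rfl

/-- The middle-four interchange. -/
local notation "τ" => TensorProduct.tensorTensorTensorComm k (DualCop k H) (DualCop k H) H H

theorem comul_T (q : DualCop k H) (b : H) :
    δ (q ⊗ₜ b) = τ (comul (R := k) q ⊗ₜ comul (R := k) b) := rfl

theorem onL_opL_T (a : H) (s : DualCop k H ⊗[k] DualCop k H) (u : H ⊗[k] H) :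
    onL k H (opL k H a) (τ (s ⊗ₜ u)) = τ ((lact k H a).rTensor _ s ⊗ₜ u) := by
  induction s with
  | zero => simp
  | add s t hs ht => simp only [TensorProduct.add_tmul, map_add, hs, ht]
  | tmul p q =>
    induction u with
    | zero => simp
    | add s t hs ht => simp only [TensorProduct.tmul_add, map_add, hs, ht]
    | tmul u v => rfl

theorem onR_opL_T (a : H) (s : DualCop k H ⊗[k] DualCop k H) (u : H ⊗[k] H) :
    onR k H (opL k H a) (τ (s ⊗ₜ u)) = τ ((lact k H a).lTensor _ s ⊗ₜ u) := by
  induction s with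
  | zero => simp
  | add s t hs ht => simp only [TensorProduct.add_tmul, map_add, hs, ht]
  | tmul p q =>
    induction u with
    | zero => simp
    | add s t hs ht => simp only [TensorProduct.tmul_add, map_add, hs, ht]
    | tmul u v => rfl

theorem onL_opR_T (a : H) (s : DualCop k H ⊗[k] DualCop k H) (u : H ⊗[k] H) :
    onL k H (opR k H a) (τ (s ⊗ₜ u)) = τ ((ract k H a).rTensor _ s ⊗ₜ u) := by
  induction s with
  | zero => simp
  | add s t hs ht => simp only [TensorProduct.add_tmul, map_add, hs, ht]
  | tmul p q =>
    induction u with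
    | zero => simp
    | add s t hs ht => simp only [TensorProduct.tmul_add, map_add, hs, ht]
    | tmul u v => rfl

theorem onR_opR_T (a : H) (s : DualCop k H ⊗[k] DualCop k H) (u : H ⊗[k] H) :
    onR k H (opR k H a) (τ (s ⊗ₜ u)) = τ ((ract k H a).lTensor _ s ⊗ₜ u) := by
  induction s with
  | zero => simp
  | add s t hs ht => simp only [TensorProduct.add_tmul, map_add, hs, ht]
  | tmul p q =>
    induction u with
    | zero => simp
    | add s t hs ht => simp only [TensorProduct.tmul_add, map_add, hs, ht]
    | tmul u v => rfl

theorem on_opN_T (a b : H) (s : DualCop k H ⊗[k] DualCop k H) (u : H ⊗[k] H) :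
    onL k H (opN k H a) (onR k H (opN k H b) (τ (s ⊗ₜ u))) = τ (s ⊗ₜ ((a ⊗ₜ b) * u)) := by
  induction s with
  | zero => simp
  | add s t hs ht => simp only [TensorProduct.add_tmul, map_add, hs, ht]
  | tmul p q =>
    induction u with
    | zero => simp
    | add s t hs ht => simp only [TensorProduct.tmul_add, mul_add, map_add, hs, ht]
    | tmul u v => rw [Algebra.TensorProduct.tmul_mul_tmul]; rfl

theorem on_actDual_T (p p' : DualCop k H) (s : DualCop k H ⊗[k] DualCop k H) (u : H ⊗[k] H) :
    onL k H (actDual k H p) (onR k H (actDual k H p') (τ (s ⊗ₜ u))) =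
      τ (((p ⊗ₜ p') * s) ⊗ₜ u) := by
  induction s with
  | zero => simp
  | add s t hs ht => simp only [TensorProduct.add_tmul, mul_add, map_add, hs, ht]
  | tmul p q =>
    induction u with
    | zero => simp
    | add s t hs ht => simp only [TensorProduct.tmul_add, map_add, hs, ht]
    | tmul u v => rw [Algebra.TensorProduct.tmul_mul_tmul]; rfl

theorem comul_actDual {ι : Type*} {p : DualCop k H} (r : Repr k p ι) (t : DualCop k H ⊗[k] H) :
    δ (actDual k H p t) = ∑ i ∈ r.index,
      onL k H (actDual k H (r.left i)) (onR k H (actDual k H (r.right i)) (δ t)) := by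
  induction t with
  | zero => simp
  | add s t hs ht => simp only [map_add, hs, ht, Finset.sum_add_distrib]
  | tmul q b =>
    simp only [actDual_tmul, comul_T, on_actDual_T, ← map_sum, ← TensorProduct.sum_tmul,
      ← Finset.sum_mul, r.eq, Bialgebra.comul_mul]

theorem comul_actH (a : H) : δ ∘ₗ actH k H a =
    cv ((onL k H).toLinearMap ∘ₗ (actH k H).toLinearMap)
      ((onR k H).toLinearMap ∘ₗ (actH k H).toLinearMap) a ∘ₗ δ := by
  let L := (opL k H).toLinearMap
  let N := (opN k H).toLinearMap
  let R := (opR k H).toLinearMap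
  let L' := (onL k H).toLinearMap ∘ₗ L
  let N' := (onL k H).toLinearMap ∘ₗ N
  let R' := (onL k H).toLinearMap ∘ₗ R
  let L'' := (onR k H).toLinearMap ∘ₗ L
  let N'' := (onR k H).toLinearMap ∘ₗ N
  let R'' := (onR k H).toLinearMap ∘ₗ R
  have hL : ∀ a, L' a ∘ₗ δ = δ ∘ₗ L a := fun a => TensorProduct.ext' fun q b => by
    simp only [LinearMap.comp_apply, L', L, AlgHom.toLinearMap_apply, opL_tmul, comul_T,
      onL_opL_T, comul_lact]
  have hR : ∀ a, R'' a ∘ₗ δ = δ ∘ₗ R a := fun a => TensorProduct.ext' fun q b => by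
    simp only [LinearMap.comp_apply, R'', R, AlgHom.toLinearMap_apply, opR_tmul, comul_T,
      onR_opR_T, comul_ract]
  have hN : ∀ a, cv N' N'' a ∘ₗ δ = δ ∘ₗ N a := fun a => TensorProduct.ext' fun q b => by
    rw [cv_apply _ _ (ℛ k a)]
    simp only [LinearMap.comp_apply, N', N'', N, AlgHom.toLinearMap_apply, opN_tmul, comul_T,
      LinearMap.sum_apply, Module.End.mul_apply, on_opN_T, ← map_sum, ← TensorProduct.tmul_sum,
      ← Finset.sum_mul, (ℛ k a).eq, Bialgebra.comul_mul]
  have hZ : ∀ a, cv R' L'' a ∘ₗ δ = counit (R := k) a • δ := fun a =>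
    TensorProduct.ext' fun q b => by
      rw [cv_apply _ _ (ℛ k a)]
      simp only [LinearMap.comp_apply, R', L'', L, R, AlgHom.toLinearMap_apply, comul_T,
        LinearMap.sum_apply, Module.End.mul_apply, onR_opL_T, onL_opR_T, ← map_sum,
        ← TensorProduct.sum_tmul, ract_lact_comul, LinearMap.smul_apply]
      rw [← TensorProduct.smul_tmul', map_smul]
  have hZX : ∀ a b, Commute (cv R' L'' a) (cv N'' R'' b) := fun a b =>
    cv_commute
      (fun x => (cv_commute (fun y => (commute_onL_onR _ _).symm)
        (fun y => (commute_onL_onR _ _).symm) b).symm)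
      (fun x => (cv_commute (fun y => ((commute_LN x y).map (onR k H)).symm)
        (fun y => ((commute_LR x y).map (onR k H)).symm) b).symm) a
  have e : (actH k H).toLinearMap = cv L (cv N R) := by
    ext1 x; exact actH_eq x
  have e1 : cv L' (cv N' R') = (onL k H).toLinearMap ∘ₗ (actH k H).toLinearMap := by
    have h1 := cv_algHom (onL k H) N R
    have h2 := cv_algHom (onL k H) L (cv N R)
    rw [e]
    exact Eq.trans (by rw [← h1]) h2
  have e2 : cv L'' (cv N'' R'') = (onR k H).toLinearMap ∘ₗ (actH k H).toLinearMap := by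
    have h1 := cv_algHom (onR k H) N R
    have h2 := cv_algHom (onR k H) L (cv N R)
    rw [e]
    exact Eq.trans (by rw [← h1]) h2
  have h1 := cv_intertwine δ hL (cv_intertwine δ hN hR) a
  rw [← e1, ← e2, actH_eq]
  refine h1.symm.trans ?_
  have e3 : cv (cv L' (cv N' R')) (cv L'' (cv N'' R'')) =
      cv L' (cv N' (cv (cv R' L'') (cv N'' R''))) := by simp only [cv_assoc]
  rw [e3]
  refine cv_congr_comp δ (fun x => ?_) a
  rw [cv_assoc]
  exact (cv_congr_comp δ (fun y => cv_cancel δ hZ hZX y) x).symm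

/-- The tensor product coalgebra. -/
instance : Coalgebra k (DrinfeldDouble k H) := inferInstanceAs (Coalgebra k (DualCop k H ⊗[k] H))

theorem tmul_mul (u v : DrinfeldDouble k H) (t : DrinfeldDouble k H ⊗[k] DrinfeldDouble k H) :
    (u ⊗ₜ[k] v) * t = TensorProduct.map (LinearMap.mulLeft k u) (LinearMap.mulLeft k v) t := by
  induction t with
  | zero => simp
  | add s t hs ht => rw [mul_add, hs, ht, map_add]
  | tmul x y => rw [Algebra.TensorProduct.tmul_mul_tmul]; rfl

theorem map_mk (p p' : DualCop k H) (a a' : H)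
    (t : DrinfeldDouble k H ⊗[k] DrinfeldDouble k H) :
    TensorProduct.map (LinearMap.mulLeft k (mk p a)) (LinearMap.mulLeft k (mk p' a')) t =
      onL k H (actDual k H p) (onR k H (actDual k H p')
        (onL k H (actH k H a) (onR k H (actH k H a') t))) := by
  induction t with
  | zero =>
    rw [map_zero]
    exact (by simp : (0 : (DualCop k H ⊗[k] H) ⊗[k] (DualCop k H ⊗[k] H)) =
      onL k H (actDual k H p) (onR k H (actDual k H p')
        (onL k H (actH k H a) (onR k H (actH k H a') 0))))
  | add s t hs ht =>
    rw [map_add, hs, ht]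
    exact (by intro s t; simp only [map_add] : ∀ s t : (DualCop k H ⊗[k] H) ⊗[k] (DualCop k H ⊗[k] H),
      onL k H (actDual k H p) (onR k H (actDual k H p')
        (onL k H (actH k H a) (onR k H (actH k H a') s))) +
      onL k H (actDual k H p) (onR k H (actDual k H p')
        (onL k H (actH k H a) (onR k H (actH k H a') t))) =
      onL k H (actDual k H p) (onR k H (actDual k H p')
        (onL k H (actH k H a) (onR k H (actH k H a') (s + t))))) s t
  | tmul x y => rfl

@[elab_as_elim]
theorem induction {P : DrinfeldDouble k H → Prop} (x : DrinfeldDouble k H) (h0 : P 0)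
    (hmk : ∀ p a, P (mk p a)) (hadd : ∀ x y, P x → P y → P (x + y)) : P x :=
  TensorProduct.induction_on (motive := P) x h0 hmk hadd

/-- `Δ(p ⋈ a) = ∑ (p₁ ⋈ a₁) ⊗ (p₂ ⋈ a₂)`. -/
def reprMk {ι κ : Type*} {p : DualCop k H} {a : H} (r : Repr k p ι) (r' : Repr k a κ) :
    Repr k (mk p a) (ι × κ) where
  index := r.index ×ˢ r'.index
  left i := mk (r.left i.1) (r'.left i.2)
  right i := mk (r.right i.1) (r'.right i.2)
  eq := (r.tmul r').eq

theorem comul_mulMap (p : DualCop k H) (a : H) (y : DualCop k H ⊗[k] H) :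
    δ (actDual k H p (actH k H a y)) = ∑ i ∈ (ℛ k p).index, ∑ j ∈ (ℛ k a).index,
      onL k H (actDual k H ((ℛ k p).left i)) (onR k H (actDual k H ((ℛ k p).right i))
        (onL k H (actH k H ((ℛ k a).left j)) (onR k H (actH k H ((ℛ k a).right j)) (δ y)))) := by
  have h2 := LinearMap.congr_fun (comul_actH a) y
  rw [cv_apply _ _ (ℛ k a)] at h2
  simp only [LinearMap.comp_apply, LinearMap.sum_apply, Module.End.mul_apply,
    AlgHom.toLinearMap_apply] at h2
  rw [comul_actDual (ℛ k p), h2]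
  simp only [map_sum]

theorem comul_mul_aux (x y : DrinfeldDouble k H) :
    comul (R := k) (x * y) = comul (R := k) x * comul (R := k) y := by
  induction x using induction with
  | h0 => simp
  | hadd s t hs ht => simp only [add_mul, map_add, hs, ht]
  | hmk p a =>
    rw [← (reprMk (ℛ k p) (ℛ k a)).eq, Finset.sum_mul]
    refine Eq.trans ?_ (Finset.sum_product (ℛ k p).index (ℛ k a).index _).symm
    have h : ∀ i j, ((mk ((ℛ k p).left i) ((ℛ k a).left j) : DrinfeldDouble k H) ⊗ₜ[k]
        mk ((ℛ k p).right i) ((ℛ k a).right j)) * comul (R := k) y =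
        onL k H (actDual k H ((ℛ k p).left i)) (onR k H (actDual k H ((ℛ k p).right i))
        (onL k H (actH k H ((ℛ k a).left j)) (onR k H (actH k H ((ℛ k a).right j)) (δ y)))) :=
      fun i j => (tmul_mul _ _ _).trans (map_mk _ _ _ _ _)
    refine Eq.trans (comul_mulMap p a y) ?_
    exact (Finset.sum_congr rfl fun i _ => Finset.sum_congr rfl fun j _ => h i j).symm

@[simp] theorem counit_mk (p : DualCop k H) (a : H) :
    counit (R := k) (mk p a) = counit (R := k) a * p 1 := rfl

theorem counit_actH (a : H) (t : DualCop k H ⊗[k] H) :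
    counit (R := k) (actH k H a t) = counit (R := k) a * counit (R := k) t := by
  induction t with
  | zero => simp
  | add s t hs ht => simp only [map_add, mul_add, hs, ht]
  | tmul q b =>
    rw [actH_tmul (ℛ k a) (fun i => ℛ k _)]
    have h : ∀ c : H, ∑ j ∈ (ℛ k c).index, counit (R := k) ((ℛ k c).left j) •
        (ℛ k c).right j = c := fun c => sum_counit_smul (ℛ k c)
    have h2 : ∀ i ∈ (ℛ k a).index, ∑ j ∈ (ℛ k ((ℛ k a).right i)).index,
        counit (R := k) (lact k H ((ℛ k a).left i) (ract k H ((ℛ k ((ℛ k a).right i)).right j) q)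
          ⊗ₜ[k] ((ℛ k ((ℛ k a).right i)).left j * b)) =
        counit (R := k) b * q (antipodeInv k H ((ℛ k a).right i) * (ℛ k a).left i) := by
      intro i _
      conv_rhs => rw [← h ((ℛ k a).right i)]
      simp only [map_sum, map_smul, Finset.sum_mul, smul_mul_assoc, Finset.mul_sum]
      refine Finset.sum_congr rfl fun j _ => ?_
      simp [TensorProduct.counit_tmul]
      ring
    simp only [map_sum]
    rw [Finset.sum_congr rfl h2, ← Finset.mul_sum, ← map_sum, sum_antipodeInv_mul]
    simp [TensorProduct.counit_tmul]
    ring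

theorem counit_actDual (p : DualCop k H) (t : DualCop k H ⊗[k] H) :
    counit (R := k) (actDual k H p t) = p 1 * counit (R := k) t := by
  induction t with
  | zero => simp
  | add s t hs ht => simp only [map_add, mul_add, hs, ht]
  | tmul q b =>
    have := Bialgebra.counit_mul (R := k) p q
    simp only [counit_apply] at this
    rw [actDual_tmul, TensorProduct.counit_tmul, TensorProduct.counit_tmul, counit_apply, this]
    simp
    ring

theorem counit_mulMap (p : DualCop k H) (a : H) (y : DualCop k H ⊗[k] H) :
    counit (R := k) (actDual k H p (actH k H a y)) =
      counit (R := k) a * p 1 * counit (R := k) y := by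
  rw [counit_actDual, counit_actH, ← mul_assoc, mul_comm (p 1)]

instance : Bialgebra k (DrinfeldDouble k H) :=
  Bialgebra.mk' k (DrinfeldDouble k H)
    (by
      change counit (R := k) (mk (1 : DualCop k H) (1 : H)) = 1
      simp)
    (by
      intro x y
      induction x using induction with
      | h0 => simp
      | hadd s t hs ht => simp only [add_mul, map_add, hs, ht]
      | hmk p a => exact counit_mulMap p a y)
    (by
      have h1 : comul (R := k) (1 : DualCop k H) = 1 ⊗ₜ 1 := Bialgebra.comul_one
      have h2 : comul (R := k) (1 : H) = 1 ⊗ₜ 1 := Bialgebra.comul_one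
      let r : Repr k (1 : DualCop k H) Unit := ⟨{()}, fun _ => 1, fun _ => 1, by simp [h1]⟩
      let r' : Repr k (1 : H) Unit := ⟨{()}, fun _ => 1, fun _ => 1, by simp [h2]⟩
      change comul (R := k) (mk (1 : DualCop k H) (1 : H)) = 1
      rw [← (reprMk r r').eq]
      simp only [reprMk, r, r', Finset.sum_product, Finset.sum_singleton]
      rfl)
    (comul_mul_aux _ _)

theorem mk_one_mul_mk (p q : DualCop k H) (b : H) : mk p 1 * mk q b = mk (p * q) b := by
  change mulMap k H (p ⊗ₜ 1) (q ⊗ₜ b) = (p * q) ⊗ₜ b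
  simp

theorem mk_mul_one_mk (p : DualCop k H) (a b : H) : mk p a * mk 1 b = mk p (a * b) := by
  change mulMap k H (p ⊗ₜ a) (1 ⊗ₜ b) = p ⊗ₜ (a * b)
  simp [actH_one_tmul]

variable (k H) in
/-- The antipode `S(p ⋈ a) = (1 ⋈ S(a)) (p ∘ S⁻¹ ⋈ 1)`. -/
def antipodeD : DrinfeldDouble k H →ₗ[k] DrinfeldDouble k H :=
  TensorProduct.lift (((LinearMap.mul k (DrinfeldDouble k H)).compl₁₂ (mk 1 ∘ₗ antipode k)
    (mk.flip 1 ∘ₗ antipode k)).flip)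

theorem antipodeD_mk (p : DualCop k H) (a : H) :
    antipodeD k H (mk p a) = mk 1 (antipode k a) * mk (antipode k p) 1 := rfl

instance : HopfAlgebra k (DrinfeldDouble k H) where
  antipode := antipodeD k H
  mul_antipode_rTensor_comul := by
    refine LinearMap.ext fun x => ?_
    induction x using induction with
    | h0 => simp
    | hadd s t hs ht => simp only [map_add, hs, ht]
    | hmk p a =>
      simp only [LinearMap.comp_apply]
      rw [← (reprMk (ℛ k p) (ℛ k a)).eq]
      simp only [map_sum, LinearMap.rTensor_tmul, LinearMap.mul'_apply, reprMk, antipodeD_mk,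
        Finset.sum_product_right]
      have h : ∀ i j, mk 1 (antipode k ((ℛ k a).left j)) * mk (antipode k ((ℛ k p).left i)) 1 *
          mk ((ℛ k p).right i) ((ℛ k a).right j) =
          mk 1 (antipode k ((ℛ k a).left j)) * mk (antipode k ((ℛ k p).left i) * (ℛ k p).right i) 1 *
          mk 1 ((ℛ k a).right j) := by
        intro i j
        rw [mul_assoc, mk_one_mul_mk, mul_assoc, mk_mul_one_mk, one_mul]
      simp only [h, ← Finset.sum_mul, ← Finset.mul_sum, ← LinearMap.sum_apply, ← map_sum,
        sum_antipode_mul_eq_smul (ℛ k p)]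
      simp only [map_smul, LinearMap.smul_apply, mul_smul_comm, mk_mul_one_mk, mul_one,
        smul_mul_assoc, ← Finset.smul_sum, ← map_sum, sum_antipode_mul_eq_smul (ℛ k a)]
      rw [smul_smul, mul_comm]
      simp [Algebra.algebraMap_eq_smul_one]
      rfl
  mul_antipode_lTensor_comul := by
    refine LinearMap.ext fun x => ?_
    induction x using induction with
    | h0 => simp
    | hadd s t hs ht => simp only [map_add, hs, ht]
    | hmk p a =>
      simp only [LinearMap.comp_apply]
      rw [← (reprMk (ℛ k p) (ℛ k a)).eq]
      simp only [map_sum, LinearMap.lTensor_tmul, LinearMap.mul'_apply, reprMk, antipodeD_mk,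
        Finset.sum_product]
      have h : ∀ i j, mk ((ℛ k p).left i) ((ℛ k a).left j) *
          (mk 1 (antipode k ((ℛ k a).right j)) * mk (antipode k ((ℛ k p).right i)) 1) =
          mk ((ℛ k p).left i) ((ℛ k a).left j * antipode k ((ℛ k a).right j)) *
            mk (antipode k ((ℛ k p).right i)) 1 := by
        intro i j
        rw [← mul_assoc, mk_mul_one_mk]
      simp only [h, ← Finset.sum_mul, ← map_sum, sum_mul_antipode_eq_smul (ℛ k a)]
      simp only [map_smul, mk_one_mul_mk, smul_mul_assoc, ← Finset.smul_sum, ← map_sum,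
        ← LinearMap.sum_apply, sum_mul_antipode_eq_smul (ℛ k p)]
      simp only [LinearMap.smul_apply]
      rw [smul_smul]
      simp [Algebra.algebraMap_eq_smul_one]
      rfl

end Hopf

end DrinfeldDouble

end Double

section QCommute

variable {k : Type*} [Field k]

/-- Gaussian binomial coefficients. -/
def gauss (ζ : k) : ℕ → ℕ → k
  | _, 0 => 1
  | 0, _ + 1 => 0
  | m + 1, j + 1 => gauss ζ m j + ζ ^ (j + 1) * gauss ζ m (j + 1)

theorem gauss_eq_zero_of_lt (ζ : k) : ∀ m j : ℕ, m < j → gauss ζ m j = 0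
  | 0, 0, h => absurd h (by omega)
  | m + 1, 0, h => absurd h (by omega)
  | 0, j + 1, _ => by simp [gauss]
  | m + 1, j + 1, h => by
    rw [gauss, gauss_eq_zero_of_lt ζ m j (by omega), gauss_eq_zero_of_lt ζ m (j + 1) (by omega)]
    simp

theorem gauss_self (ζ : k) : ∀ m : ℕ, gauss ζ m m = 1
  | 0 => by simp [gauss]
  | m + 1 => by rw [gauss, gauss_self ζ m, gauss_eq_zero_of_lt ζ m (m + 1) (by omega)]; simp

theorem gauss_zero (ζ : k) (m : ℕ) : gauss ζ m 0 = 1 := by cases m <;> simp [gauss]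

theorem prod_mul_gauss (ζ : k) (m : ℕ) : ∀ j : ℕ, j ≤ m →
    (∏ i ∈ Finset.range j, (1 - ζ ^ (i + 1))) * gauss ζ m j =
      ∏ i ∈ Finset.range j, (1 - ζ ^ (m - i)) := by
  induction m with
  | zero =>
    intro j hj
    obtain rfl : j = 0 := by omega
    simp [gauss]
  | succ m ih =>
    intro j hj
    cases j with
    | zero => simp [gauss]
    | succ j =>
      have h1 := ih j (by omega)
      have h2 : (∏ i ∈ Finset.range (j + 1), (1 - ζ ^ (i + 1))) * gauss ζ m (j + 1) =
          ∏ i ∈ Finset.range (j + 1), (1 - ζ ^ (m - i)) := by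
        rcases Nat.lt_or_ge j m with h | h
        · exact ih (j + 1) h
        · obtain rfl : j = m := by omega
          rw [gauss_eq_zero_of_lt ζ j (j + 1) (by omega), Finset.prod_range_succ (n := j)
            (f := fun i => 1 - ζ ^ (j - i))]
          simp
      have h3 : ζ ^ (m + 1) = ζ ^ (j + 1) * ζ ^ (m - j) := by
        rw [← pow_add]; congr 1; omega
      rw [gauss, mul_add, Finset.prod_range_succ, Finset.prod_range_succ']
      rw [Finset.prod_range_succ, Finset.prod_range_succ] at h2
      simp only [Nat.add_sub_add_right, Nat.sub_zero]
      rw [h3]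
      linear_combination (1 - ζ ^ (j + 1)) * h1 + ζ ^ (j + 1) * h2

theorem gauss_primitive {ζ : k} {n : ℕ} (hζ : IsPrimitiveRoot ζ n) {j : ℕ} (h0 : 0 < j)
    (hj : j < n) : gauss ζ n j = 0 := by
  have h := prod_mul_gauss ζ n j hj.le
  have h1 : ∏ i ∈ Finset.range j, (1 - ζ ^ (n - i)) = 0 :=
    Finset.prod_eq_zero (Finset.mem_range.2 h0) (by simp [hζ.pow_eq_one])
  have h2 : ∏ i ∈ Finset.range j, (1 - ζ ^ (i + 1)) ≠ 0 := by
    refine Finset.prod_ne_zero_iff.2 fun i hi => ?_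
    have := Finset.mem_range.1 hi
    exact sub_ne_zero.2 (hζ.pow_ne_one_of_pos_of_lt (by omega) (by omega)).symm
  rw [h1] at h
  exact (mul_eq_zero.1 h).resolve_left h2

variable {B : Type*} [Ring B] [Algebra k B]

theorem qcomm_pow {ζ : k} {x y : B} (h : y * x = ζ • (x * y)) (j : ℕ) :
    y * x ^ j = ζ ^ j • (x ^ j * y) := by
  induction j with
  | zero => simp
  | succ j ih =>
    rw [pow_succ, ← mul_assoc, ih, smul_mul_assoc, mul_assoc, h, mul_smul_comm, smul_smul,
      pow_succ, mul_assoc]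

theorem qcomm_add_pow {ζ : k} {x y : B} (h : y * x = ζ • (x * y)) (m : ℕ) :
    (x + y) ^ m = ∑ j ∈ Finset.range (m + 1), gauss ζ m j • (x ^ j * y ^ (m - j)) := by
  induction m with
  | zero => simp [gauss]
  | succ m ih =>
    have e1 : ∑ j ∈ Finset.range (m + 1), gauss ζ m j • (x ^ (j + 1) * y ^ (m - j)) =
        ∑ j ∈ Finset.range (m + 1), gauss ζ m j • (x ^ (j + 1) * y ^ (m + 1 - (j + 1))) := by
      simp
    have e2 : ∑ j ∈ Finset.range (m + 1), (ζ ^ j * gauss ζ m j) • (x ^ j * y ^ (m + 1 - j)) =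
        ∑ j ∈ Finset.range (m + 1), (ζ ^ (j + 1) * gauss ζ m (j + 1)) •
          (x ^ (j + 1) * y ^ (m + 1 - (j + 1))) + y ^ (m + 1) := by
      rw [Finset.sum_range_succ', Finset.sum_range_succ (n := m),
        gauss_eq_zero_of_lt ζ m (m + 1) (by omega), gauss_zero]
      simp
    rw [pow_succ', ih, Finset.mul_sum, Finset.sum_range_succ' _ (m + 1)]
    simp only [gauss, add_smul, Finset.sum_add_distrib]
    rw [add_assoc]
    have e3 : ∀ j ∈ Finset.range (m + 1), (x + y) * gauss ζ m j • (x ^ j * y ^ (m - j)) =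
        gauss ζ m j • (x ^ (j + 1) * y ^ (m - j)) +
          (ζ ^ j * gauss ζ m j) • (x ^ j * y ^ (m + 1 - j)) := by
      intro j hj
      have hj := Finset.mem_range.1 hj
      rw [add_mul, mul_smul_comm, mul_smul_comm, ← mul_assoc, ← pow_succ', ← mul_assoc,
        qcomm_pow h, smul_mul_assoc, smul_smul, mul_comm (gauss ζ m j), mul_assoc, ← pow_succ',
        show m - j + 1 = m + 1 - j by omega]
    rw [Finset.sum_congr rfl e3, Finset.sum_add_distrib, e1, e2]
    simp

/-- If `y x = ζ x y` with `ζ` a primitive `n`-th root of unity, then `(x + y)ⁿ = xⁿ + yⁿ`. -/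
theorem qcomm_add_pow_primitive {ζ : k} {n : ℕ} (hn : 0 < n) (hζ : IsPrimitiveRoot ζ n) {x y : B}
    (h : y * x = ζ • (x * y)) : (x + y) ^ n = x ^ n + y ^ n := by
  rw [qcomm_add_pow h, Finset.sum_range_succ, gauss_self]
  obtain ⟨m, rfl⟩ : ∃ m, n = m + 1 := ⟨n - 1, by omega⟩
  rw [Finset.sum_range_succ', gauss_zero, Finset.sum_eq_zero]
  · simp [add_comm]
  · intro j hj
    have := Finset.mem_range.1 hj
    rw [gauss_primitive hζ (by omega) (by omega), zero_smul]

theorem qcomm_mul_pow {ζ : k} {x y : B} (h : y * x = ζ • (x * y)) (m : ℕ) :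
    ∃ c : k, (x * y) ^ m = c • (x ^ m * y ^ m) := by
  induction m with
  | zero => exact ⟨1, by simp⟩
  | succ m ih =>
    obtain ⟨c, hc⟩ := ih
    refine ⟨ζ ^ m * c, ?_⟩
    rw [pow_succ', hc, mul_smul_comm, mul_assoc, ← mul_assoc y, qcomm_pow h, smul_mul_assoc,
      mul_smul_comm, smul_smul, mul_comm c, mul_assoc (x ^ m), ← pow_succ', ← mul_assoc,
      ← pow_succ']

end QCommute

section SmallQuantumGroup

/-- `n ≥ 3` is odd and `q` is a primitive `n`-th root of unity. -/
class OddPrimitiveRoot {k : Type*} [Field k] (n : ℕ) (q : k) : Prop where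
  three_le : 3 ≤ n
  odd : Odd n
  primitive : IsPrimitiveRoot q n

/-- The generators of `u_q(sl_2)`. -/
inductive UqGen | E | F | K

/-- The defining relations of `u_q(sl_2)`; since `Kⁿ = 1`, the inverse of `K` is `Kⁿ⁻¹`. -/
inductive UqRel (k : Type*) [Field k] (n : ℕ) (q : k) :
    FreeAlgebra k UqGen → FreeAlgebra k UqGen → Prop
  | K_pow : UqRel k n q (FreeAlgebra.ι k .K ^ n) 1
  | E_pow : UqRel k n q (FreeAlgebra.ι k .E ^ n) 0
  | F_pow : UqRel k n q (FreeAlgebra.ι k .F ^ n) 0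
  | K_E : UqRel k n q (FreeAlgebra.ι k .K * FreeAlgebra.ι k .E)
      (q ^ 2 • (FreeAlgebra.ι k .E * FreeAlgebra.ι k .K))
  | K_F : UqRel k n q (FreeAlgebra.ι k .K * FreeAlgebra.ι k .F)
      ((q ^ 2)⁻¹ • (FreeAlgebra.ι k .F * FreeAlgebra.ι k .K))
  | E_F : UqRel k n q
      (FreeAlgebra.ι k .E * FreeAlgebra.ι k .F - FreeAlgebra.ι k .F * FreeAlgebra.ι k .E)
      ((q - q⁻¹)⁻¹ • (FreeAlgebra.ι k .K - FreeAlgebra.ι k .K ^ (n - 1)))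

/-- The Frobenius-Lusztig kernel `u_q(sl_2)`, as an algebra. -/
def Uq (k : Type*) [Field k] (n : ℕ) (q : k) : Type _ := RingQuot (UqRel k n q)

namespace Uq

variable (k : Type*) [Field k] (n : ℕ) (q : k)

instance : Ring (Uq k n q) := inferInstanceAs (Ring (RingQuot (UqRel k n q)))
instance : Algebra k (Uq k n q) := inferInstanceAs (Algebra k (RingQuot (UqRel k n q)))

/-- The quotient map from the free algebra. -/
def proj : FreeAlgebra k UqGen →ₐ[k] Uq k n q := RingQuot.mkAlgHom k (UqRel k n q)

def E : Uq k n q := proj k n q (FreeAlgebra.ι k .E)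
def F : Uq k n q := proj k n q (FreeAlgebra.ι k .F)
def K : Uq k n q := proj k n q (FreeAlgebra.ι k .K)

/-- `K⁻¹ = Kⁿ⁻¹`. -/
def Ki : Uq k n q := K k n q ^ (n - 1)

theorem proj_rel {x y : FreeAlgebra k UqGen} (h : UqRel k n q x y) :
    proj k n q x = proj k n q y := RingQuot.mkAlgHom_rel k h

theorem K_pow : K k n q ^ n = 1 := by
  simpa [K] using proj_rel k n q UqRel.K_pow
theorem E_pow : E k n q ^ n = 0 := by
  simpa [E] using proj_rel k n q UqRel.E_pow
theorem F_pow : F k n q ^ n = 0 := by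
  simpa [F] using proj_rel k n q UqRel.F_pow
theorem K_E : K k n q * E k n q = q ^ 2 • (E k n q * K k n q) := by
  simpa only [map_mul, map_smul, E, F, K] using proj_rel k n q UqRel.K_E
theorem K_F : K k n q * F k n q = (q ^ 2)⁻¹ • (F k n q * K k n q) := by
  simpa only [map_mul, map_smul, E, F, K] using proj_rel k n q UqRel.K_F
theorem E_F : E k n q * F k n q - F k n q * E k n q = (q - q⁻¹)⁻¹ • (K k n q - Ki k n q) := by
  simpa only [map_mul, map_smul, map_sub, map_pow, E, F, K, Ki] using proj_rel k n q UqRel.E_F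

variable {k n q}

section lift

variable {B : Type*} [Ring B] [Algebra k B] (e f g : B) (hg : g ^ n = 1) (he : e ^ n = 0)
  (hf : f ^ n = 0) (hge : g * e = q ^ 2 • (e * g)) (hgf : g * f = (q ^ 2)⁻¹ • (f * g))
  (hef : e * f - f * e = (q - q⁻¹)⁻¹ • (g - g ^ (n - 1)))

/-- Algebra maps out of `u_q(sl_2)`. -/
def lift : Uq k n q →ₐ[k] B :=
  RingQuot.liftAlgHom k ⟨FreeAlgebra.lift k (fun x => match x with | .E => e | .F => f | .K => g), by
    intro x y h
    cases h <;> simpa⟩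

theorem lift_proj (x : FreeAlgebra k UqGen) : lift e f g hg he hf hge hgf hef (proj k n q x) =
    FreeAlgebra.lift k (fun x => match x with | .E => e | .F => f | .K => g) x :=
  RingQuot.liftAlgHom_mkAlgHom_apply ..

@[simp] theorem lift_E : lift e f g hg he hf hge hgf hef (E k n q) = e := by
  rw [E, lift_proj]; simp
@[simp] theorem lift_F : lift e f g hg he hf hge hgf hef (F k n q) = f := by
  rw [F, lift_proj]; simp
@[simp] theorem lift_K : lift e f g hg he hf hge hgf hef (K k n q) = g := by
  rw [K, lift_proj]; simp

theorem hom_ext {φ ψ : Uq k n q →ₐ[k] B} (hE : φ (E k n q) = ψ (E k n q))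
    (hF : φ (F k n q) = ψ (F k n q)) (hK : φ (K k n q) = ψ (K k n q)) : φ = ψ := by
  refine RingQuot.ringQuot_ext' (S := k) φ ψ (FreeAlgebra.hom_ext ?_)
  funext x
  cases x
  · exact hE
  · exact hF
  · exact hK

end lift

/-- Induction on elements of `u_q(sl_2)`. -/
theorem induction {P : Uq k n q → Prop} (h1 : ∀ c : k, P (algebraMap k _ c))
    (hE : P (E k n q)) (hF : P (F k n q)) (hK : P (K k n q))
    (hmul : ∀ x y, P x → P y → P (x * y)) (hadd : ∀ x y, P x → P y → P (x + y))
    (x : Uq k n q) : P x := by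
  obtain ⟨x, rfl⟩ := RingQuot.mkAlgHom_surjective k (UqRel k n q) x
  refine FreeAlgebra.induction k UqGen (motive := fun x => P (proj k n q x)) ?_ ?_ ?_ ?_ x
  · intro c
    rw [AlgHom.commutes]; exact h1 c
  · rintro (_ | _ | _)
    · exact hE
    · exact hF
    · exact hK
  · intro x y hx hy; rw [map_mul]; exact hmul _ _ hx hy
  · intro x y hx hy; rw [map_add]; exact hadd _ _ hx hy

variable [h : OddPrimitiveRoot n q]

local notation "e" => E k n q
local notation "f" => F k n q
local notation "g" => K k n q
local notation "gi" => Ki k n q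

theorem q_ne_zero (n : ℕ) (q : k) [h : OddPrimitiveRoot n q] : q ≠ 0 :=
  h.primitive.ne_zero (by have := h.three_le; omega)

theorem sq_primitive (n : ℕ) (q : k) [h : OddPrimitiveRoot n q] : IsPrimitiveRoot (q ^ 2) n :=
  h.primitive.pow_of_coprime 2 (Nat.coprime_two_left.2 h.odd)

theorem n_pos (n : ℕ) (q : k) [h : OddPrimitiveRoot n q] : 0 < n := by
  have := h.three_le; omega

theorem pow_pred_mul {B : Type*} [Monoid B] (q : k) [OddPrimitiveRoot n q] {x : B}
    (hx : x ^ n = 1) : x ^ (n - 1) * x = 1 := by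
  rw [← pow_succ, Nat.sub_add_cancel (n_pos n q), hx]

theorem mul_pow_pred {B : Type*} [Monoid B] (q : k) [OddPrimitiveRoot n q] {x : B}
    (hx : x ^ n = 1) : x * x ^ (n - 1) = 1 := by
  rw [← pow_succ', Nat.sub_add_cancel (n_pos n q), hx]

theorem pow_pred_eq {B : Type*} [Monoid B] (q : k) [OddPrimitiveRoot n q] {x y : B}
    (hx : x ^ n = 1) (hxy : x * y = 1) : x ^ (n - 1) = y :=
  left_inv_eq_right_inv (pow_pred_mul q hx) hxy

@[simp] theorem Ki_K : gi * g = 1 := pow_pred_mul q (K_pow k n q)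
@[simp] theorem K_Ki : g * gi = 1 := mul_pow_pred q (K_pow k n q)

theorem Ki_pow : gi ^ n = 1 := by
  rw [Ki, ← pow_mul, mul_comm, pow_mul, K_pow, one_pow]

theorem Ki_E : gi * e = (q ^ 2)⁻¹ • (e * gi) := by
  have h2 : q ^ 2 ≠ 0 := pow_ne_zero 2 (q_ne_zero n q)
  calc gi * e = gi * e * (g * gi) := by rw [K_Ki, mul_one]
    _ = (q ^ 2)⁻¹ • (gi * (q ^ 2 • (e * g)) * gi) := by
        rw [mul_smul_comm, smul_mul_assoc, smul_smul, inv_mul_cancel₀ h2, one_smul]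
        simp only [mul_assoc]
    _ = (q ^ 2)⁻¹ • (e * gi) := by rw [← K_E, ← mul_assoc, Ki_K, one_mul]

theorem Ki_F : gi * f = q ^ 2 • (f * gi) := by
  have h2 : q ^ 2 ≠ 0 := pow_ne_zero 2 (q_ne_zero n q)
  calc gi * f = gi * f * (g * gi) := by rw [K_Ki, mul_one]
    _ = q ^ 2 • (gi * ((q ^ 2)⁻¹ • (f * g)) * gi) := by
        rw [mul_smul_comm, smul_mul_assoc, smul_smul, mul_inv_cancel₀ h2, one_smul]
        simp only [mul_assoc]
    _ = q ^ 2 • (f * gi) := by rw [← K_F, ← mul_assoc, Ki_K, one_mul]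

/-! ### Hopf algebra structure -/

variable (k n q) in
/-- `Δ(E) = 1 ⊗ E + E ⊗ K`, `Δ(F) = K⁻¹ ⊗ F + F ⊗ 1`, `Δ(K) = K ⊗ K`. -/
def comulHom : Uq k n q →ₐ[k] Uq k n q ⊗[k] Uq k n q :=
  lift (1 ⊗ₜ e + e ⊗ₜ g) (gi ⊗ₜ f + f ⊗ₜ 1) (g ⊗ₜ g)
    (by rw [Algebra.TensorProduct.tmul_pow, K_pow]; rfl)
    (by
      rw [add_comm, qcomm_add_pow_primitive (ζ := (q ^ 2)⁻¹) (n_pos n q) (sq_primitive n q).inv]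
      · simp [Algebra.TensorProduct.tmul_pow, E_pow]
      · have h2 : q ^ 2 ≠ 0 := pow_ne_zero 2 (q_ne_zero n q)
        simp only [Algebra.TensorProduct.tmul_mul_tmul, K_E, TensorProduct.tmul_smul, smul_smul,
          inv_mul_cancel₀ h2, one_mul, mul_one, one_smul])
    (by
      rw [add_comm, qcomm_add_pow_primitive (ζ := q ^ 2) (n_pos n q) (sq_primitive n q)]
      · simp [Algebra.TensorProduct.tmul_pow, F_pow]
      · simp only [Algebra.TensorProduct.tmul_mul_tmul, Ki_F, TensorProduct.smul_tmul',
          one_mul, mul_one])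
    (by
      simp only [mul_add, add_mul, Algebra.TensorProduct.tmul_mul_tmul, K_E, mul_one, one_mul,
        TensorProduct.tmul_smul, TensorProduct.smul_tmul', smul_add])
    (by
      have hc : g * gi = gi * g := by simp
      simp only [mul_add, add_mul, Algebra.TensorProduct.tmul_mul_tmul, K_F, mul_one, one_mul,
        TensorProduct.tmul_smul, TensorProduct.smul_tmul', smul_add, hc])
    (by
      have h2 : q ^ 2 ≠ 0 := pow_ne_zero 2 (q_ne_zero n q)
      have h3 : (g ⊗ₜ[k] g) ^ (n - 1) = gi ⊗ₜ[k] gi := by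
        rw [Algebra.TensorProduct.tmul_pow]; rfl
      have h4 : e ⊗ₜ[k] g * gi ⊗ₜ[k] f = gi ⊗ₜ[k] f * e ⊗ₜ[k] g := by
        simp only [Algebra.TensorProduct.tmul_mul_tmul, K_F, Ki_E, TensorProduct.tmul_smul,
          TensorProduct.smul_tmul']
      have h5 : gi ⊗ₜ[k] (e * f - f * e) + (e * f - f * e) ⊗ₜ[k] g =
        (q - q⁻¹)⁻¹ • (g ⊗ₜ[k] g - gi ⊗ₜ[k] gi) := by
        rw [E_F, TensorProduct.tmul_smul, ← TensorProduct.smul_tmul', ← smul_add,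
          TensorProduct.tmul_sub, TensorProduct.sub_tmul]
        congr 1
        abel
      rw [h3, ← h5]
      simp only [mul_add, add_mul, h4]
      simp only [Algebra.TensorProduct.tmul_mul_tmul, one_mul, mul_one, TensorProduct.tmul_sub,
        TensorProduct.sub_tmul]
      abel)

variable (k n q) in
/-- `ε(E) = ε(F) = 0`, `ε(K) = 1`. -/
def counitHom : Uq k n q →ₐ[k] k :=
  lift 0 0 1 (one_pow _) (zero_pow (n_pos n q).ne') (zero_pow (n_pos n q).ne') (by simp) (by simp)
    (by simp)

@[simp] theorem comulHom_E : comulHom k n q e = 1 ⊗ₜ e + e ⊗ₜ g := lift_E ..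
@[simp] theorem comulHom_F : comulHom k n q f = gi ⊗ₜ f + f ⊗ₜ 1 := lift_F ..
@[simp] theorem comulHom_K : comulHom k n q g = g ⊗ₜ g := lift_K ..
@[simp] theorem comulHom_Ki : comulHom k n q gi = gi ⊗ₜ gi := by
  rw [Ki, map_pow, comulHom_K, Algebra.TensorProduct.tmul_pow]
@[simp] theorem counitHom_E : counitHom k n q e = 0 := lift_E ..
@[simp] theorem counitHom_F : counitHom k n q f = 0 := lift_F ..
@[simp] theorem counitHom_K : counitHom k n q g = 1 := lift_K ..
@[simp] theorem counitHom_Ki : counitHom k n q gi = 1 := by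
  rw [Ki, map_pow, counitHom_K, one_pow]

instance : Bialgebra k (Uq k n q) :=
  Bialgebra.ofAlgHom (comulHom k n q) (counitHom k n q)
    (by
      apply hom_ext
      · simp [TensorProduct.tmul_add, TensorProduct.add_tmul, Algebra.TensorProduct.one_def,
          add_assoc]
      · simp [TensorProduct.tmul_add, TensorProduct.add_tmul, Algebra.TensorProduct.one_def,
          add_assoc]
      · simp)
    (by apply hom_ext <;> simp)
    (by apply hom_ext <;> simp)

@[simp] theorem comul_E : comul (R := k) e = 1 ⊗ₜ e + e ⊗ₜ g := comulHom_E
@[simp] theorem comul_F : comul (R := k) f = gi ⊗ₜ f + f ⊗ₜ 1 := comulHom_F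
@[simp] theorem comul_K : comul (R := k) g = g ⊗ₜ g := comulHom_K
@[simp] theorem counit_E : counit (R := k) e = 0 := counitHom_E
@[simp] theorem counit_F : counit (R := k) f = 0 := counitHom_F
@[simp] theorem counit_K : counit (R := k) g = 1 := counitHom_K

open MulOpposite in
variable (k n q) in
/-- `S(E) = -E K⁻¹`, `S(F) = -K F`, `S(K) = K⁻¹`, as an algebra map to the opposite algebra. -/
def antipodeOp : Uq k n q →ₐ[k] (Uq k n q)ᵐᵒᵖ :=
  lift (op (-(e * gi))) (op (-(g * f))) (op gi)
    (by rw [← op_pow, Ki_pow, op_one])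
    (by
      rw [← op_pow, neg_pow]
      obtain ⟨c, hc⟩ := qcomm_mul_pow (Ki_E (k := k) (n := n) (q := q)) n
      rw [hc, E_pow]; simp)
    (by
      have h2 : q ^ 2 ≠ 0 := pow_ne_zero 2 (q_ne_zero n q)
      rw [← op_pow, neg_pow]
      obtain ⟨c, hc⟩ := qcomm_mul_pow (x := g) (y := f) (ζ := q ^ 2)
        (by rw [K_F, smul_smul, mul_inv_cancel₀ h2, one_smul]) n
      rw [hc, F_pow]; simp)
    (by
      have h2 : q ^ 2 ≠ 0 := pow_ne_zero 2 (q_ne_zero n q)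
      rw [← op_mul, ← op_mul, ← op_smul]
      congr 1
      rw [mul_neg, ← mul_assoc, Ki_E, smul_mul_assoc, smul_neg, smul_smul, mul_inv_cancel₀ h2,
        one_smul, neg_mul])
    (by
      rw [← op_mul, ← op_mul, ← op_smul]
      congr 1
      rw [mul_neg, ← mul_assoc, Ki_K, one_mul, K_F, neg_mul, smul_mul_assoc, mul_assoc, K_Ki,
        mul_one, smul_neg])
    (by
      have h2 : q ^ 2 ≠ 0 := pow_ne_zero 2 (q_ne_zero n q)
      rw [← op_mul, ← op_mul, ← op_pow, ← op_sub, ← op_sub, ← op_smul]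
      congr 1
      rw [pow_pred_eq q Ki_pow Ki_K]
      have h3 : g * f * (e * gi) = f * e := by
        rw [K_F, smul_mul_assoc, mul_assoc, ← mul_assoc g, K_E, smul_mul_assoc, mul_assoc, K_Ki,
          mul_one, mul_smul_comm, smul_smul, inv_mul_cancel₀ h2, one_smul]
      have h4 : e * gi * (g * f) = e * f := by
        rw [mul_assoc, ← mul_assoc gi, Ki_K, one_mul]
      rw [neg_mul_neg, neg_mul_neg, h3, h4, ← neg_sub (e * f), E_F, ← smul_neg, neg_sub])

variable (k n q) in
/-- The antipode of `u_q(sl_2)`. -/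
def antipodeLin : Uq k n q →ₗ[k] Uq k n q :=
  (MulOpposite.opLinearEquiv k).symm.toLinearMap ∘ₗ (antipodeOp k n q).toLinearMap

theorem antipodeLin_apply (x : Uq k n q) :
    antipodeLin k n q x = (antipodeOp k n q x).unop := rfl

theorem antipodeLin_mul (x y : Uq k n q) :
    antipodeLin k n q (x * y) = antipodeLin k n q y * antipodeLin k n q x := by
  simp [antipodeLin_apply]

@[simp] theorem antipodeLin_one : antipodeLin k n q 1 = 1 := by
  simp [antipodeLin_apply]

@[simp] theorem antipodeLin_E : antipodeLin k n q e = -(e * gi) := by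
  rw [antipodeLin_apply, antipodeOp, lift_E]; rfl
@[simp] theorem antipodeLin_F : antipodeLin k n q f = -(g * f) := by
  rw [antipodeLin_apply, antipodeOp, lift_F]; rfl
@[simp] theorem antipodeLin_K : antipodeLin k n q g = gi := by
  rw [antipodeLin_apply, antipodeOp, lift_K]; rfl
@[simp] theorem antipodeLin_Ki : antipodeLin k n q gi = g := by
  have h1 : gi = g ^ (n - 1) := rfl
  rw [h1, antipodeLin_apply, map_pow, MulOpposite.unop_pow, ← antipodeLin_apply,
    antipodeLin_K, pow_pred_eq q Ki_pow Ki_K]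

theorem antipode_left_mul (s t : Uq k n q ⊗[k] Uq k n q) (c : k)
    (hs : LinearMap.mul' k _ ((antipodeLin k n q).rTensor _ s) = algebraMap k _ c) :
    LinearMap.mul' k _ ((antipodeLin k n q).rTensor _ (s * t)) =
      c • LinearMap.mul' k _ ((antipodeLin k n q).rTensor _ t) := by
  induction t with
  | zero => simp
  | add t t' h1 h2 => simp only [mul_add, map_add, h1, h2, smul_add]
  | tmul u v =>
    have key : LinearMap.mul' k _ ((antipodeLin k n q).rTensor _ (s * u ⊗ₜ v)) =
        antipodeLin k n q u * LinearMap.mul' k _ ((antipodeLin k n q).rTensor _ s) * v := by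
      clear hs
      induction s with
      | zero => simp
      | add t t' h1 h2 => simp only [add_mul, mul_add, map_add, h1, h2]
      | tmul x y => simp [antipodeLin_mul, mul_assoc]
    rw [key, hs]
    simp [Algebra.algebraMap_eq_smul_one]

theorem antipode_right_mul (s t : Uq k n q ⊗[k] Uq k n q) (c : k)
    (ht : LinearMap.mul' k _ ((antipodeLin k n q).lTensor _ t) = algebraMap k _ c) :
    LinearMap.mul' k _ ((antipodeLin k n q).lTensor _ (s * t)) =
      c • LinearMap.mul' k _ ((antipodeLin k n q).lTensor _ s) := by
  induction s with
  | zero => simp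
  | add t t' h1 h2 => simp only [add_mul, map_add, h1, h2, smul_add]
  | tmul u v =>
    have key : LinearMap.mul' k _ ((antipodeLin k n q).lTensor _ (u ⊗ₜ v * t)) =
        u * LinearMap.mul' k _ ((antipodeLin k n q).lTensor _ t) * antipodeLin k n q v := by
      clear ht
      induction t with
      | zero => simp
      | add t t' h1 h2 => simp only [add_mul, mul_add, map_add, h1, h2]
      | tmul x y => simp [antipodeLin_mul, mul_assoc]
    rw [key, ht]
    simp [Algebra.algebraMap_eq_smul_one]

instance : HopfAlgebra k (Uq k n q) where
  antipode := antipodeLin k n q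
  mul_antipode_rTensor_comul := by
    refine LinearMap.ext fun x => ?_
    simp only [LinearMap.comp_apply, Algebra.linearMap_apply]
    induction x using induction with
    | h1 c =>
      simp [Algebra.algebraMap_eq_smul_one, Algebra.TensorProduct.one_def]
    | hE => simp [mul_assoc]
    | hF => simp
    | hK => simp
    | hmul x y hx hy =>
      rw [Bialgebra.comul_mul, antipode_left_mul _ _ _ hx, hy, Bialgebra.counit_mul, map_mul,
        Algebra.smul_def]
    | hadd x y hx hy => simp only [map_add, hx, hy]
  mul_antipode_lTensor_comul := by
    refine LinearMap.ext fun x => ?_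
    simp only [LinearMap.comp_apply, Algebra.linearMap_apply]
    induction x using induction with
    | h1 c =>
      simp [Algebra.algebraMap_eq_smul_one, Algebra.TensorProduct.one_def]
    | hE => simp
    | hF => simp [← mul_assoc]
    | hK => simp
    | hmul x y hx hy =>
      rw [Bialgebra.comul_mul, antipode_right_mul _ _ _ hy, hx, Bialgebra.counit_mul, mul_comm,
        map_mul, Algebra.smul_def]
    | hadd x y hx hy => simp only [map_add, hx, hy]

@[simp] theorem antipode_E : antipode k e = -(e * gi) := antipodeLin_E
@[simp] theorem antipode_F : antipode k f = -(g * f) := antipodeLin_F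
@[simp] theorem antipode_K : antipode k g = gi := antipodeLin_K

theorem antipode_surjective : Function.Surjective (antipode k (A := Uq k n q)) := by
  intro x
  have hKi : antipode k gi = g := antipodeLin_Ki
  induction x using induction with
  | h1 c => exact ⟨algebraMap k _ c, by simp [Algebra.algebraMap_eq_smul_one]⟩
  | hE =>
    refine ⟨-(gi * e), ?_⟩
    rw [map_neg, antipode_mul_antidistrib, antipode_E, hKi, neg_mul, neg_neg, mul_assoc, Ki_K,
      mul_one]
  | hF =>
    refine ⟨-(f * g), ?_⟩
    rw [map_neg, antipode_mul_antidistrib, antipode_F, antipode_K, mul_neg, neg_neg, ← mul_assoc,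
      Ki_K, one_mul]
  | hK => exact ⟨gi, hKi⟩
  | hmul x y hx hy =>
    obtain ⟨x, rfl⟩ := hx
    obtain ⟨y, rfl⟩ := hy
    exact ⟨y * x, antipode_mul_antidistrib ..⟩
  | hadd x y hx hy =>
    obtain ⟨x, rfl⟩ := hx
    obtain ⟨y, rfl⟩ := hy
    exact ⟨x + y, map_add ..⟩

/-! ### Finite dimension -/

variable (k n q) in
/-- The span of the monomials `E^i F^j K^l`. -/
def mono : Submodule k (Uq k n q) :=
  Submodule.span k (Set.range fun t : ℕ × ℕ × ℕ => e ^ t.1 * f ^ t.2.1 * g ^ t.2.2)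

theorem mono_mem (i j l : ℕ) : e ^ i * f ^ j * g ^ l ∈ mono k n q :=
  Submodule.subset_span ⟨(i, j, l), rfl⟩

theorem mono_induct {a : Uq k n q} (h : ∀ i j l : ℕ, a * (e ^ i * f ^ j * g ^ l) ∈ mono k n q)
    {x : Uq k n q} (hx : x ∈ mono k n q) : a * x ∈ mono k n q := by
  induction hx using Submodule.span_induction with
  | mem x hx => obtain ⟨t, rfl⟩ := hx; exact h _ _ _
  | zero => simp
  | add x y _ _ hx hy => rw [mul_add]; exact add_mem hx hy
  | smul c x _ hx => rw [mul_smul_comm]; exact Submodule.smul_mem _ _ hx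

theorem E_mono {x : Uq k n q} (hx : x ∈ mono k n q) : e * x ∈ mono k n q :=
  mono_induct (fun i j l => by
    rw [← mul_assoc, ← mul_assoc, ← pow_succ']; exact mono_mem _ _ _) hx

theorem K_mono {x : Uq k n q} (hx : x ∈ mono k n q) : g * x ∈ mono k n q :=
  mono_induct (fun i j l => by
    rw [← mul_assoc, ← mul_assoc, qcomm_pow (K_E k n q), smul_mul_assoc, mul_assoc _ g,
      qcomm_pow (K_F k n q), mul_smul_comm, smul_smul, smul_mul_assoc, ← mul_assoc, mul_assoc _ g,
      ← pow_succ']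
    exact Submodule.smul_mem _ _ (mono_mem _ _ _)) hx

theorem Ki_mono {x : Uq k n q} (hx : x ∈ mono k n q) : gi * x ∈ mono k n q := by
  rw [Ki]
  generalize n - 1 = m
  induction m with
  | zero => simpa
  | succ m ih => rw [pow_succ', mul_assoc]; exact K_mono ih

theorem F_mono {x : Uq k n q} (hx : x ∈ mono k n q) : f * x ∈ mono k n q := by
  refine mono_induct (fun i j l => ?_) hx
  induction i with
  | zero =>
    rw [pow_zero, one_mul, ← mul_assoc, ← pow_succ']
    simpa using mono_mem (k := k) (n := n) (q := q) 0 (j + 1) l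
  | succ i ih =>
    have h1 : f * e = e * f - (q - q⁻¹)⁻¹ • (g - gi) := by rw [← E_F]; abel
    rw [pow_succ', mul_assoc e, mul_assoc e, ← mul_assoc f, h1, sub_mul, smul_mul_assoc, sub_mul,
      mul_assoc]
    exact sub_mem (E_mono ih) (Submodule.smul_mem _ _ (sub_mem (K_mono (mono_mem _ _ _))
      (Ki_mono (mono_mem _ _ _))))

theorem mono_eq_top : mono k n q = ⊤ := by
  refine (Submodule.eq_top_iff').2 fun x => ?_
  have h : ∀ y ∈ mono k n q, x * y ∈ mono k n q := by
    induction x using induction with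
    | h1 c => intro y hy; rw [← Algebra.smul_def]; exact Submodule.smul_mem _ _ hy
    | hE => exact fun y => E_mono
    | hF => exact fun y => F_mono
    | hK => exact fun y => K_mono
    | hmul x y hx hy => intro z hz; rw [mul_assoc]; exact hx _ (hy _ hz)
    | hadd x y hx hy => intro z hz; rw [add_mul]; exact add_mem (hx _ hz) (hy _ hz)
  simpa using h 1 (by simpa using mono_mem (k := k) (n := n) (q := q) 0 0 0)

instance : FiniteDimensional k (Uq k n q) := by
  have hfin : (Set.range fun t : ℕ × ℕ × ℕ => e ^ t.1 * f ^ t.2.1 * g ^ t.2.2).Finite := by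
    refine Set.Finite.subset (((Set.finite_Iic n).prod ((Set.finite_Iic n).prod
      (Set.finite_Iic n))).image fun t : ℕ × ℕ × ℕ => e ^ t.1 * f ^ t.2.1 * g ^ t.2.2) ?_
    rintro _ ⟨⟨i, j, l⟩, rfl⟩
    refine ⟨(min i n, min j n, l % n), ?_, ?_⟩
    · exact Set.mk_mem_prod (min_le_right i n) (Set.mk_mem_prod (min_le_right j n)
        (Nat.mod_lt l (n_pos n q)).le)
    · have hmin : ∀ {x : Uq k n q} (_ : x ^ n = 0) (i : ℕ), x ^ min i n = x ^ i := by
        intro x hx i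
        rcases le_total i n with h | h
        · rw [min_eq_left h]
        · rw [min_eq_right h, hx, pow_eq_zero_of_le h hx]
      have hK : g ^ (l % n) = g ^ l := by
        conv_rhs => rw [← Nat.mod_add_div l n, pow_add, pow_mul, K_pow, one_pow, mul_one]
      simp only [hmin (E_pow k n q), hmin (F_pow k n q), hK]
  rw [FiniteDimensional, Module.finite_def, ← mono_eq_top]
  exact Submodule.fg_span hfin

instance : BijectiveAntipode k (Uq k n q) :=
  ⟨LinearMap.injective_iff_surjective.2 antipode_surjective, antipode_surjective⟩

/-! ### The two-dimensional representation -/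

theorem rho_K_pow : (!![q, 0; 0, q⁻¹] : Matrix (Fin 2) (Fin 2) k) ^ n = 1 := by
  have h1 : (!![q, 0; 0, q⁻¹] : Matrix (Fin 2) (Fin 2) k) = Matrix.diagonal ![q, q⁻¹] := by
    ext i j; fin_cases i <;> fin_cases j <;> rfl
  rw [h1, Matrix.diagonal_pow, ← Matrix.diagonal_one]
  congr 1
  ext i; fin_cases i <;> simp [h.primitive.pow_eq_one]

theorem pow_eq_zero_of_sq {B : Type*} [MonoidWithZero B] (n : ℕ) (q : k) [h : OddPrimitiveRoot n q]
    {x : B} (hx : x * x = 0) : x ^ n = 0 :=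
  pow_eq_zero_of_le (by have := h.three_le; omega : 2 ≤ n) (by rw [pow_two, hx])

theorem q_sub_ne_zero (n : ℕ) (q : k) [h : OddPrimitiveRoot n q] : q - q⁻¹ ≠ 0 := by
  intro h0
  have hq := q_ne_zero n q
  have h3 := h.three_le
  refine (sq_primitive n q).pow_ne_one_of_pos_of_lt one_ne_zero (by omega) ?_
  field_simp at h0
  linear_combination h0

variable (k n q) in
/-- The representation of `u_q(sl_2)` on the two-dimensional module `V` with basis `v₀, v₁` and
`E v₁ = v₀`, `F v₀ = v₁`, `K v₀ = q v₀`, `K v₁ = q⁻¹ v₁`, `E v₀ = F v₁ = 0`. -/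
def rho : Uq k n q →ₐ[k] Matrix (Fin 2) (Fin 2) k :=
  lift !![0, 1; 0, 0] !![0, 0; 1, 0] !![q, 0; 0, q⁻¹] rho_K_pow
    (pow_eq_zero_of_sq n q (by simp [← Matrix.ext_iff]))
    (pow_eq_zero_of_sq n q (by simp [← Matrix.ext_iff]))
    (by
      have := q_ne_zero n q
      ext i j; fin_cases i <;> fin_cases j <;> simp
      field_simp)
    (by
      have := q_ne_zero n q
      ext i j; fin_cases i <;> fin_cases j <;> simp
      field_simp)
    (by
      have hq := q_ne_zero n q
      have h1 := q_sub_ne_zero n q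
      rw [pow_pred_eq q rho_K_pow (y := !![q⁻¹, 0; 0, q])
        (by ext i j; fin_cases i <;> fin_cases j <;> simp [hq])]
      ext i j
      fin_cases i <;> fin_cases j <;> simp [h1]
      rw [← neg_sub q q⁻¹, mul_neg, inv_mul_cancel₀ h1])

@[simp] theorem rho_E : rho k n q e = !![0, 1; 0, 0] := lift_E ..
@[simp] theorem rho_F : rho k n q f = !![0, 0; 1, 0] := lift_F ..
@[simp] theorem rho_K : rho k n q g = !![q, 0; 0, q⁻¹] := lift_K ..

variable (k n q) in
/-- The matrix coefficients `x ↦ ρ(x) i j` of `ρ`. -/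
def coeff (i j : Fin 2) : DualCop k (Uq k n q) :=
  DualCop.of (Matrix.entryLinearMap k k i j ∘ₗ (rho k n q).toLinearMap)

theorem coeff_apply (i j : Fin 2) (x : Uq k n q) : coeff k n q i j x = rho k n q x i j := rfl

end Uq

end SmallQuantumGroup

section Presentation

/-- The generators of the presentation of `D(u_q(sl_2))`. -/
inductive DGen | a | b | c | d | E | F | K

variable (k : Type*) [Field k] (n : ℕ) (q : k)

local notation "xa" => FreeAlgebra.ι k DGen.a
local notation "xb" => FreeAlgebra.ι k DGen.b
local notation "xc" => FreeAlgebra.ι k DGen.c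
local notation "xd" => FreeAlgebra.ι k DGen.d
local notation "xE" => FreeAlgebra.ι k DGen.E
local notation "xF" => FreeAlgebra.ι k DGen.F
local notation "xK" => FreeAlgebra.ι k DGen.K

/-- The relations of the presentation of `D(u_q(sl_2))`; since `Kⁿ = 1`, the inverse of `K` is
`Kⁿ⁻¹`. -/
inductive DRel :
    FreeAlgebra k DGen → FreeAlgebra k DGen → Prop
  | a_pow : DRel (xa ^ n) 1
  | d_pow : DRel (xd ^ n) 1
  | K_pow : DRel (xK ^ n) 1
  | b_pow : DRel (xb ^ n) 0
  | c_pow : DRel (xc ^ n) 0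
  | E_pow : DRel (xE ^ n) 0
  | F_pow : DRel (xF ^ n) 0
  | ba : DRel (xb * xa) (q • (xa * xb))
  | db : DRel (xd * xb) (q • (xb * xd))
  | ca : DRel (xc * xa) (q • (xa * xc))
  | dc : DRel (xd * xc) (q • (xc * xd))
  | bc : DRel (xb * xc) (xc * xb)
  | ad : DRel (xa * xd) (q⁻¹ • (xb * xc) + 1)
  | KE : DRel (xK * xE) (q ^ 2 • (xE * xK))
  | KF : DRel (xK * xF) ((q ^ 2)⁻¹ • (xF * xK))
  | EF : DRel (xE * xF - xF * xE) ((q - q⁻¹)⁻¹ • (xK - xK ^ (n - 1)))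
  | Ka : DRel (xK * xa) (xa * xK)
  | Kb : DRel (xK * xb) ((q ^ 2)⁻¹ • (xb * xK))
  | Kc : DRel (xK * xc) (q ^ 2 • (xc * xK))
  | Kd : DRel (xK * xd) (xd * xK)
  | Ea : DRel (xE * xa) (q⁻¹ • (xa * xE) - q⁻¹ • xc)
  | Eb : DRel (xE * xb) (q⁻¹ • (xb * xE) + q⁻¹ • (xa * xK) - q⁻¹ • xd)
  | Ec : DRel (xE * xc) (q • (xc * xE))
  | Ed : DRel (xE * xd) (q • (xd * xE) + q • (xc * xK))
  | Fa : DRel (xF * xa) (q⁻¹ • (xa * xF) + xb)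
  | Fb : DRel (xF * xb) (q • (xb * xF))
  | Fc : DRel (xF * xc) (q⁻¹ • (xc * xF) - xa * xK ^ (n - 1) + xd)
  | Fd : DRel (xF * xd) (q • (xd * xF) - q ^ 2 • (xb * xK ^ (n - 1)))

/-- The `k`-algebra with generators `a, b, c, d, E, F, K` and the relations `DRel`. -/
abbrev PresentedDouble : Type _ := RingQuot (DRel k n q)

/-- The class of a generator in the presented algebra. -/
def PresentedDouble.gen (x : DGen) : PresentedDouble k n q :=
  RingQuot.mkAlgHom k (DRel k n q) (FreeAlgebra.ι k x)

variable [OddPrimitiveRoot n q]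

/-- The Drinfel'd double `D(u_q(sl_2))`. -/
abbrev DUq : Type _ := DrinfeldDouble k (Uq k n q)

namespace DUq

/-- `a = A ⋈ 1`; here `A, B, C, D` are the entries of the matrix-valued function `ρ`, listed by
rows. -/
def a : DUq k n q := DrinfeldDouble.mk (Uq.coeff k n q 0 0) 1
/-- `b = B ⋈ 1`. -/
def b : DUq k n q := DrinfeldDouble.mk (Uq.coeff k n q 0 1) 1
/-- `c = C ⋈ 1`. -/
def c : DUq k n q := DrinfeldDouble.mk (Uq.coeff k n q 1 0) 1
/-- `d = D ⋈ 1`. -/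
def d : DUq k n q := DrinfeldDouble.mk (Uq.coeff k n q 1 1) 1
/-- `E = ε ⋈ E`. -/
def E : DUq k n q := DrinfeldDouble.mk 1 (Uq.E k n q)
/-- `F = ε ⋈ F`. -/
def F : DUq k n q := DrinfeldDouble.mk 1 (Uq.F k n q)
/-- `K = ε ⋈ K`. -/
def K : DUq k n q := DrinfeldDouble.mk 1 (Uq.K k n q)
/-- `K⁻¹ = Kⁿ⁻¹`. -/
def Ki : DUq k n q := K k n q ^ (n - 1)

end DUq

end Presentation

end QDouble

end

open QDouble

/-!
The seven generators satisfy the relations, so there is an algebra map from the presented algebra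
`P` to the double `D = H^{* cop} ⊗ H`, where `H = u_q(sl_2)`. It is surjective, and `dim P ≤ dim D`;
hence it is bijective.

*Relations.* The relations between `E, F, K` and `a, b, c, d` are the product formula of the double
for `Δ²(E)`, `Δ²(F)`, `Δ²(K)`, since translating the matrix `(A, B; C, D)` of coefficients of the
representation `V` is multiplying it by `ρ(S⁻¹(x))` on the left or by `ρ(x)` on the right. The
quadratic relations between `a, b, c, d` say that `v₁ ⊗ v₀ - q v₀ ⊗ v₁` and the covector with the
same coordinates are invariant under `V ⊗ V` (`Uq.coeffSq_mulVec`, `Uq.vecMul_coeffSq`). By the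
`q`-binomial theorem `Δ(aⁿ) = aⁿ ⊗ aⁿ + cⁿ ⊗ bⁿ`, and likewise for the other coefficients: the `n`-th
powers of the coefficients are again the coefficients of a representation of `H`. As `E` and `F` act
on it by `0` and `K` by `1`, it is trivial (`Uq.coeff_pow_apply`).

*Dimensions.* The translations of the dual by `E` and by `F` lower the exponents of `b` and of `c` in
`aˢ bᵗ cʳ`, with coefficients that are quantum integers up to sign and powers of `q`, hence nonzero
for exponents below `n`. Applying them until `b` and `c` are used up and evaluating at the powers of
`K` leaves a Vandermonde system, so the `n³` monomials with exponents below `n` are linearly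
independent (`Uq.linearIndependent_coeffMono`). Since the `n³` monomials `Eⁱ Fʲ Kˡ` span `H`, it
follows that `dim H = n³` and that the monomials `aˢ bᵗ cʳ` are a basis of the dual. In particular
`A, B, C` generate the dual, which gives surjectivity, and `dim D = n⁶`.

In `P` the relation for `a d` eliminates `d = aⁿ⁻¹ (q⁻¹ b c + 1)`, and the relations move `E, F, K`
past `a, b, c`; so `P` is spanned by the products `aˢ bᵗ cʳ u` with `s, t, r < n` and `u` in the image
of `H` (`PresentedDouble.triangular_eq_top`), and `dim P ≤ n⁶`.
-/

/-! ### The matrix coefficients of the two-dimensional representation -/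

namespace QDouble

namespace Uq

variable {k : Type*} [Field k] {n : ℕ} {q : k} [h : OddPrimitiveRoot n q]

theorem antipodeInv_E : antipodeInv k (Uq k n q) (E k n q) = -(Ki k n q * E k n q) := by
  have hKi : antipode k (Ki k n q) = K k n q := antipodeLin_Ki
  apply antipode_inj k
  rw [antipode_antipodeInv, map_neg, antipode_mul_antidistrib, antipode_E, hKi, neg_mul, neg_neg,
    mul_assoc, Ki_K, mul_one]

theorem antipodeInv_F : antipodeInv k (Uq k n q) (F k n q) = -(F k n q * K k n q) := by
  apply antipode_inj k
  rw [antipode_antipodeInv, map_neg, antipode_mul_antidistrib, antipode_F, antipode_K, mul_neg,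
    neg_neg, ← mul_assoc, Ki_K, one_mul]

theorem antipodeInv_K : antipodeInv k (Uq k n q) (K k n q) = Ki k n q := by
  have hKi : antipode k (Ki k n q) = K k n q := antipodeLin_Ki
  exact antipode_inj k (by rw [antipode_antipodeInv, hKi])

theorem antipodeInv_Ki : antipodeInv k (Uq k n q) (Ki k n q) = K k n q :=
  antipode_inj k (by rw [antipode_antipodeInv, antipode_K])

@[simp] theorem rho_Ki : rho k n q (Ki k n q) = !![q⁻¹, 0; 0, q] := by
  have hq := q_ne_zero n q
  rw [Ki, map_pow, rho_K]
  exact pow_pred_eq q rho_K_pow (by ext i j; fin_cases i <;> fin_cases j <;> simp [hq])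

theorem rho_antipodeInv_E : rho k n q (antipodeInv k _ (E k n q)) = !![0, -q⁻¹; 0, 0] := by
  rw [antipodeInv_E, map_neg, map_mul, rho_Ki, rho_E]
  ext i j; fin_cases i <;> fin_cases j <;> simp

theorem rho_antipodeInv_F : rho k n q (antipodeInv k _ (F k n q)) = !![0, 0; -q, 0] := by
  rw [antipodeInv_F, map_neg, map_mul, rho_K, rho_F]
  ext i j; fin_cases i <;> fin_cases j <;> simp

theorem rho_antipodeInv_K : rho k n q (antipodeInv k _ (K k n q)) = !![q⁻¹, 0; 0, q] := by
  rw [antipodeInv_K, rho_Ki]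

theorem rho_antipodeInv_Ki : rho k n q (antipodeInv k _ (Ki k n q)) = !![q, 0; 0, q⁻¹] := by
  rw [antipodeInv_Ki, rho_K]

theorem lact_coeff (x : Uq k n q) (i j : Fin 2) :
    DualCop.lact k _ x (coeff k n q i j) = ∑ m, rho k n q x m j • coeff k n q i m := by
  ext y
  rw [DualCop.lact_apply, coeff_apply, map_mul, Matrix.mul_apply]
  simp [coeff_apply, mul_comm]

theorem ract_coeff (x : Uq k n q) (i j : Fin 2) :
    DualCop.ract k _ x (coeff k n q i j) =
      ∑ m, rho k n q (antipodeInv k _ x) i m • coeff k n q m j := by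
  ext y
  rw [DualCop.ract_apply, coeff_apply, map_mul, Matrix.mul_apply]
  simp [coeff_apply]

theorem comul_coeff (i j : Fin 2) : comul (R := k) (coeff k n q i j) =
    ∑ m, coeff k n q m j ⊗ₜ[k] coeff k n q i m := by
  refine DualCop.tensor_ext fun x => ?_
  rw [DualCop.tensorEquiv_comul, lact_coeff]
  simp [coeff_apply]

/-- `V ⊗ V`, as a matrix representation on `Fin 2 × Fin 2`; its entries are the products of two
matrix coefficients of `V`. -/
noncomputable def coeffSq (x : Uq k n q) : Matrix (Fin 2 × Fin 2) (Fin 2 × Fin 2) k :=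
  fun r s => (coeff k n q r.1 s.1 * coeff k n q r.2 s.2) x

theorem coeffSq_mul (x y : Uq k n q) : coeffSq (x * y) = coeffSq x * coeffSq y := by
  ext r s
  have h1 := DualCop.lact_mul (ℛ k y) (coeff k n q r.1 s.1) (coeff k n q r.2 s.2)
  have h2 := congrArg (fun p : DualCop k (Uq k n q) => p x) h1
  simp only [DualCop.lact_apply] at h2
  rw [coeffSq, h2]
  simp only [lact_coeff, map_sum, LinearMap.sum_apply, Matrix.mul_apply, Fintype.sum_prod_type,
    coeffSq, DualCop.mul_apply (ℛ k y), Finset.sum_mul, Finset.mul_sum, smul_mul_assoc,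
    mul_smul_comm, map_smul, LinearMap.smul_apply, smul_eq_mul, coeff_apply]
  rw [Finset.sum_comm, Finset.sum_congr rfl (fun m _ => Finset.sum_comm), Finset.sum_comm]
  refine Finset.sum_congr rfl fun m _ => Finset.sum_congr rfl fun m' _ =>
    Finset.sum_congr rfl fun i _ => ?_
  ring

end Uq
end QDouble

/-! ### Quadratic relations between the matrix coefficients -/

namespace QDouble

section TwoTerm

variable {k : Type*} [Field k] {H : Type*} [Ring H] [HopfAlgebra k H]

/-- A comultiplication `Δ(x) = s ⊗ t + u ⊗ v`, as a sum over `Bool`. -/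
def reprPair {x s t u v : H} (hx : comul (R := k) x = s ⊗ₜ t + u ⊗ₜ v) : Repr k x Bool where
  index := Finset.univ
  left i := cond i s u
  right i := cond i t v
  eq := by simp [hx]

namespace DualCop

theorem mul_apply_pair {x s t u v : H} (hx : comul (R := k) x = s ⊗ₜ t + u ⊗ₜ v)
    (p r : DualCop k H) : (p * r) x = p s * r t + p u * r v := by
  rw [mul_apply (reprPair hx)]
  simp [reprPair]

theorem mul_apply_groupLike {x : H} (hx : comul (R := k) x = x ⊗ₜ x) (p r : DualCop k H) :
    (p * r) x = p x * r x := by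
  have := mul_apply_pair (u := 0) (v := 0) (by simpa using hx) p r
  simpa using this

theorem pow_apply_groupLike {x : H} (hx : comul (R := k) x = x ⊗ₜ x)
    (h1 : counit (R := k) x = 1) (p : DualCop k H) (m : ℕ) : (p ^ m) x = p x ^ m := by
  induction m with
  | zero => simp [h1]
  | succ m ih => rw [pow_succ, mul_apply_groupLike hx, ih, pow_succ]

theorem mul_apply_one (p r : DualCop k H) : (p * r) (1 : H) = p 1 * r 1 :=
  mul_apply_groupLike (by simp [Algebra.TensorProduct.one_def]) p r

theorem pow_apply_one (p : DualCop k H) (m : ℕ) : (p ^ m) (1 : H) = p 1 ^ m :=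
  pow_apply_groupLike (by simp [Algebra.TensorProduct.one_def]) (by simp) p m

theorem lact_mul_pair {x s t u v : H} (hx : comul (R := k) x = s ⊗ₜ t + u ⊗ₜ v)
    (p r : DualCop k H) :
    lact k H x (p * r) = lact k H s p * lact k H t r + lact k H u p * lact k H v r := by
  rw [lact_mul (reprPair hx)]
  simp [reprPair]

theorem ract_mul_pair [BijectiveAntipode k H] {x s t u v : H}
    (hx : comul (R := k) x = s ⊗ₜ t + u ⊗ₜ v) (p r : DualCop k H) :
    ract k H x (p * r) = ract k H t p * ract k H s r + ract k H v p * ract k H u r := by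
  rw [ract_mul (reprPair hx)]
  simp [reprPair]

theorem lact_mul_groupLike {x : H} (hx : comul (R := k) x = x ⊗ₜ x) (p r : DualCop k H) :
    lact k H x (p * r) = lact k H x p * lact k H x r := by
  simpa using lact_mul_pair (u := 0) (v := 0) (by simpa using hx) p r

theorem ract_mul_groupLike [BijectiveAntipode k H] {x : H} (hx : comul (R := k) x = x ⊗ₜ x)
    (p r : DualCop k H) : ract k H x (p * r) = ract k H x p * ract k H x r := by
  simpa using ract_mul_pair (u := 0) (v := 0) (by simpa using hx) p r

end DualCop

end TwoTerm

namespace Uq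

variable {k : Type*} [Field k] {n : ℕ} {q : k} [h : OddPrimitiveRoot n q]

local notation "cA" => coeff k n q 0 0
local notation "cB" => coeff k n q 0 1
local notation "cC" => coeff k n q 1 0
local notation "cD" => coeff k n q 1 1

theorem comul_Ki : comul (R := k) (Ki k n q) = Ki k n q ⊗ₜ Ki k n q := comulHom_Ki

theorem counit_Ki : counit (R := k) (Ki k n q) = 1 := counitHom_Ki

open DualCop

variable (k n q) in
/-- The vector `v₁ ⊗ v₀ - q v₀ ⊗ v₁` of `V ⊗ V`, by coordinates. -/
def invVec : Fin 2 × Fin 2 → k := fun r => !![0, -q; 1, 0] r.1 r.2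

@[simp] theorem invVec_zero_zero : invVec k q (0, 0) = 0 := rfl
@[simp] theorem invVec_zero_one : invVec k q (0, 1) = -q := rfl
@[simp] theorem invVec_one_zero : invVec k q (1, 0) = 1 := rfl
@[simp] theorem invVec_one_one : invVec k q (1, 1) = 0 := rfl

theorem mul_apply_E (p r : DualCop k (Uq k n q)) :
    (p * r) (E k n q) = p 1 * r (E k n q) + p (E k n q) * r (K k n q) :=
  mul_apply_pair (H := Uq k n q) comul_E p r

theorem mul_apply_F (p r : DualCop k (Uq k n q)) :
    (p * r) (F k n q) = p (Ki k n q) * r (F k n q) + p (F k n q) * r 1 :=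
  mul_apply_pair (H := Uq k n q) comul_F p r

theorem mul_apply_K (p r : DualCop k (Uq k n q)) :
    (p * r) (K k n q) = p (K k n q) * r (K k n q) :=
  mul_apply_groupLike (H := Uq k n q) comul_K p r

theorem coeffSq_add (x y : Uq k n q) : coeffSq (x + y) = coeffSq x + coeffSq y := by
  ext r s
  exact map_add (toLin _) x y

theorem coeffSq_algebraMap (c : k) : coeffSq (algebraMap k (Uq k n q) c) = c • 1 := by
  ext ⟨i, j⟩ ⟨i', j'⟩
  simp only [coeffSq, Algebra.algebraMap_eq_smul_one, map_smul, mul_apply_one, coeff_apply, map_one,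
    Matrix.smul_apply, Matrix.one_apply, Prod.mk.injEq, ite_and]
  split_ifs <;> simp

/-- The vector `invVec` is invariant: `u_q(sl_2)` acts on it through the counit. -/
theorem coeffSq_mulVec (x : Uq k n q) :
    Matrix.mulVec (coeffSq x) (invVec k q) = counit (R := k) x • invVec k q := by
  have hq := q_ne_zero n q
  induction x using induction with
  | h1 c =>
    rw [coeffSq_algebraMap, Matrix.smul_mulVec, Matrix.one_mulVec,
      Bialgebra.counit_algebraMap]
  | hE =>
    ext ⟨i, j⟩
    simp only [Matrix.mulVec, dotProduct, coeffSq, mul_apply_E, coeff_apply, map_one, counit_E,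
      rho_E, rho_K, Fintype.sum_prod_type, Fin.sum_univ_two]
    fin_cases i <;> fin_cases j <;> simp [Matrix.one_apply]
  | hF =>
    ext ⟨i, j⟩
    simp only [Matrix.mulVec, dotProduct, coeffSq, mul_apply_F, coeff_apply, map_one, counit_F,
      rho_F, rho_Ki, Fintype.sum_prod_type, Fin.sum_univ_two]
    fin_cases i <;> fin_cases j <;> simp [Matrix.one_apply]
  | hK =>
    ext ⟨i, j⟩
    simp only [Matrix.mulVec, dotProduct, coeffSq, mul_apply_K, coeff_apply, counit_K,
      rho_K, Fintype.sum_prod_type, Fin.sum_univ_two]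
    fin_cases i <;> fin_cases j <;> simp [hq]
  | hmul x y hx hy =>
    rw [coeffSq_mul, ← Matrix.mulVec_mulVec, hy, Matrix.mulVec_smul, hx, smul_smul,
      Bialgebra.counit_mul, mul_comm]
  | hadd x y hx hy => rw [coeffSq_add, Matrix.add_mulVec, hx, hy, map_add, add_smul]

/-- The covector with the coordinates of `invVec` is invariant as well. -/
theorem vecMul_coeffSq (x : Uq k n q) :
    Matrix.vecMul (invVec k q) (coeffSq x) = counit (R := k) x • invVec k q := by
  have hq := q_ne_zero n q
  induction x using induction with
  | h1 c => 
    rw [coeffSq_algebraMap, Matrix.vecMul_smul, Matrix.vecMul_one,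
      Bialgebra.counit_algebraMap]
  | hE =>
    ext ⟨i, j⟩
    simp only [Matrix.vecMul, dotProduct, coeffSq, mul_apply_E, coeff_apply, map_one, counit_E,
      rho_E, rho_K, Fintype.sum_prod_type, Fin.sum_univ_two]
    fin_cases i <;> fin_cases j <;> simp [hq, Matrix.one_apply]
  | hF =>
    ext ⟨i, j⟩
    simp only [Matrix.vecMul, dotProduct, coeffSq, mul_apply_F, coeff_apply, map_one, counit_F,
      rho_F, rho_Ki, Fintype.sum_prod_type, Fin.sum_univ_two]
    fin_cases i <;> fin_cases j <;> simp [hq, Matrix.one_apply]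
  | hK =>
    ext ⟨i, j⟩
    simp only [Matrix.vecMul, dotProduct, coeffSq, mul_apply_K, coeff_apply, counit_K,
      rho_K, Fintype.sum_prod_type, Fin.sum_univ_two]
    fin_cases i <;> fin_cases j <;> simp [hq]
  | hmul x y hx hy =>
    rw [coeffSq_mul, ← Matrix.vecMul_vecMul, hx, Matrix.smul_vecMul, hy, smul_smul,
      Bialgebra.counit_mul]
  | hadd x y hx hy => rw [coeffSq_add, Matrix.vecMul_add, hx, hy, map_add, add_smul]

/-- The invariance of `invVec`, row by row, as a relation between products of coefficients. -/
theorem coeff_row (x : Uq k n q) (i j : Fin 2) :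
    (coeff k n q i 1 * coeff k n q j 0) x - q * (coeff k n q i 0 * coeff k n q j 1) x =
      counit (R := k) x * invVec k q (i, j) := by
  have := congrFun (coeffSq_mulVec x) (i, j)
  simp [Matrix.mulVec, dotProduct, coeffSq, Fintype.sum_prod_type, Fin.sum_univ_two] at this
  linear_combination this

/-- The invariance of the covector, column by column. -/
theorem coeff_col (x : Uq k n q) (i j : Fin 2) :
    (coeff k n q 1 i * coeff k n q 0 j) x - q * (coeff k n q 0 i * coeff k n q 1 j) x =
      counit (R := k) x * invVec k q (i, j) := by
  have := congrFun (vecMul_coeffSq x) (i, j)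
  simp [Matrix.vecMul, dotProduct, coeffSq, Fintype.sum_prod_type, Fin.sum_univ_two] at this
  linear_combination this

theorem coeff_ba : cB * cA = q • (cA * cB) := by
  ext x
  have := coeff_row x 0 0
  simp at this
  simpa [sub_eq_zero] using this

theorem coeff_db : cD * cB = q • (cB * cD) := by
  ext x
  have := coeff_col x 1 1
  simp at this
  simpa [sub_eq_zero] using this

theorem coeff_ca : cC * cA = q • (cA * cC) := by
  ext x
  have := coeff_col x 0 0
  simp at this
  simpa [sub_eq_zero] using this

theorem coeff_dc : cD * cC = q • (cC * cD) := by
  ext x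
  have := coeff_row x 1 1
  simp at this
  simpa [sub_eq_zero] using this

theorem coeff_bc : cB * cC = cC * cB := by
  ext x
  have h1 := coeff_row x 0 1
  have h2 := coeff_col x 0 1
  linear_combination h1 - h2

theorem coeff_ad : cA * cD = q⁻¹ • (cB * cC) + 1 := by
  have hq := q_ne_zero n q
  ext x
  have h1 := coeff_row x 0 1
  simp at h1
  simp
  field_simp
  linear_combination -h1

end Uq
end QDouble

/-! ### The `n`-th powers of the matrix coefficients -/

namespace QDouble

namespace DualCop

variable {k : Type*} [Field k] {H : Type*} [Ring H] [HopfAlgebra k H] [FiniteDimensional k H]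

theorem apply_mul_of_comul {p s t u v : DualCop k H}
    (hp : comul (R := k) p = s ⊗ₜ t + u ⊗ₜ v) (x y : H) : p (x * y) = s y * t x + u y * v x := by
  have h1 := congrArg (fun r : DualCop k H => r x) (tensorEquiv_comul p y)
  rw [hp] at h1
  simpa using h1.symm

end DualCop

namespace Uq

open DualCop

variable {k : Type*} [Field k] {n : ℕ} {q : k} [h : OddPrimitiveRoot n q]

local notation "cA" => coeff k n q 0 0
local notation "cB" => coeff k n q 0 1
local notation "cC" => coeff k n q 1 0
local notation "cD" => coeff k n q 1 1

/-- The `n`-th powers of the coefficients have the comultiplication of coefficients: the two summands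
of `Δ` commute up to `q²`, a primitive `n`-th root of unity as `n` is odd. -/
theorem comul_coeff_pow {i j : Fin 2}
    (hq : (coeff k n q 1 j ⊗ₜ[k] coeff k n q i 1) * (coeff k n q 0 j ⊗ₜ[k] coeff k n q i 0) =
      q ^ 2 • ((coeff k n q 0 j ⊗ₜ[k] coeff k n q i 0) * (coeff k n q 1 j ⊗ₜ[k] coeff k n q i 1))) :
    comul (R := k) (coeff k n q i j ^ n) = (coeff k n q 0 j ^ n) ⊗ₜ (coeff k n q i 0 ^ n) +
      (coeff k n q 1 j ^ n) ⊗ₜ (coeff k n q i 1 ^ n) := by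
  rw [Bialgebra.comul_pow, comul_coeff, Fin.sum_univ_two,
    qcomm_add_pow_primitive (n_pos n q) (sq_primitive n q) hq, Algebra.TensorProduct.tmul_pow,
    Algebra.TensorProduct.tmul_pow]

theorem tmul_qcomm {B : Type*} [Ring B] [Algebra k B] {x y x' y' : B} (hx : y * x = q • (x * y))
    (hy : y' * x' = q • (x' * y')) :
    (y ⊗ₜ[k] y') * (x ⊗ₜ[k] x') = q ^ 2 • ((x ⊗ₜ[k] x') * (y ⊗ₜ[k] y')) := by
  simp only [Algebra.TensorProduct.tmul_mul_tmul, hx, hy, TensorProduct.tmul_smul,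
    TensorProduct.smul_tmul', smul_smul, pow_two]

theorem pow_apply_E {p : DualCop k (Uq k n q)} (hp : p (E k n q) = 0) (m : ℕ) :
    (p ^ m) (E k n q) = 0 := by
  induction m with
  | zero => simp
  | succ m ih => rw [pow_succ, mul_apply_E, ih, hp]; simp

theorem pow_apply_F {p : DualCop k (Uq k n q)} (hp : p (F k n q) = 0) (m : ℕ) :
    (p ^ m) (F k n q) = 0 := by
  induction m with
  | zero => simp
  | succ m ih => rw [pow_succ, mul_apply_F, ih, hp]; simp

theorem pow_apply_K (p : DualCop k (Uq k n q)) (m : ℕ) : (p ^ m) (K k n q) = p (K k n q) ^ m :=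
  pow_apply_groupLike (H := Uq k n q) comul_K counit_K p m

theorem pow_apply_Ki (p : DualCop k (Uq k n q)) (m : ℕ) : (p ^ m) (Ki k n q) = p (Ki k n q) ^ m :=
  pow_apply_groupLike (H := Uq k n q) comul_Ki counit_Ki p m

theorem coeffB_pow_apply_E {m : ℕ} (hm : 2 ≤ m) : (cB ^ m) (E k n q) = 0 := by
  obtain ⟨m, rfl⟩ : ∃ l, m = l + 1 := ⟨m - 1, by omega⟩
  rw [pow_succ, mul_apply_E, DualCop.pow_apply_one]
  simp [coeff_apply, show m ≠ 0 by omega]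

theorem coeffC_pow_apply_F {m : ℕ} (hm : 2 ≤ m) : (cC ^ m) (F k n q) = 0 := by
  obtain ⟨m, rfl⟩ : ∃ l, m = l + 1 := ⟨m - 1, by omega⟩
  rw [pow_succ, mul_apply_F, pow_apply_Ki]
  simp [coeff_apply, show m ≠ 0 by omega]

/-- The `n`-th powers of the coefficients form a representation, so they are known once they are known
on the generators, where they agree with the trivial representation. -/
theorem coeff_pow_apply (x : Uq k n q) (i j : Fin 2) :
    (coeff k n q i j ^ n) x = if i = j then counit (R := k) x else 0 := by
  have hn : n ≠ 0 := (n_pos n q).ne'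
  have h2 : 2 ≤ n := by have := h.three_le; omega
  induction x using induction generalizing i j with
  | h1 c =>
    rw [Algebra.algebraMap_eq_smul_one, map_smul, DualCop.pow_apply_one, coeff_apply, map_one,
      Matrix.one_apply]
    split_ifs <;> simp [hn]
  | hE =>
    have key : (coeff k n q i j ^ n) (E k n q) = 0 := by
      fin_cases i <;> fin_cases j
      · exact pow_apply_E (by simp [coeff_apply]) n
      · exact coeffB_pow_apply_E h2
      · exact pow_apply_E (by simp [coeff_apply]) n
      · exact pow_apply_E (by simp [coeff_apply]) n
    rw [key, counit_E, ite_self]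
  | hF =>
    have key : (coeff k n q i j ^ n) (F k n q) = 0 := by
      fin_cases i <;> fin_cases j
      · exact pow_apply_F (by simp [coeff_apply]) n
      · exact pow_apply_F (by simp [coeff_apply]) n
      · exact coeffC_pow_apply_F h2
      · exact pow_apply_F (by simp [coeff_apply]) n
    rw [key, counit_F, ite_self]
  | hK =>
    rw [pow_apply_K, coeff_apply, rho_K, counit_K]
    fin_cases i <;> fin_cases j <;> simp [hn, h.primitive.pow_eq_one]
  | hmul x y hx hy =>
    have hqc : (coeff k n q 1 j ⊗ₜ[k] coeff k n q i 1) * (coeff k n q 0 j ⊗ₜ[k] coeff k n q i 0) =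
        q ^ 2 • ((coeff k n q 0 j ⊗ₜ[k] coeff k n q i 0) *
          (coeff k n q 1 j ⊗ₜ[k] coeff k n q i 1)) := by
      fin_cases i <;> fin_cases j
      · exact tmul_qcomm coeff_ca coeff_ba
      · exact tmul_qcomm coeff_db coeff_ba
      · exact tmul_qcomm coeff_ca coeff_dc
      · exact tmul_qcomm coeff_db coeff_dc
    rw [apply_mul_of_comul (comul_coeff_pow hqc), hx, hx, hy, hy, Bialgebra.counit_mul]
    fin_cases i <;> fin_cases j <;> simp [mul_comm]
  | hadd x y hx hy => rw [map_add, hx, hy, map_add]; split_ifs <;> simp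

theorem coeff_pow_self (i : Fin 2) : coeff k n q i i ^ n = 1 := by
  ext x; simp [coeff_pow_apply]

theorem coeff_pow_of_ne {i j : Fin 2} (hij : i ≠ j) : coeff k n q i j ^ n = 0 := by
  ext x; simp [coeff_pow_apply, hij]

end Uq
end QDouble

/-! ### The monomials in `a, b, c` form a basis of the dual -/

namespace QDouble

section SpanPow

variable {k : Type*} [Field k] {B : Type*} [Ring B] [Algebra k B]

theorem exists_pow_eq_of_pow_eq {n : ℕ} (hn : 0 < n) {x : B} (hx : x ^ n = 0 ∨ x ^ n = 1) (i : ℕ) :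
    x ^ i = 0 ∨ ∃ j : Fin n, x ^ i = x ^ (j : ℕ) := by
  rcases hx with hx | hx
  · rcases Nat.lt_or_ge i n with hi | hi
    · exact Or.inr ⟨⟨i, hi⟩, rfl⟩
    · exact Or.inl (pow_eq_zero_of_le hi hx)
  · exact Or.inr ⟨⟨i % n, Nat.mod_lt _ hn⟩, by
      conv_lhs => rw [← Nat.mod_add_div i n, pow_add, pow_mul, hx, one_pow, mul_one]⟩

theorem qcomm_pow_left {ζ : k} {x y : B} (h : y * x = ζ • (x * y)) (j : ℕ) :
    y ^ j * x = ζ ^ j • (x * y ^ j) := by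
  induction j with
  | zero => simp
  | succ j ih =>
    rw [pow_succ', mul_assoc, ih, mul_smul_comm, ← mul_assoc, h, smul_mul_assoc, smul_smul,
      mul_assoc, ← pow_succ, ← pow_succ']

variable (k) in
/-- If the `n`-th powers of `x, y, z` lie in `{0, 1}`, then exponents below `n` suffice to span the
monomials `xⁱ yʲ zˡ`. -/
theorem span_range_pow_le {n : ℕ} (hn : 0 < n) {x y z : B} (hx : x ^ n = 0 ∨ x ^ n = 1)
    (hy : y ^ n = 0 ∨ y ^ n = 1) (hz : z ^ n = 0 ∨ z ^ n = 1) :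
    Submodule.span k (Set.range fun t : ℕ × ℕ × ℕ => x ^ t.1 * y ^ t.2.1 * z ^ t.2.2) ≤
      Submodule.span k
        (Set.range fun t : Fin n × Fin n × Fin n =>
          x ^ (t.1 : ℕ) * y ^ (t.2.1 : ℕ) * z ^ (t.2.2 : ℕ)) := by
  rw [Submodule.span_le]
  rintro _ ⟨⟨i, j, l⟩, rfl⟩
  dsimp only
  rcases exists_pow_eq_of_pow_eq hn hx i with h1 | ⟨i', h1⟩
  · simp [h1]
  rcases exists_pow_eq_of_pow_eq hn hy j with h2 | ⟨j', h2⟩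
  · simp [h2]
  rcases exists_pow_eq_of_pow_eq hn hz l with h3 | ⟨l', h3⟩
  · simp [h3]
  rw [h1, h2, h3]
  exact Submodule.subset_span ⟨(i', j', l'), rfl⟩

theorem finrank_span_fin_le {n : ℕ} {M : Type*} [AddCommGroup M] [Module k M]
    (v : Fin n × Fin n × Fin n → M) :
    Module.finrank k (Submodule.span k (Set.range v)) ≤ n ^ 3 := by
  refine (finrank_range_le_card v).trans_eq ?_
  simp; ring

/-- The quantum integer `[m] = (qᵐ - q⁻ᵐ) / (q - q⁻¹)`. -/
def qInt (q : k) (m : ℕ) : k := (q ^ m - (q ^ m)⁻¹) / (q - q⁻¹)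

@[simp] theorem qInt_zero (q : k) : qInt q 0 = 0 := by simp [qInt]

end SpanPow

namespace Uq

open DualCop

variable {k : Type*} [Field k] {n : ℕ} {q : k} [h : OddPrimitiveRoot n q]

local notation "cA" => coeff k n q 0 0
local notation "cB" => coeff k n q 0 1
local notation "cC" => coeff k n q 1 0

variable (k n q) in
theorem finrank_le : Module.finrank k (Uq k n q) ≤ n ^ 3 := by
  have h1 := span_range_pow_le k (n_pos n q) (Or.inl (E_pow k n q)) (Or.inl (F_pow k n q))
    (Or.inr (K_pow k n q))
  have h2 := (top_le_iff.1 ((mono_eq_top (k := k) (n := n) (q := q)).ge.trans h1))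
  rw [← finrank_top, ← h2]
  exact finrank_span_fin_le _

variable (n) in
theorem qInt_one (q : k) [OddPrimitiveRoot n q] : qInt q 1 = 1 := by
  rw [qInt, pow_one, div_self (q_sub_ne_zero n q)]

variable (n) in
theorem qInt_succ (q : k) [OddPrimitiveRoot n q] (m : ℕ) :
    qInt q (m + 1) = q * qInt q m + (q ^ m)⁻¹ := by
  have h1 := q_sub_ne_zero n q
  have hq := q_ne_zero n q
  rw [qInt, qInt, div_eq_iff h1, add_mul, mul_assoc, div_mul_cancel₀ _ h1]
  field_simp
  ring

theorem qInt_ne_zero {m : ℕ} (h0 : 0 < m) (hm : m < n) : qInt q m ≠ 0 := by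
  have hq := pow_ne_zero m (q_ne_zero n q)
  refine div_ne_zero (fun h1 => ?_) (q_sub_ne_zero n q)
  refine (sq_primitive n q).pow_ne_one_of_pos_of_lt h0.ne' hm ?_
  rw [← pow_mul, mul_comm, pow_mul, pow_two]
  nth_rw 1 [sub_eq_zero.1 h1]
  exact inv_mul_cancel₀ hq

theorem lact_E_coeffA : lact k _ (E k n q) cA = 0 := by simp [lact_coeff]
theorem lact_E_coeffB : lact k _ (E k n q) cB = cA := by simp [lact_coeff]
theorem lact_E_coeffC : lact k _ (E k n q) cC = 0 := by simp [lact_coeff]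
theorem lact_K_coeffB : lact k _ (K k n q) cB = q⁻¹ • cB := by simp [lact_coeff]
theorem lact_K_coeffC : lact k _ (K k n q) cC = q • cC := by simp [lact_coeff]

theorem ract_F_coeffA : ract k _ (F k n q) cA = 0 := by simp [ract_coeff, rho_antipodeInv_F]
theorem ract_F_coeffB : ract k _ (F k n q) cB = 0 := by simp [ract_coeff, rho_antipodeInv_F]
theorem ract_F_coeffC : ract k _ (F k n q) cC = -(q • cA) := by
  simp [ract_coeff, rho_antipodeInv_F]
theorem ract_Ki_coeffC : ract k _ (Ki k n q) cC = q⁻¹ • cC := by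
  simp [ract_coeff, rho_antipodeInv_Ki]

theorem lact_E_mul (p r : DualCop k (Uq k n q)) : lact k _ (E k n q) (p * r) =
    p * lact k _ (E k n q) r + lact k _ (E k n q) p * lact k _ (K k n q) r := by
  rw [lact_mul_pair (H := Uq k n q) comul_E, map_one, Module.End.one_apply]

theorem ract_F_mul (p r : DualCop k (Uq k n q)) : ract k _ (F k n q) (p * r) =
    ract k _ (F k n q) p * ract k _ (Ki k n q) r + p * ract k _ (F k n q) r := by
  rw [ract_mul_pair (H := Uq k n q) comul_F, map_one, Module.End.one_apply]

theorem lact_E_pow_eq_zero {p : DualCop k (Uq k n q)} (hp : lact k _ (E k n q) p = 0) (m : ℕ) :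
    lact k _ (E k n q) (p ^ m) = 0 := by
  induction m with
  | zero => simp
  | succ m ih => rw [pow_succ, lact_E_mul, ih, hp, mul_zero, zero_mul, add_zero]

theorem ract_F_pow_eq_zero {p : DualCop k (Uq k n q)} (hp : ract k _ (F k n q) p = 0) (m : ℕ) :
    ract k _ (F k n q) (p ^ m) = 0 := by
  induction m with
  | zero => simp
  | succ m ih => rw [pow_succ, ract_F_mul, ih, hp, mul_zero, zero_mul, add_zero]

theorem lact_K_pow (p : DualCop k (Uq k n q)) (m : ℕ) :
    lact k _ (K k n q) (p ^ m) = lact k _ (K k n q) p ^ m := by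
  induction m with
  | zero => simp
  | succ m ih => rw [pow_succ, lact_mul_groupLike (H := Uq k n q) comul_K, ih, pow_succ]

theorem ract_Ki_pow (p : DualCop k (Uq k n q)) (m : ℕ) :
    ract k _ (Ki k n q) (p ^ m) = ract k _ (Ki k n q) p ^ m := by
  induction m with
  | zero => simp [counit_Ki]
  | succ m ih => rw [pow_succ, ract_mul_groupLike (H := Uq k n q) comul_Ki, ih, pow_succ]

theorem lact_E_coeffB_pow (m : ℕ) :
    lact k _ (E k n q) (cB ^ (m + 1)) = qInt q (m + 1) • (cA * cB ^ m) := by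
  induction m with
  | zero => simp [lact_E_coeffB, qInt_one n q]
  | succ m ih =>
    rw [pow_succ', lact_E_mul, ih, lact_E_coeffB, lact_K_pow, lact_K_coeffB, smul_pow,
      qInt_succ n q (m + 1), mul_smul_comm, ← mul_assoc, coeff_ba, smul_mul_assoc, mul_assoc,
      ← pow_succ', mul_smul_comm, smul_smul, ← add_smul, inv_pow, mul_comm q]

theorem ract_F_coeffC_pow (m : ℕ) :
    ract k _ (F k n q) (cC ^ (m + 1)) = -(q * qInt q (m + 1)) • (cA * cC ^ m) := by
  induction m with
  | zero => simp [ract_F_coeffC, qInt_one n q]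
  | succ m ih =>
    rw [pow_succ', ract_F_mul, ih, ract_F_coeffC, ract_Ki_pow, ract_Ki_coeffC, smul_pow,
      qInt_succ n q (m + 1), mul_smul_comm, mul_smul_comm, ← mul_assoc, coeff_ca, smul_mul_assoc,
      mul_assoc, ← pow_succ', smul_smul, neg_mul, smul_mul_assoc, ← neg_smul, smul_smul,
      ← add_smul, inv_pow]
    congr 1
    ring

variable (k n q) in
/-- The monomial `aˢ bᵗ cʳ` in the matrix coefficients. -/
noncomputable def coeffMono (s t r : ℕ) : DualCop k (Uq k n q) := cA ^ s * cB ^ t * cC ^ r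

/-- Translation by `E` lowers the exponent of `b`; for `t = 0` the coefficient vanishes. -/
theorem lact_E_coeffMono (s t r : ℕ) : lact k _ (E k n q) (coeffMono k n q s t r) =
    (q ^ r * qInt q t) • coeffMono k n q (s + 1) (t - 1) r := by
  rw [coeffMono, lact_E_mul, lact_E_mul, lact_E_pow_eq_zero lact_E_coeffA,
    lact_E_pow_eq_zero lact_E_coeffC, mul_zero, zero_mul, zero_add, add_zero]
  cases t with
  | zero => simp
  | succ t =>
    rw [lact_E_coeffB_pow, lact_K_pow cC, lact_K_coeffC, smul_pow, mul_smul_comm, mul_smul_comm,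
      ← mul_assoc, ← pow_succ, smul_mul_assoc, smul_smul, coeffMono, Nat.add_sub_cancel]

/-- Translation by `F` lowers the exponent of `c`; for `r = 0` the coefficient vanishes. -/
theorem ract_F_coeffMono (s t r : ℕ) : ract k _ (F k n q) (coeffMono k n q s t r) =
    -(q ^ (t + 1) * qInt q r) • coeffMono k n q (s + 1) t (r - 1) := by
  rw [coeffMono, ract_F_mul, ract_F_mul, ract_F_pow_eq_zero ract_F_coeffA,
    ract_F_pow_eq_zero ract_F_coeffB, zero_mul, mul_zero, zero_add, zero_mul, zero_add]
  cases r with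
  | zero => simp
  | succ r =>
    rw [ract_F_coeffC_pow, mul_smul_comm, ← mul_assoc, mul_assoc _ _ cA, qcomm_pow_left coeff_ba,
      mul_smul_comm, smul_mul_assoc, smul_smul, ← mul_assoc, ← pow_succ, coeffMono,
      Nat.add_sub_cancel]
    congr 1
    ring

/-- The scalar is a product of quantum integers `[t] ⋯ [t - j + 1]` and powers of `q`. It vanishes
for `j > t`, where the truncated `t - j` is immaterial, and it does not depend on `s`. -/
theorem exists_lact_E_pow_coeffMono (j t r : ℕ) : ∃ κ : k, (j ≤ t → t < n → κ ≠ 0) ∧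
    (t < j → κ = 0) ∧ ∀ s, (lact k _ (E k n q) ^ j) (coeffMono k n q s t r) =
      κ • coeffMono k n q (s + j) (t - j) r := by
  induction j with
  | zero => exact ⟨1, by simp, by simp, by simp⟩
  | succ j ih =>
    obtain ⟨κ, h1, h2, h3⟩ := ih
    refine ⟨κ * (q ^ r * qInt q (t - j)), fun hj ht => mul_ne_zero (h1 (by omega) ht)
      (mul_ne_zero (pow_ne_zero r (q_ne_zero n q)) (qInt_ne_zero (n := n) (by omega) (by omega))),
      fun hj => ?_, fun s => ?_⟩
    · rw [Nat.sub_eq_zero_of_le (by omega), qInt_zero, mul_zero, mul_zero]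
    · rw [pow_succ', Module.End.mul_apply, h3, map_smul, lact_E_coeffMono, smul_smul]
      rfl

/-- The counterpart of `exists_lact_E_pow_coeffMono` for `F` and the exponent of `c`. -/
theorem exists_ract_F_pow_coeffMono (i t r : ℕ) : ∃ κ : k, (i ≤ r → r < n → κ ≠ 0) ∧
    (r < i → κ = 0) ∧ ∀ s, (ract k _ (F k n q) ^ i) (coeffMono k n q s t r) =
      κ • coeffMono k n q (s + i) t (r - i) := by
  induction i with
  | zero => exact ⟨1, by simp, by simp, by simp⟩
  | succ i ih =>
    obtain ⟨κ, h1, h2, h3⟩ := ih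
    refine ⟨κ * -(q ^ (t + 1) * qInt q (r - i)), fun hi hr => mul_ne_zero (h1 (by omega) hr)
      (neg_ne_zero.2 (mul_ne_zero (pow_ne_zero _ (q_ne_zero n q))
        (qInt_ne_zero (n := n) (by omega) (by omega)))), fun hi => ?_, fun s => ?_⟩
    · rw [Nat.sub_eq_zero_of_le (by omega), qInt_zero, mul_zero, neg_zero, mul_zero]
    · rw [pow_succ', Module.End.mul_apply, h3, map_smul, ract_F_coeffMono, smul_smul]
      rfl

theorem coeffMono_K_pow (s t r m : ℕ) :
    coeffMono k n q s t r (K k n q ^ m) = q ^ (m * s) * 0 ^ t * 0 ^ r := by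
  have hK : comul (R := k) (K k n q ^ m) = (K k n q ^ m) ⊗ₜ[k] (K k n q ^ m) := by
    rw [Bialgebra.comul_pow, comul_K, Algebra.TensorProduct.tmul_pow]
  have hε : counit (R := k) (K k n q ^ m) = 1 := by
    rw [Bialgebra.counit_pow, counit_K, one_pow]
  have hρ : rho k n q (K k n q ^ m) = !![q ^ m, 0; 0, q⁻¹ ^ m] := by
    have h1 : (!![q, 0; 0, q⁻¹] : Matrix (Fin 2) (Fin 2) k) = Matrix.diagonal ![q, q⁻¹] := by
      ext i j; fin_cases i <;> fin_cases j <;> rfl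
    rw [map_pow, rho_K, h1, Matrix.diagonal_pow]
    ext i j; fin_cases i <;> fin_cases j <;> simp
  simp only [coeffMono, mul_apply_groupLike (H := Uq k n q) hK,
    pow_apply_groupLike (H := Uq k n q) hK hε, coeff_apply, hρ]
  simp [pow_mul]

variable (k n q) in
/-- The functional on the dual that sends `p` to its value at `S⁻¹(F)ⁱ Kᵐ Eʲ`. -/
noncomputable def testFun (i j m : ℕ) : DualCop k (Uq k n q) →ₗ[k] k :=
  LinearMap.applyₗ (K k n q ^ m) ∘ₗ toLin.toLinearMap ∘ₗ (ract k _ (F k n q) ^ i) ∘ₗ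
    (lact k _ (E k n q) ^ j)

theorem testFun_apply (i j m : ℕ) (p : DualCop k (Uq k n q)) : testFun k n q i j m p =
    ((ract k _ (F k n q) ^ i) ((lact k _ (E k n q) ^ j) p)) (K k n q ^ m) := rfl

/-- The pairing of the monomials `aˢ bᵗ cʳ` with the elements `S⁻¹(F)ⁱ Kᵐ Eʲ` is diagonal in
`(t, r)` and `(j, i)`, up to a Vandermonde matrix in the remaining indices. -/
theorem exists_testFun_coeffMono (i j t r : ℕ) : ∃ κ : k, (t < n → r < n → t = j → r = i → κ ≠ 0) ∧
    (¬(t = j ∧ r = i) → κ = 0) ∧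
    ∀ s m, testFun k n q i j m (coeffMono k n q s t r) = κ * (q ^ (s + j + i)) ^ m := by
  obtain ⟨κ, h1, h2, h3⟩ := exists_lact_E_pow_coeffMono (k := k) (n := n) (q := q) j t r
  obtain ⟨κ', h1', h2', h3'⟩ := exists_ract_F_pow_coeffMono (k := k) (n := n) (q := q) i (t - j) r
  -- `b` and `c` vanish at `Kᵐ`, so what is left of them contributes powers of `0`.
  refine ⟨κ * κ' * 0 ^ (t - j) * 0 ^ (r - i), ?_, fun hne => ?_, fun s m => ?_⟩
  · rintro ht hr rfl rfl
    simpa using ⟨h1 le_rfl ht, h1' le_rfl hr⟩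
  · rcases lt_or_ge t j with htj | htj
    · simp [h2 htj]
    rcases lt_or_ge r i with hri | hri
    · simp [h2' hri]
    rcases eq_or_ne t j with rfl | htj'
    · have : r - i ≠ 0 := by omega
      simp [this]
    · have : t - j ≠ 0 := by omega
      simp [this]
  · rw [testFun_apply, h3, map_smul, h3', map_smul, map_smul, LinearMap.smul_apply,
      LinearMap.smul_apply, coeffMono_K_pow, ← pow_mul, mul_comm m, smul_eq_mul, smul_eq_mul]
    ring

variable (k n q) in
theorem linearIndependent_coeffMono : LinearIndependent k
    fun t : Fin n × Fin n × Fin n => coeffMono k n q t.1 t.2.1 t.2.2 := by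
  rw [Fintype.linearIndependent_iff]
  rintro g hg ⟨s₀, t₀, r₀⟩
  choose κ h1 h2 h3 using fun t r => exists_testFun_coeffMono (k := k) (n := n) (q := q)
    (r₀ : ℕ) (t₀ : ℕ) t r
  have hinj : Function.Injective fun s : Fin n => q ^ ((s : ℕ) + t₀ + r₀) := by
    intro s s' hs
    have hq := q_ne_zero n q
    simp only [pow_add] at hs
    exact Fin.ext (h.primitive.pow_inj s.2 s'.2
      (mul_right_cancel₀ (pow_ne_zero _ hq) (mul_right_cancel₀ (pow_ne_zero _ hq) hs)))
  have key : (fun s : Fin n => g (s, t₀, r₀) * κ t₀ r₀) = 0 := by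
    refine Matrix.eq_zero_of_forall_pow_sum_mul_pow_eq_zero hinj fun m => ?_
    have h4 := congrArg (testFun k n q r₀ t₀ m) hg
    rw [map_sum, map_zero, Fintype.sum_prod_type] at h4
    rw [← h4]
    refine Finset.sum_congr rfl fun s _ => ?_
    rw [Fintype.sum_eq_single (t₀, r₀)]
    · rw [map_smul, h3, smul_eq_mul, mul_assoc]
    · rintro ⟨t, r⟩ hne
      rw [map_smul, h3, h2 t r (fun hh => hne (Prod.ext (Fin.ext hh.1) (Fin.ext hh.2))), zero_mul,
        smul_zero]
  exact (mul_eq_zero.1 (congrFun key s₀)).resolve_right (h1 _ _ t₀.2 r₀.2 rfl rfl)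

variable (k n q) in
theorem finrank_dualCop : Module.finrank k (DualCop k (Uq k n q)) = Module.finrank k (Uq k n q) :=
  (LinearEquiv.finrank_eq toLin).trans (Subspace.dual_finrank_eq (K := k) (V := Uq k n q))

instance : FiniteDimensional k (DualCop k (Uq k n q)) :=
  Module.Finite.equiv (toLin (k := k) (H := Uq k n q)).symm

variable (k n q) in
/-- The `n³` monomials `Eⁱ Fʲ Kˡ` span, and there are `n³` linearly independent functionals. -/
theorem finrank_eq : Module.finrank k (Uq k n q) = n ^ 3 := by
  refine (finrank_le k n q).antisymm ?_
  have := (linearIndependent_coeffMono k n q).fintype_card_le_finrank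
  rw [finrank_dualCop] at this
  refine le_trans (le_of_eq ?_) this
  simp; ring

variable (k n q) in
/-- The coefficients `a`, `b`, `c` generate the dual of `u_q(sl_2)`. -/
theorem span_coeffMono : Submodule.span k
    (Set.range fun t : Fin n × Fin n × Fin n => coeffMono k n q t.1 t.2.1 t.2.2) = ⊤ := by
  refine (linearIndependent_coeffMono k n q).span_eq_top_of_card_eq_finrank' ?_
  rw [finrank_dualCop, finrank_eq]
  simp; ring

end Uq
end QDouble

/-! ### The generators of the Drinfel'd double -/

namespace QDouble

namespace DrinfeldDouble

open DualCop

variable {k : Type*} [Field k] {H : Type*} [Ring H] [HopfAlgebra k H] [BijectiveAntipode k H]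
  [FiniteDimensional k H]

theorem one_eq_mk : (1 : DrinfeldDouble k H) = mk 1 1 := rfl

variable (k H) in
/-- The inclusion `p ↦ p ⋈ 1` of the dual. -/
noncomputable def inclDual : DualCop k H →ₐ[k] DrinfeldDouble k H :=
  AlgHom.ofLinearMap (mk.flip 1) rfl fun p r => (mk_one_mul_mk p r 1).symm

variable (k H) in
/-- The inclusion `x ↦ 1 ⋈ x` of `H`. -/
noncomputable def incl : H →ₐ[k] DrinfeldDouble k H :=
  AlgHom.ofLinearMap (mk 1) rfl fun x y => (mk_mul_one_mk 1 x y).symm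

theorem inclDual_apply (p : DualCop k H) : inclDual k H p = mk p 1 := rfl
theorem incl_apply (x : H) : incl k H x = mk 1 x := rfl

theorem mk_eq_mul (p : DualCop k H) (x : H) : mk p x = inclDual k H p * incl k H x := by
  rw [inclDual_apply, incl_apply, mk_mul_one_mk, one_mul]

theorem comul_inclDual (p : DualCop k H) : comul (R := k) (inclDual k H p) =
    TensorProduct.map (inclDual k H).toLinearMap (inclDual k H).toLinearMap (comul (R := k) p) := by
  have h1 : comul (R := k) (1 : H) = 1 ⊗ₜ 1 := Bialgebra.comul_one
  let r : Repr k (1 : H) Unit := ⟨{()}, fun _ => 1, fun _ => 1, by simp [h1]⟩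
  rw [inclDual_apply, ← (reprMk (ℛ k p) r).eq]
  conv_rhs => rw [← (ℛ k p).eq]
  simp only [reprMk, r, Finset.sum_product, Finset.sum_singleton, map_sum, TensorProduct.map_tmul]
  rfl

theorem comul_incl (x : H) : comul (R := k) (incl k H x) =
    TensorProduct.map (incl k H).toLinearMap (incl k H).toLinearMap (comul (R := k) x) := by
  have h1 : comul (R := k) (1 : DualCop k H) = 1 ⊗ₜ 1 := Bialgebra.comul_one
  let r : Repr k (1 : DualCop k H) Unit := ⟨{()}, fun _ => 1, fun _ => 1, by simp [h1]⟩
  rw [incl_apply, ← (reprMk r (ℛ k x)).eq]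
  conv_rhs => rw [← (ℛ k x).eq]
  simp only [reprMk, r, Finset.sum_product, Finset.sum_singleton, map_sum, TensorProduct.map_tmul]
  rfl

theorem counit_inclDual (p : DualCop k H) : counit (R := k) (inclDual k H p) = p 1 := by
  rw [inclDual_apply, counit_mk, Bialgebra.counit_one, one_mul]

theorem counit_incl (x : H) : counit (R := k) (incl k H x) = counit (R := k) x := by
  rw [incl_apply, counit_mk, one_apply, Bialgebra.counit_one, mul_one]

theorem antipode_inclDual (p : DualCop k H) :
    antipode k (inclDual k H p) = inclDual k H (antipode k p) := by
  refine (antipodeD_mk p 1).trans ?_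
  rw [antipode_one, ← one_eq_mk, one_mul, inclDual_apply]

theorem antipode_incl (x : H) : antipode k (incl k H x) = incl k H (antipode k x) := by
  refine (antipodeD_mk 1 x).trans ?_
  rw [antipode_one, ← one_eq_mk, mul_one, incl_apply]

end DrinfeldDouble

namespace Uq

open DualCop DrinfeldDouble

variable {k : Type*} [Field k] {n : ℕ} {q : k} [h : OddPrimitiveRoot n q]

local notation "cA" => coeff k n q 0 0
local notation "cB" => coeff k n q 0 1
local notation "cC" => coeff k n q 1 0
local notation "cD" => coeff k n q 1 1
local notation "iO" => inclDual k (Uq k n q)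
local notation "iU" => incl k (Uq k n q)

/-- A group-like element, as a two-term comultiplication. -/
theorem groupLike_pair {H : Type*} [Ring H] [HopfAlgebra k H] {x : H}
    (hx : comul (R := k) x = x ⊗ₜ x) : comul (R := k) x = x ⊗ₜ x + 0 ⊗ₜ 0 := by simpa using hx

/-- The product formula for `Δ²(E) = 1 ⊗ 1 ⊗ E + 1 ⊗ E ⊗ K + E ⊗ K ⊗ K`. -/
theorem incl_E_mul_inclDual (p : DualCop k (Uq k n q)) : iU (E k n q) * iO p =
    iO (ract k _ (E k n q) p) + iO (ract k _ (K k n q) p) * iU (E k n q) +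
      iO (lact k _ (E k n q) (ract k _ (K k n q) p)) * iU (K k n q) := by
  let r : Repr k (E k n q) Bool := reprPair (H := Uq k n q) comul_E
  let r' : ∀ i, Repr k (r.right i) Bool := fun i => match i with
    | true => reprPair (H := Uq k n q) comul_E
    | false => reprPair (H := Uq k n q) (groupLike_pair comul_K)
  rw [incl_apply, inclDual_apply, mk_mul_mk _ _ _ _ r r', ← incl_apply, ← mk_eq_mul]
  simp [r, r', reprPair, mk_eq_mul]

/-- The product formula for `Δ²(F) = K⁻¹ ⊗ K⁻¹ ⊗ F + K⁻¹ ⊗ F ⊗ 1 + F ⊗ 1 ⊗ 1`. -/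
theorem incl_F_mul_inclDual (p : DualCop k (Uq k n q)) : iU (F k n q) * iO p =
    iO (lact k _ (Ki k n q) (ract k _ (F k n q) p)) * iU (Ki k n q) +
      iO (lact k _ (Ki k n q) p) * iU (F k n q) + iO (lact k _ (F k n q) p) := by
  let r : Repr k (F k n q) Bool := reprPair (H := Uq k n q) comul_F
  let r' : ∀ i, Repr k (r.right i) Bool := fun i => match i with
    | true => reprPair (H := Uq k n q) comul_F
    | false => reprPair (H := Uq k n q) (x := 1)
        (groupLike_pair (by simp [Algebra.TensorProduct.one_def]))
  rw [incl_apply, inclDual_apply, mk_mul_mk _ _ _ _ r r', ← incl_apply, ← mk_eq_mul]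
  simp [r, r', reprPair, mk_eq_mul]

theorem incl_K_mul_inclDual (p : DualCop k (Uq k n q)) : iU (K k n q) * iO p =
    iO (lact k _ (K k n q) (ract k _ (K k n q) p)) * iU (K k n q) := by
  let r : Repr k (K k n q) Bool := reprPair (H := Uq k n q) (groupLike_pair comul_K)
  let r' : ∀ i, Repr k (r.right i) Bool := fun i => match i with
    | true => reprPair (H := Uq k n q) (groupLike_pair comul_K)
    | false => reprPair (H := Uq k n q) (x := 0) (s := 0) (t := 0) (u := 0) (v := 0) (by simp)
  rw [incl_apply, inclDual_apply, mk_mul_mk _ _ _ _ r r', ← incl_apply, ← mk_eq_mul]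
  simp [r, r', reprPair, mk_eq_mul]

/-- `ρ(S⁻¹(x))` is the adjugate of `ρ(x)`, with off-diagonal entries rescaled by `q^{∓1}`. -/
theorem rho_antipodeInv (x : Uq k n q) : rho k n q (antipodeInv k _ x) =
    !![rho k n q x 1 1, -(q⁻¹ * rho k n q x 0 1); -(q * rho k n q x 1 0), rho k n q x 0 0] := by
  have hq := q_ne_zero n q
  induction x using induction with
  | h1 c =>
    rw [Algebra.algebraMap_eq_smul_one, map_smul, map_smul, antipodeInv_one, map_smul, map_one]
    ext i j; fin_cases i <;> fin_cases j <;> simp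
  | hE =>
    rw [rho_antipodeInv_E, rho_E]
    ext i j; fin_cases i <;> fin_cases j <;> simp
  | hF =>
    rw [rho_antipodeInv_F, rho_F]
    ext i j; fin_cases i <;> fin_cases j <;> simp
  | hK =>
    rw [rho_antipodeInv_K, rho_K]
    ext i j; fin_cases i <;> fin_cases j <;> simp
  | hmul x y hx hy =>
    rw [antipodeInv_mul, map_mul, map_mul, hx, hy]
    ext i j
    fin_cases i <;> fin_cases j <;> simp [Matrix.mul_apply, Fin.sum_univ_two] <;> field_simp <;>
      ring
  | hadd x y hx hy =>
    rw [map_add, map_add, hx, hy, map_add]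
    ext i j
    fin_cases i <;> fin_cases j <;> simp <;> ring

theorem antipode_coeffA : antipode k cA = cD := by
  ext x; simp [antipode_apply, coeff_apply, rho_antipodeInv]

theorem antipode_coeffB : antipode k cB = -(q⁻¹ • cB) := by
  ext x; simp [antipode_apply, coeff_apply, rho_antipodeInv]

theorem antipode_coeffC : antipode k cC = -(q • cC) := by
  ext x; simp [antipode_apply, coeff_apply, rho_antipodeInv]

theorem antipode_coeffD : antipode k cD = cA := by
  ext x; simp [antipode_apply, coeff_apply, rho_antipodeInv]

end Uq

namespace DUq

open DualCop DrinfeldDouble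

variable {k : Type*} [Field k] {n : ℕ} {q : k} [h : OddPrimitiveRoot n q]

variable (k n q) in
theorem a_eq : DUq.a k n q = inclDual k _ (Uq.coeff k n q 0 0) := rfl
variable (k n q) in
theorem b_eq : DUq.b k n q = inclDual k _ (Uq.coeff k n q 0 1) := rfl
variable (k n q) in
theorem c_eq : DUq.c k n q = inclDual k _ (Uq.coeff k n q 1 0) := rfl
variable (k n q) in
theorem d_eq : DUq.d k n q = inclDual k _ (Uq.coeff k n q 1 1) := rfl
variable (k n q) in
theorem E_eq : DUq.E k n q = incl k _ (Uq.E k n q) := rfl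
variable (k n q) in
theorem F_eq : DUq.F k n q = incl k _ (Uq.F k n q) := rfl
variable (k n q) in
theorem K_eq : DUq.K k n q = incl k _ (Uq.K k n q) := rfl
variable (k n q) in
theorem Ki_eq : DUq.Ki k n q = incl k _ (Uq.Ki k n q) := by
  rw [DUq.Ki, K_eq, Uq.Ki, map_pow]

variable (k n q) in
/-- The generators of the double, indexed by the generators of the presentation. -/
noncomputable def gen : DGen → DUq k n q
  | .a => DUq.a k n q
  | .b => DUq.b k n q
  | .c => DUq.c k n q
  | .d => DUq.d k n q
  | .E => DUq.E k n q
  | .F => DUq.F k n q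
  | .K => DUq.K k n q

/-- The generators of the double satisfy the defining relations. -/
theorem lift_gen_rel {x y : FreeAlgebra k DGen} (hxy : DRel k n q x y) :
    FreeAlgebra.lift k (gen k n q) x = FreeAlgebra.lift k (gen k n q) y := by
  have hK : DUq.K k n q ^ (n - 1) = incl k _ (Uq.Ki k n q) := Ki_eq k n q
  have hq := Uq.q_ne_zero n q
  cases hxy <;>
    simp only [map_mul, map_pow, map_one, map_zero, map_add, map_sub, map_smul,
      FreeAlgebra.lift_ι_apply, gen, hK] <;>
    simp only [a_eq, b_eq, c_eq, d_eq, E_eq, F_eq, K_eq]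
  case a_pow => rw [← map_pow, Uq.coeff_pow_self, map_one]
  case d_pow => rw [← map_pow, Uq.coeff_pow_self, map_one]
  case b_pow => rw [← map_pow, Uq.coeff_pow_of_ne (by decide), map_zero]
  case c_pow => rw [← map_pow, Uq.coeff_pow_of_ne (by decide), map_zero]
  case K_pow => rw [← map_pow, Uq.K_pow, map_one]
  case E_pow => rw [← map_pow, Uq.E_pow, map_zero]
  case F_pow => rw [← map_pow, Uq.F_pow, map_zero]
  case ba => rw [← map_mul, Uq.coeff_ba, map_smul, map_mul]
  case db => rw [← map_mul, Uq.coeff_db, map_smul, map_mul]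
  case ca => rw [← map_mul, Uq.coeff_ca, map_smul, map_mul]
  case dc => rw [← map_mul, Uq.coeff_dc, map_smul, map_mul]
  case bc => rw [← map_mul, Uq.coeff_bc, map_mul]
  case ad => rw [← map_mul, Uq.coeff_ad, map_add, map_smul, map_mul, map_one]
  case KE => rw [← map_mul, Uq.K_E, map_smul, map_mul]
  case KF => rw [← map_mul, Uq.K_F, map_smul, map_mul]
  case EF => rw [← map_mul, ← map_mul, ← map_sub, Uq.E_F, map_smul, map_sub]
  case' Ka | Kb | Kc | Kd => rw [Uq.incl_K_mul_inclDual]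
  case' Ea | Eb | Ec | Ed => rw [Uq.incl_E_mul_inclDual]
  case' Fa | Fb | Fc | Fd => rw [Uq.incl_F_mul_inclDual]
  all_goals
    simp [Uq.lact_coeff, Uq.ract_coeff, Uq.rho_antipodeInv_K, Uq.rho_antipodeInv_E,
      Uq.rho_antipodeInv_F, smul_smul, hq, pow_two]
  all_goals abel

end DUq
end QDouble

/-! ### The presented algebra and its dimension -/

namespace QDouble

namespace PresentedDouble

variable {k : Type*} [Field k] {n : ℕ} {q : k}

local notation "ga" => gen k n q DGen.a
local notation "gb" => gen k n q DGen.b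
local notation "gc" => gen k n q DGen.c
local notation "gd" => gen k n q DGen.d
local notation "gE" => gen k n q DGen.E
local notation "gF" => gen k n q DGen.F
local notation "gK" => gen k n q DGen.K

theorem mk_rel {x y : FreeAlgebra k DGen} (hxy : DRel k n q x y) :
    RingQuot.mkAlgHom k (DRel k n q) x = RingQuot.mkAlgHom k (DRel k n q) y :=
  RingQuot.mkAlgHom_rel k hxy

theorem a_pow : ga ^ n = 1 := by simpa [gen] using mk_rel (DRel.a_pow (k := k) (n := n) (q := q))
theorem b_pow : gb ^ n = 0 := by simpa [gen] using mk_rel (DRel.b_pow (k := k) (n := n) (q := q))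
theorem c_pow : gc ^ n = 0 := by simpa [gen] using mk_rel (DRel.c_pow (k := k) (n := n) (q := q))
theorem E_pow : gE ^ n = 0 := by simpa [gen] using mk_rel (DRel.E_pow (k := k) (n := n) (q := q))
theorem F_pow : gF ^ n = 0 := by simpa [gen] using mk_rel (DRel.F_pow (k := k) (n := n) (q := q))
theorem K_pow : gK ^ n = 1 := by simpa [gen] using mk_rel (DRel.K_pow (k := k) (n := n) (q := q))
theorem b_a : gb * ga = q • (ga * gb) := by
  simpa [gen] using mk_rel (DRel.ba (k := k) (n := n) (q := q))
theorem c_a : gc * ga = q • (ga * gc) := by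
  simpa [gen] using mk_rel (DRel.ca (k := k) (n := n) (q := q))
theorem b_c : gb * gc = gc * gb := by
  simpa [gen] using mk_rel (DRel.bc (k := k) (n := n) (q := q))
theorem a_d : ga * gd = q⁻¹ • (gb * gc) + 1 := by
  simpa [gen] using mk_rel (DRel.ad (k := k) (n := n) (q := q))
theorem K_E : gK * gE = q ^ 2 • (gE * gK) := by
  simpa only [gen, map_mul, map_smul] using mk_rel (DRel.KE (k := k) (n := n) (q := q))
theorem K_F : gK * gF = (q ^ 2)⁻¹ • (gF * gK) := by
  simpa only [gen, map_mul, map_smul] using mk_rel (DRel.KF (k := k) (n := n) (q := q))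
theorem E_F : gE * gF - gF * gE = (q - q⁻¹)⁻¹ • (gK - gK ^ (n - 1)) := by
  simpa only [gen, map_mul, map_smul, map_sub, map_pow] using
    mk_rel (DRel.EF (k := k) (n := n) (q := q))
theorem K_a : gK * ga = ga * gK := by
  simpa [gen] using mk_rel (DRel.Ka (k := k) (n := n) (q := q))
theorem K_b : gK * gb = (q ^ 2)⁻¹ • (gb * gK) := by
  simpa only [gen, map_mul, map_smul] using mk_rel (DRel.Kb (k := k) (n := n) (q := q))
theorem K_c : gK * gc = q ^ 2 • (gc * gK) := by
  simpa only [gen, map_mul, map_smul] using mk_rel (DRel.Kc (k := k) (n := n) (q := q))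
theorem E_a : gE * ga = q⁻¹ • (ga * gE) - q⁻¹ • gc := by
  simpa only [gen, map_mul, map_smul, map_sub] using mk_rel (DRel.Ea (k := k) (n := n) (q := q))
theorem E_b : gE * gb = q⁻¹ • (gb * gE) + q⁻¹ • (ga * gK) - q⁻¹ • gd := by
  simpa only [gen, map_mul, map_smul, map_sub, map_add] using
    mk_rel (DRel.Eb (k := k) (n := n) (q := q))
theorem E_c : gE * gc = q • (gc * gE) := by
  simpa only [gen, map_mul, map_smul] using mk_rel (DRel.Ec (k := k) (n := n) (q := q))
theorem F_a : gF * ga = q⁻¹ • (ga * gF) + gb := by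
  simpa only [gen, map_mul, map_smul, map_add] using mk_rel (DRel.Fa (k := k) (n := n) (q := q))
theorem F_b : gF * gb = q • (gb * gF) := by
  simpa only [gen, map_mul, map_smul] using mk_rel (DRel.Fb (k := k) (n := n) (q := q))
theorem F_c : gF * gc = q⁻¹ • (gc * gF) - ga * gK ^ (n - 1) + gd := by
  simpa only [gen, map_mul, map_smul, map_add, map_sub, map_pow] using
    mk_rel (DRel.Fc (k := k) (n := n) (q := q))

theorem d_eq [OddPrimitiveRoot n q] : gd = ga ^ (n - 1) * (q⁻¹ • (gb * gc) + 1) := by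
  rw [← a_d, ← mul_assoc, Uq.pow_pred_mul q a_pow, one_mul]

variable (k n q) in
/-- The algebra map from `u_q(sl_2)` to the presented algebra. -/
noncomputable def inclUq : Uq k n q →ₐ[k] PresentedDouble k n q :=
  Uq.lift gE gF gK K_pow E_pow F_pow K_E K_F E_F

@[simp] theorem inclUq_E : inclUq k n q (Uq.E k n q) = gE := Uq.lift_E ..
@[simp] theorem inclUq_F : inclUq k n q (Uq.F k n q) = gF := Uq.lift_F ..
@[simp] theorem inclUq_K : inclUq k n q (Uq.K k n q) = gK := Uq.lift_K ..

variable (k n q) in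
/-- The span of the monomials `aⁱ bʲ cˡ`. -/
noncomputable def dualPart : Submodule k (PresentedDouble k n q) :=
  Submodule.span k (Set.range fun t : ℕ × ℕ × ℕ => ga ^ t.1 * gb ^ t.2.1 * gc ^ t.2.2)

variable (k n q) in
/-- The span of the products `aⁱ bʲ cˡ u` with `u` in the image of `u_q(sl_2)`. -/
noncomputable def triangular : Submodule k (PresentedDouble k n q) :=
  dualPart k n q * LinearMap.range (inclUq k n q).toLinearMap

/-- A submodule that contains the image of `u_q(sl_2)` and is stable under left multiplication by
`a`, `b` and `c` contains all products `aⁱ bʲ cˡ u`. -/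
theorem triangular_le {N : Submodule k (PresentedDouble k n q)} (hu : ∀ u, inclUq k n q u ∈ N)
    (ha : ∀ x ∈ N, ga * x ∈ N) (hb : ∀ x ∈ N, gb * x ∈ N) (hc : ∀ x ∈ N, gc * x ∈ N) :
    triangular k n q ≤ N := by
  have hpow : ∀ {g : PresentedDouble k n q} (_ : ∀ x ∈ N, g * x ∈ N) (i : ℕ), ∀ x ∈ N,
      g ^ i * x ∈ N := by
    intro g hg i
    induction i with
    | zero => simp
    | succ i ih => intro x hx; rw [pow_succ', mul_assoc]; exact hg _ (ih x hx)
  rw [triangular, Submodule.mul_le]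
  rintro x hx _ ⟨u, rfl⟩
  induction hx using Submodule.span_induction with
  | mem x hx =>
    obtain ⟨t, rfl⟩ := hx
    rw [mul_assoc, mul_assoc]
    exact hpow ha _ _ (hpow hb _ _ (hpow hc _ _ (hu u)))
  | zero => simp
  | add x y _ _ hx hy => rw [add_mul]; exact add_mem hx hy
  | smul r x _ hx => rw [smul_mul_assoc]; exact Submodule.smul_mem _ _ hx

theorem mono_mem (i j l : ℕ) : ga ^ i * gb ^ j * gc ^ l ∈ dualPart k n q :=
  Submodule.subset_span ⟨(i, j, l), rfl⟩

theorem one_mem_dualPart : (1 : PresentedDouble k n q) ∈ dualPart k n q := by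
  simpa using mono_mem (k := k) (n := n) (q := q) 0 0 0

theorem mul_mem_dualPart {g : PresentedDouble k n q}
    (hg : ∀ i j l, g * (ga ^ i * gb ^ j * gc ^ l) ∈ dualPart k n q) {x : PresentedDouble k n q}
    (hx : x ∈ dualPart k n q) : g * x ∈ dualPart k n q := by
  induction hx using Submodule.span_induction with
  | mem x hx => obtain ⟨t, rfl⟩ := hx; exact hg _ _ _
  | zero => simp
  | add x y _ _ hx hy => rw [mul_add]; exact add_mem hx hy
  | smul r x _ hx => rw [mul_smul_comm]; exact Submodule.smul_mem _ _ hx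

theorem a_mul_mem_dualPart {x : PresentedDouble k n q} (hx : x ∈ dualPart k n q) :
    ga * x ∈ dualPart k n q :=
  mul_mem_dualPart (fun i j l => by
    rw [← mul_assoc, ← mul_assoc, ← pow_succ']; exact mono_mem _ _ _) hx

theorem b_mul_mem_dualPart {x : PresentedDouble k n q} (hx : x ∈ dualPart k n q) :
    gb * x ∈ dualPart k n q :=
  mul_mem_dualPart (fun i j l => by
    rw [← mul_assoc, ← mul_assoc, qcomm_pow (b_a (n := n)) i, smul_mul_assoc, smul_mul_assoc,
      mul_assoc _ gb,
      ← pow_succ']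
    exact Submodule.smul_mem _ _ (mono_mem _ _ _)) hx

theorem c_mul_mem_dualPart {x : PresentedDouble k n q} (hx : x ∈ dualPart k n q) :
    gc * x ∈ dualPart k n q :=
  mul_mem_dualPart (fun i j l => by
    have hbc : gc * gb ^ j = gb ^ j * gc := (Commute.pow_right (b_c (k := k)).symm j)
    rw [← mul_assoc, ← mul_assoc, qcomm_pow (c_a (n := n)) i, smul_mul_assoc, smul_mul_assoc,
      mul_assoc _ gc,
      hbc, ← mul_assoc, mul_assoc _ gc, ← pow_succ']
    exact Submodule.smul_mem _ _ (mono_mem _ _ _)) hx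

theorem mul_mem_triangular {g : PresentedDouble k n q}
    (hg : ∀ x ∈ dualPart k n q, g * x ∈ dualPart k n q) {x : PresentedDouble k n q}
    (hx : x ∈ triangular k n q) : g * x ∈ triangular k n q := by
  rw [triangular] at hx
  induction hx using Submodule.mul_induction_on' with
  | mem_mul_mem y hy u hu => rw [← mul_assoc]; exact Submodule.mul_mem_mul (hg y hy) hu
  | add x _ y _ hx hy => rw [mul_add]; exact add_mem hx hy

theorem inclUq_mem (u : Uq k n q) : inclUq k n q u ∈ triangular k n q := by
  rw [← one_mul (inclUq k n q u)]
  exact Submodule.mul_mem_mul one_mem_dualPart ⟨u, rfl⟩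

theorem a_mul_mem {x : PresentedDouble k n q} (hx : x ∈ triangular k n q) :
    ga * x ∈ triangular k n q :=
  mul_mem_triangular (fun _ => a_mul_mem_dualPart) hx

theorem b_mul_mem {x : PresentedDouble k n q} (hx : x ∈ triangular k n q) :
    gb * x ∈ triangular k n q :=
  mul_mem_triangular (fun _ => b_mul_mem_dualPart) hx

theorem c_mul_mem {x : PresentedDouble k n q} (hx : x ∈ triangular k n q) :
    gc * x ∈ triangular k n q :=
  mul_mem_triangular (fun _ => c_mul_mem_dualPart) hx

theorem pow_mul_mem {g : PresentedDouble k n q}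
    (hg : ∀ x ∈ triangular k n q, g * x ∈ triangular k n q) (i : ℕ) :
    ∀ x ∈ triangular k n q, g ^ i * x ∈ triangular k n q := by
  induction i with
  | zero => simp
  | succ i ih => intro x hx; rw [pow_succ', mul_assoc]; exact hg _ (ih x hx)

theorem d_mul_mem [OddPrimitiveRoot n q] {x : PresentedDouble k n q}
    (hx : x ∈ triangular k n q) : gd * x ∈ triangular k n q := by
  rw [d_eq, mul_assoc, add_mul, smul_mul_assoc, one_mul, mul_assoc]
  exact pow_mul_mem (fun _ => a_mul_mem) _ _
    (add_mem (Submodule.smul_mem _ _ (b_mul_mem (c_mul_mem hx))) hx)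

/-- If left multiplication by `g` maps the image of `u_q(sl_2)` into `triangular`, and `g` moves past
`a`, `b` and `c`, then `triangular` is stable under left multiplication by `g`. -/
theorem mul_mem_of_commutation {g : PresentedDouble k n q}
    (hu : ∀ u, g * inclUq k n q u ∈ triangular k n q)
    (ha : ∀ x ∈ triangular k n q, g * x ∈ triangular k n q → g * (ga * x) ∈ triangular k n q)
    (hb : ∀ x ∈ triangular k n q, g * x ∈ triangular k n q → g * (gb * x) ∈ triangular k n q)
    (hc : ∀ x ∈ triangular k n q, g * x ∈ triangular k n q → g * (gc * x) ∈ triangular k n q)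
    {x : PresentedDouble k n q} (hx : x ∈ triangular k n q) : g * x ∈ triangular k n q :=
  (triangular_le (N := triangular k n q ⊓ (triangular k n q).comap (LinearMap.mulLeft k g))
    (fun u => ⟨inclUq_mem u, hu u⟩) (fun y hy => ⟨a_mul_mem hy.1, ha y hy.1 hy.2⟩)
    (fun y hy => ⟨b_mul_mem hy.1, hb y hy.1 hy.2⟩)
    (fun y hy => ⟨c_mul_mem hy.1, hc y hy.1 hy.2⟩) hx).2

theorem K_mul_mem {x : PresentedDouble k n q} (hx : x ∈ triangular k n q) :
    gK * x ∈ triangular k n q := by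
  refine mul_mem_of_commutation (fun u => ?_) (fun x _ hK => ?_) (fun x _ hK => ?_)
    (fun x _ hK => ?_) hx
  · rw [← inclUq_K, ← map_mul]; exact inclUq_mem _
  · rw [← mul_assoc, K_a, mul_assoc]; exact a_mul_mem hK
  · rw [← mul_assoc, K_b, smul_mul_assoc, mul_assoc]; exact Submodule.smul_mem _ _ (b_mul_mem hK)
  · rw [← mul_assoc, K_c, smul_mul_assoc, mul_assoc]; exact Submodule.smul_mem _ _ (c_mul_mem hK)

variable [OddPrimitiveRoot n q]

theorem E_mul_mem {x : PresentedDouble k n q} (hx : x ∈ triangular k n q) :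
    gE * x ∈ triangular k n q := by
  refine mul_mem_of_commutation (fun u => ?_) (fun x hx hE => ?_) (fun x hx hE => ?_)
    (fun x _ hE => ?_) hx
  · rw [← inclUq_E, ← map_mul]; exact inclUq_mem _
  · rw [← mul_assoc, E_a, sub_mul, smul_mul_assoc, smul_mul_assoc, mul_assoc]
    exact sub_mem (Submodule.smul_mem _ _ (a_mul_mem hE)) (Submodule.smul_mem _ _ (c_mul_mem hx))
  · rw [← mul_assoc, E_b, sub_mul, add_mul, smul_mul_assoc, smul_mul_assoc, smul_mul_assoc,
      mul_assoc, mul_assoc]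
    exact sub_mem (add_mem (Submodule.smul_mem _ _ (b_mul_mem hE))
      (Submodule.smul_mem _ _ (a_mul_mem (K_mul_mem hx)))) (Submodule.smul_mem _ _ (d_mul_mem hx))
  · rw [← mul_assoc, E_c, smul_mul_assoc, mul_assoc]; exact Submodule.smul_mem _ _ (c_mul_mem hE)

theorem F_mul_mem {x : PresentedDouble k n q} (hx : x ∈ triangular k n q) :
    gF * x ∈ triangular k n q := by
  refine mul_mem_of_commutation (fun u => ?_) (fun x hx hF => ?_) (fun x _ hF => ?_)
    (fun x hx hF => ?_) hx
  · rw [← inclUq_F, ← map_mul]; exact inclUq_mem _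
  · rw [← mul_assoc, F_a, add_mul, smul_mul_assoc, mul_assoc]
    exact add_mem (Submodule.smul_mem _ _ (a_mul_mem hF)) (b_mul_mem hx)
  · rw [← mul_assoc, F_b, smul_mul_assoc, mul_assoc]; exact Submodule.smul_mem _ _ (b_mul_mem hF)
  · rw [← mul_assoc, F_c, add_mul, sub_mul, smul_mul_assoc, mul_assoc, mul_assoc]
    exact add_mem (sub_mem (Submodule.smul_mem _ _ (c_mul_mem hF))
      (a_mul_mem (pow_mul_mem (fun _ => K_mul_mem) _ _ hx))) (d_mul_mem hx)

theorem triangular_eq_top : triangular k n q = ⊤ := by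
  refine Submodule.eq_top_iff'.2 fun x => ?_
  obtain ⟨x, rfl⟩ := RingQuot.mkAlgHom_surjective k (DRel k n q) x
  have key : ∀ y ∈ triangular k n q, RingQuot.mkAlgHom k (DRel k n q) x * y ∈ triangular k n q := by
    induction x using FreeAlgebra.induction with
    | grade0 r =>
      intro y hy
      rw [AlgHom.commutes, ← Algebra.smul_def]
      exact Submodule.smul_mem _ _ hy
    | grade1 g =>
      intro y hy
      cases g
      · exact a_mul_mem hy
      · exact b_mul_mem hy
      · exact c_mul_mem hy
      · exact d_mul_mem hy
      · exact E_mul_mem hy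
      · exact F_mul_mem hy
      · exact K_mul_mem hy
    | mul x y hx hy => intro z hz; rw [map_mul, mul_assoc]; exact hx _ (hy _ hz)
    | add x y hx hy => intro z hz; rw [map_add, add_mul]; exact add_mem (hx _ hz) (hy _ hz)
  simpa using key 1 (by simpa using inclUq_mem (k := k) (n := n) (q := q) 1)

theorem dualPart_le : dualPart k n q ≤ Submodule.span k (Set.range
    fun t : Fin n × Fin n × Fin n => ga ^ (t.1 : ℕ) * gb ^ (t.2.1 : ℕ) * gc ^ (t.2.2 : ℕ)) :=
  span_range_pow_le k (Uq.n_pos n q) (Or.inr a_pow) (Or.inl b_pow) (Or.inl c_pow)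

variable (k n q) in
/-- The multiplication map `(aˢ bᵗ cʳ) ⊗ u ↦ aˢ bᵗ cʳ u`, with exponents below `n`. -/
noncomputable def triangularMap :
    (Fin n × Fin n × Fin n → k) ⊗[k] Uq k n q →ₗ[k] PresentedDouble k n q :=
  TensorProduct.lift ((LinearMap.mul k _).compl₁₂ (Fintype.linearCombination k
    fun t : Fin n × Fin n × Fin n => ga ^ (t.1 : ℕ) * gb ^ (t.2.1 : ℕ) * gc ^ (t.2.2 : ℕ))
    (inclUq k n q).toLinearMap)

theorem triangularMap_surjective : Function.Surjective (triangularMap k n q) := by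
  rw [← LinearMap.range_eq_top, eq_top_iff, ← triangular_eq_top, triangular, Submodule.mul_le]
  rintro y hy _ ⟨u, rfl⟩
  have hy' := dualPart_le hy
  rw [← Fintype.range_linearCombination] at hy'
  obtain ⟨v, rfl⟩ := hy'
  exact ⟨v ⊗ₜ u, rfl⟩

instance : FiniteDimensional k (PresentedDouble k n q) :=
  Module.Finite.of_surjective _ (triangularMap_surjective (k := k) (n := n) (q := q))

variable (k n q) in
theorem finrank_le : Module.finrank k (PresentedDouble k n q) ≤ n ^ 3 * n ^ 3 := by
  refine (LinearMap.finrank_le_finrank_of_surjective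
    (triangularMap_surjective (k := k) (n := n) (q := q))).trans_eq ?_
  rw [Module.finrank_tensorProduct, Uq.finrank_eq]
  congr 1
  simp; ring

variable (k n q) in
/-- The canonical map to the Drinfel'd double. -/
noncomputable def toDouble : PresentedDouble k n q →ₐ[k] DUq k n q :=
  RingQuot.liftAlgHom k ⟨FreeAlgebra.lift k (DUq.gen k n q), fun _ _ hxy => DUq.lift_gen_rel hxy⟩

@[simp] theorem toDouble_gen (x : DGen) : toDouble k n q (gen k n q x) = DUq.gen k n q x := by
  rw [toDouble, gen, RingQuot.liftAlgHom_mkAlgHom_apply, FreeAlgebra.lift_ι_apply]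

open DrinfeldDouble in
theorem inclDual_mem_range (p : DualCop k (Uq k n q)) :
    inclDual k _ p ∈ (toDouble k n q).range := by
  have hmem : ∀ i j, inclDual k _ (Uq.coeff k n q i j) ∈ (toDouble k n q).range := by
    intro i j
    fin_cases i <;> fin_cases j
    exacts [⟨ga, toDouble_gen _⟩, ⟨gb, toDouble_gen _⟩, ⟨gc, toDouble_gen _⟩, ⟨gd, toDouble_gen _⟩]
  have hp : p ∈ Submodule.span k (Set.range fun t : Fin n × Fin n × Fin n =>
      Uq.coeffMono k n q t.1 t.2.1 t.2.2) := by rw [Uq.span_coeffMono]; trivial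
  induction hp using Submodule.span_induction with
  | mem x hx =>
    obtain ⟨t, rfl⟩ := hx
    simp only [Uq.coeffMono, map_mul, map_pow]
    exact mul_mem (mul_mem (pow_mem (hmem _ _) _) (pow_mem (hmem _ _) _)) (pow_mem (hmem _ _) _)
  | zero => rw [map_zero]; exact zero_mem _
  | add x y _ _ hx hy => rw [map_add]; exact add_mem hx hy
  | smul c x _ hx => rw [map_smul]; exact Subalgebra.smul_mem _ hx c

open DrinfeldDouble in
theorem incl_mem_range (x : Uq k n q) : incl k _ x ∈ (toDouble k n q).range := by
  induction x using Uq.induction with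
  | h1 c => rw [AlgHom.commutes]; exact Subalgebra.algebraMap_mem _ c
  | hE => exact ⟨gE, toDouble_gen _⟩
  | hF => exact ⟨gF, toDouble_gen _⟩
  | hK => exact ⟨gK, toDouble_gen _⟩
  | hmul x y hx hy => rw [map_mul]; exact mul_mem hx hy
  | hadd x y hx hy => rw [map_add]; exact add_mem hx hy

theorem toDouble_surjective : Function.Surjective (toDouble k n q) := by
  intro x
  rw [← AlgHom.mem_range]
  induction x using DrinfeldDouble.induction with
  | h0 => exact zero_mem _
  | hmk p a =>
    rw [DrinfeldDouble.mk_eq_mul]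
    exact mul_mem (inclDual_mem_range p) (incl_mem_range a)
  | hadd x y hx hy => exact add_mem hx hy

theorem finrank_double : Module.finrank k (DUq k n q) = n ^ 3 * n ^ 3 := by
  refine (Module.finrank_tensorProduct (R := k) (M := DualCop k (Uq k n q))
    (M' := Uq k n q)).trans ?_
  rw [Uq.finrank_dualCop, Uq.finrank_eq]

theorem toDouble_bijective : Function.Bijective (toDouble k n q) := by
  have : FiniteDimensional k (DUq k n q) :=
    inferInstanceAs (FiniteDimensional k (DualCop k (Uq k n q) ⊗[k] Uq k n q))
  have h1 : Module.finrank k (PresentedDouble k n q) = Module.finrank k (DUq k n q) := by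
    refine le_antisymm ?_
      (LinearMap.finrank_le_finrank_of_surjective (f := (toDouble k n q).toLinearMap)
        toDouble_surjective)
    rw [finrank_double]
    exact finrank_le k n q
  exact ⟨(LinearMap.injective_iff_surjective_of_finrank_eq_finrank h1
    (f := (toDouble k n q).toLinearMap)).2 toDouble_surjective, toDouble_surjective⟩

end PresentedDouble

end QDouble

theorem theoremA {k : Type*} [Field k] (n : ℕ) (q : k) [OddPrimitiveRoot n q] :
    -- the presentation by generators and relations
    (∃ Φ : PresentedDouble k n q ≃ₐ[k] DUq k n q,
      Φ (PresentedDouble.gen k n q .a) = DUq.a k n q ∧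
      Φ (PresentedDouble.gen k n q .b) = DUq.b k n q ∧
      Φ (PresentedDouble.gen k n q .c) = DUq.c k n q ∧
      Φ (PresentedDouble.gen k n q .d) = DUq.d k n q ∧
      Φ (PresentedDouble.gen k n q .E) = DUq.E k n q ∧
      Φ (PresentedDouble.gen k n q .F) = DUq.F k n q ∧
      Φ (PresentedDouble.gen k n q .K) = DUq.K k n q) ∧
    -- `Ki` is the inverse of `K`
    (DUq.K k n q * DUq.Ki k n q = 1 ∧ DUq.Ki k n q * DUq.K k n q = 1) ∧
    -- the comultiplication
    (comul (R := k) (DUq.a k n q) = DUq.a k n q ⊗ₜ[k] DUq.a k n q + DUq.c k n q ⊗ₜ[k] DUq.b k n q ∧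
      comul (R := k) (DUq.b k n q) = DUq.b k n q ⊗ₜ[k] DUq.a k n q + DUq.d k n q ⊗ₜ[k] DUq.b k n q ∧
      comul (R := k) (DUq.c k n q) = DUq.a k n q ⊗ₜ[k] DUq.c k n q + DUq.c k n q ⊗ₜ[k] DUq.d k n q ∧
      comul (R := k) (DUq.d k n q) = DUq.b k n q ⊗ₜ[k] DUq.c k n q + DUq.d k n q ⊗ₜ[k] DUq.d k n q ∧
      comul (R := k) (DUq.K k n q) = DUq.K k n q ⊗ₜ[k] DUq.K k n q ∧
      comul (R := k) (DUq.E k n q) = 1 ⊗ₜ[k] DUq.E k n q + DUq.E k n q ⊗ₜ[k] DUq.K k n q ∧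
      comul (R := k) (DUq.F k n q) = DUq.Ki k n q ⊗ₜ[k] DUq.F k n q + DUq.F k n q ⊗ₜ[k] 1) ∧
    -- the counit
    (counit (R := k) (DUq.a k n q) = 1 ∧
      counit (R := k) (DUq.b k n q) = 0 ∧
      counit (R := k) (DUq.c k n q) = 0 ∧
      counit (R := k) (DUq.d k n q) = 1 ∧
      counit (R := k) (DUq.E k n q) = 0 ∧
      counit (R := k) (DUq.F k n q) = 0 ∧
      counit (R := k) (DUq.K k n q) = 1) ∧
    -- the antipode
    (antipode k (DUq.a k n q) = DUq.d k n q ∧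
      antipode k (DUq.b k n q) = -(q⁻¹ • DUq.b k n q) ∧
      antipode k (DUq.c k n q) = -(q • DUq.c k n q) ∧
      antipode k (DUq.d k n q) = DUq.a k n q ∧
      antipode k (DUq.K k n q) = DUq.Ki k n q ∧
      antipode k (DUq.E k n q) = -(DUq.E k n q * DUq.Ki k n q) ∧
      antipode k (DUq.F k n q) = -(DUq.K k n q * DUq.F k n q)) := by
  refine ⟨⟨AlgEquiv.ofBijective _ PresentedDouble.toDouble_bijective,
      PresentedDouble.toDouble_gen _, PresentedDouble.toDouble_gen _,
      PresentedDouble.toDouble_gen _, PresentedDouble.toDouble_gen _,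
      PresentedDouble.toDouble_gen _, PresentedDouble.toDouble_gen _,
      PresentedDouble.toDouble_gen _⟩, ⟨?_, ?_⟩, ?_, ?_, ?_⟩
  · rw [DUq.K_eq, DUq.Ki_eq, ← map_mul, Uq.K_Ki, map_one]
  · rw [DUq.K_eq, DUq.Ki_eq, ← map_mul, Uq.Ki_K, map_one]
  · simp only [DUq.a_eq, DUq.b_eq, DUq.c_eq, DUq.d_eq, DUq.E_eq, DUq.F_eq, DUq.K_eq, DUq.Ki_eq,
      DrinfeldDouble.comul_inclDual, DrinfeldDouble.comul_incl, Uq.comul_coeff, Uq.comul_E,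
      Uq.comul_F, Uq.comul_K, Fin.sum_univ_two, map_add, TensorProduct.map_tmul,
      AlgHom.toLinearMap_apply, map_one, and_self]
  · simp [DUq.a_eq, DUq.b_eq, DUq.c_eq, DUq.d_eq, DUq.E_eq, DUq.F_eq, DUq.K_eq,
      DrinfeldDouble.counit_inclDual, DrinfeldDouble.counit_incl, Uq.coeff_apply]
  · simp only [DUq.a_eq, DUq.b_eq, DUq.c_eq, DUq.d_eq, DUq.E_eq, DUq.F_eq, DUq.K_eq, DUq.Ki_eq,
      DrinfeldDouble.antipode_inclDual, DrinfeldDouble.antipode_incl, Uq.antipode_coeffA,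
      Uq.antipode_coeffB, Uq.antipode_coeffC, Uq.antipode_coeffD, Uq.antipode_E, Uq.antipode_F,
      Uq.antipode_K, map_neg, map_smul, map_mul, and_self]
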